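/- Consider a discrete memoryless cognitive interference channel with state: finite input alphabets $\mathcal X_1,\mathcal X_2$, a finite state alphabet $\mathcal S$, finite output alphabets $\mathcal Y,\mathcal Z$, a state distribution $P_S$ and transition probabilities $P_{YZ|X_1X_2S}$. The state sequence $S^n$ is i.i.d. with distribution $P_S$ and is known noncausally to transmitter 2 only. A $(2^{nR_1},2^{nR_2},n)$ code consists of message sets $\mathcal W_k$ with $|\mathcal W_k|=\lceil 2^{nR_k}\rceil$ for $k=1,2$, encoders $f_1:\mathcal W_1\to\mathcal X_1^n$ and $f_2:\mathcal W_1\times\mathcal W_2\times\mathcal S^n\to\mathcal X_2^n$, and decoders $g_1:\mathcal Y^n\to\mathcal W_1$ and $g_2:\mathcal Z^n\to\mathcal W_1\times\mathcal W_2$. For independent, uniformly distributed messages $W_1,W_2$, its error probability is $P_e^{(n)}=\Pr\{(g_1(Y^n),g_2(Z^n))\ne(W_1,(W_1,W_2))\}$. A pair $(R_1,R_2)$ of nonnegative rates is achievable if there is a sequence of $(2^{nR_1},2^{nR_2},n)$ codes with $P_e^{(n)}\to0$ as $n\to\infty$, and the capacity region is the closure of the set of achievable pairs. Suppose that the channel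 is degraded, i.e. $P_{YZ|X_1X_2S}=P_{Z|X_1X_2S}P_{Y|Z}$ for some transition law $P_{Y|Z}$, and semideterministic, i.e. $P_{Z|X_1X_2S}$ only takes the values $0$ and $1$. Then the capacity region is the set of all pairs $(R_1,R_2)$ with $R_1,R_2\ge0$ satisfying \begin{align*} R_1&\le I(X_1T;Y)-I(T;S|X_1),\\ R_2&\le H(Z|X_1TS),\\ R_2&\le H(Z|X_1)-I(TZ;S|X_1) \end{align*} for some distribution $P_{X_1STX_2YZ}=P_{X_1}P_SP_{TX_2|SX_1}P_{Z|X_1X_2S}P_{Y|Z}$, where $T$ is an auxiliary random variable with values in a finite set $\mathcal T$, $|\mathcal T|\le|\mathcal X_1||\mathcal X_2||\mathcal S|+1$. The same region results if $\mathcal T$ is allowed to be an arbitrary finite set. (All information quantities are in bits.) -/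

import Mathlib

open scoped BigOperators Topology

noncomputable section

namespace CognitiveIC

/-! ### Entropy and mutual information on a finite probability space (logarithms to base 2) -/

/-- The probability mass function of the random variable `A` under the mass function `p` on `Ω`. -/
def law {Ω α : Type*} [Fintype Ω] (p : Ω → ℝ) (A : Ω → α) (a : α) : ℝ :=
  open Classical in ∑ ω, if A ω = a then p ω else 0

/-- Entropy `H(A) = - ∑ₐ P(a) log₂ P(a)`. -/
def entropy {Ω α : Type*} [Fintype Ω] [Fintype α] (p : Ω → ℝ) (A : Ω → α) : ℝ :=
  -∑ a, law p A a * Real.logb 2 (law p A a)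

/-- Conditional entropy `H(A|B) = - ∑ P(a,b) log₂ (P(a,b) / P(b))`. -/
def condEntropy {Ω α β : Type*} [Fintype Ω] [Fintype α] [Fintype β]
    (p : Ω → ℝ) (A : Ω → α) (B : Ω → β) : ℝ :=
  -∑ a, ∑ b, law p (fun ω => (A ω, B ω)) (a, b) *
      Real.logb 2 (law p (fun ω => (A ω, B ω)) (a, b) / law p B b)

/-- Mutual information `I(A;B) = H(A) - H(A|B)`. -/
def mutualInfo {Ω α β : Type*} [Fintype Ω] [Fintype α] [Fintype β]
    (p : Ω → ℝ) (A : Ω → α) (B : Ω → β) : ℝ :=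
  entropy p A - condEntropy p A B

/-- Conditional mutual information `I(A;B|C) = H(A|C) - H(A|B,C)`. -/
def condMutualInfo {Ω α β γ : Type*} [Fintype Ω] [Fintype α] [Fintype β] [Fintype γ]
    (p : Ω → ℝ) (A : Ω → α) (B : Ω → β) (C : Ω → γ) : ℝ :=
  condEntropy p A C - condEntropy p A (fun ω => (B ω, C ω))

/-! ### The channel -/

/-- A discrete memoryless cognitive interference channel with i.i.d. state: the law `P_S` of the
state and the transition probabilities `P_{YZ|X₁X₂S}`. -/
structure Channel (X₁ X₂ S Y Z : Type*) [Fintype S] [Fintype Y] [Fintype Z] where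
  /-- `P_S` -/
  stateLaw : S → ℝ
  stateLaw_mem : stateLaw ∈ stdSimplex ℝ S
  /-- `trans x₁ x₂ s (y, z) = P_{YZ|X₁X₂S}(y,z|x₁,x₂,s)` -/
  trans : X₁ → X₂ → S → Y × Z → ℝ
  trans_mem : ∀ x₁ x₂ s, trans x₁ x₂ s ∈ stdSimplex ℝ (Y × Z)

namespace Channel

/-- The marginal `P_{Z|X₁X₂S}`. -/
def transZ {X₁ X₂ S Y Z : Type*} [Fintype S] [Fintype Y] [Fintype Z]
    (ch : Channel X₁ X₂ S Y Z) (x₁ : X₁) (x₂ : X₂) (s : S) (z : Z) : ℝ :=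
  ∑ y, ch.trans x₁ x₂ s (y, z)

/-- Degradedness: `P_{YZ|X₁X₂S} = P_{Z|X₁X₂S} P_{Y|Z}` for some transition law `P_{Y|Z}`. -/
def IsDegraded {X₁ X₂ S Y Z : Type*} [Fintype S] [Fintype Y] [Fintype Z]
    (ch : Channel X₁ X₂ S Y Z) : Prop :=
  ∃ K : Z → Y → ℝ, (∀ z, K z ∈ stdSimplex ℝ Y) ∧
    ∀ x₁ x₂ s y z, ch.trans x₁ x₂ s (y, z) = ch.transZ x₁ x₂ s z * K z y

/-- Semideterminism: `P_{Z|X₁X₂S}` only takes the values `0` and `1`. -/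
def IsSemideterministic {X₁ X₂ S Y Z : Type*} [Fintype S] [Fintype Y] [Fintype Z]
    (ch : Channel X₁ X₂ S Y Z) : Prop :=
  ∀ x₁ x₂ s z, ch.transZ x₁ x₂ s z = 0 ∨ ch.transZ x₁ x₂ s z = 1

end Channel

/-! ### Codes, achievable rates, capacity region -/

/-- A block code of length `n` with `M₁` and `M₂` messages; the state sequence is known
noncausally to encoder 2 only. -/
structure Code (X₁ X₂ S Y Z : Type*) (M₁ M₂ n : ℕ) where
  enc₁ : Fin M₁ → (Fin n → X₁)
  enc₂ : Fin M₁ → Fin M₂ → (Fin n → S) → (Fin n → X₂)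
  dec₁ : (Fin n → Y) → Fin M₁
  dec₂ : (Fin n → Z) → Fin M₁ × Fin M₂

/-- The probability, over the i.i.d. state sequence and the memoryless channel, that the
decoders do not output `(w₁, w₁, w₂)` when the message pair is `(w₁, w₂)`. -/
def Code.errorProbAt {X₁ X₂ S Y Z : Type*} [Fintype S] [Fintype Y] [Fintype Z] {M₁ M₂ n : ℕ}
    (c : Code X₁ X₂ S Y Z M₁ M₂ n) (ch : Channel X₁ X₂ S Y Z) (w₁ : Fin M₁) (w₂ : Fin M₂) : ℝ :=
  ∑ s : Fin n → S, ∑ y : Fin n → Y, ∑ z : Fin n → Z,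
    if c.dec₁ y = w₁ ∧ c.dec₂ z = (w₁, w₂) then 0
    else (∏ i, ch.stateLaw (s i)) *
      ∏ i, ch.trans (c.enc₁ w₁ i) (c.enc₂ w₁ w₂ s i) (s i) (y i, z i)

/-- The error probability averaged over independent, uniformly distributed messages. -/
def Code.errorProb {X₁ X₂ S Y Z : Type*} [Fintype S] [Fintype Y] [Fintype Z] {M₁ M₂ n : ℕ}
    (c : Code X₁ X₂ S Y Z M₁ M₂ n) (ch : Channel X₁ X₂ S Y Z) : ℝ :=
  1 / ((M₁ : ℝ) * (M₂ : ℝ)) * ∑ w₁, ∑ w₂, c.errorProbAt ch w₁ w₂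

/-- The number of messages of a block code of length `n` and rate `R`: `2^{nR}`, rounded up. -/
def numMessages (n : ℕ) (R : ℝ) : ℕ := ⌈(2 : ℝ) ^ ((n : ℝ) * R)⌉₊

/-- A pair of (nonnegative) rates is achievable if some sequence of `(2^{nR₁}, 2^{nR₂}, n)` codes
has vanishing error probability. -/
def Channel.Achievable {X₁ X₂ S Y Z : Type*} [Fintype S] [Fintype Y] [Fintype Z]
    (ch : Channel X₁ X₂ S Y Z) (R : ℝ × ℝ) : Prop :=
  0 ≤ R.1 ∧ 0 ≤ R.2 ∧
    ∃ c : (n : ℕ) → Code X₁ X₂ S Y Z (numMessages n R.1) (numMessages n R.2) n,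
      Filter.Tendsto (fun n => (c n).errorProb ch) Filter.atTop (𝓝 0)

/-- The capacity region: the closure of the set of achievable rate pairs. -/
def Channel.capacityRegion {X₁ X₂ S Y Z : Type*} [Fintype S] [Fintype Y] [Fintype Z]
    (ch : Channel X₁ X₂ S Y Z) : Set (ℝ × ℝ) :=
  closure {R | ch.Achievable R}

/-! ### The single-letter region -/

/-- The mass function
`P_{X₁STX₂YZ} = P_{X₁} P_S P_{TX₂|SX₁} P_{YZ|X₁X₂S}` for given `P_{X₁}` and `P_{TX₂|SX₁}`. -/
def Channel.jointLaw {X₁ X₂ S Y Z T : Type*} [Fintype S] [Fintype Y] [Fintype Z]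
    (ch : Channel X₁ X₂ S Y Z) (pX₁ : X₁ → ℝ) (q : S → X₁ → T × X₂ → ℝ) :
    X₁ × S × T × X₂ × Y × Z → ℝ :=
  fun (x₁, s, t, x₂, y, z) =>
    pX₁ x₁ * ch.stateLaw s * q s x₁ (t, x₂) * ch.trans x₁ x₂ s (y, z)

/-- The nonnegative rate pairs with
`R₁ ≤ I(X₁T;Y) - I(T;S|X₁)`, `R₂ ≤ H(Z|X₁TS)` and `R₂ ≤ H(Z|X₁) - I(TZ;S|X₁)`
for some distribution `P_{X₁} P_S P_{TX₂|SX₁} P_{YZ|X₁X₂S}`, the auxiliary variable `T` having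
the alphabet `T`. -/
def Channel.rateRegion {X₁ X₂ S Y Z : Type*} [Fintype X₁] [Fintype X₂] [Fintype S] [Fintype Y]
    [Fintype Z] (ch : Channel X₁ X₂ S Y Z) (T : Type*) [Fintype T] : Set (ℝ × ℝ) :=
  {R | 0 ≤ R.1 ∧ 0 ≤ R.2 ∧
    ∃ pX₁ ∈ stdSimplex ℝ X₁, ∃ q : S → X₁ → T × X₂ → ℝ,
      (∀ s x₁, q s x₁ ∈ stdSimplex ℝ (T × X₂)) ∧
      let P : X₁ × S × T × X₂ × Y × Z → ℝ := ch.jointLaw pX₁ q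
      let vX₁ : X₁ × S × T × X₂ × Y × Z → X₁ := fun ω => ω.1
      let vS : X₁ × S × T × X₂ × Y × Z → S := fun ω => ω.2.1
      let vT : X₁ × S × T × X₂ × Y × Z → T := fun ω => ω.2.2.1
      let vY : X₁ × S × T × X₂ × Y × Z → Y := fun ω => ω.2.2.2.2.1
      let vZ : X₁ × S × T × X₂ × Y × Z → Z := fun ω => ω.2.2.2.2.2
      R.1 ≤ mutualInfo P (fun ω => (vX₁ ω, vT ω)) vY - condMutualInfo P vT vS vX₁ ∧
      R.2 ≤ condEntropy P vZ (fun ω => (vX₁ ω, vT ω, vS ω)) ∧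
      R.2 ≤ condEntropy P vZ vX₁ - condMutualInfo P (fun ω => (vT ω, vZ ω)) vS vX₁}

end CognitiveIC

end

/-!
The capacity region of the degraded semideterministic cognitive interference channel with state.
All information quantities are written as combinations of joint entropies `entropy p A` on a finite
probability space, `rateOne`, `rateTwo`, `rateThree` being the three bounds of the region.

*The third bound is redundant.* By degradedness `I(T;Y|X₁) ≤ I(T;Z|X₁)` (`data_processing`). If
`I(T;Y|X₁) ≥ I(T;S|X₁)`, it follows that `H(Z|X₁TS) ≤ H(Z|X₁) - I(TZ;S|X₁)`, and the third bound
holds automatically. Otherwise replacing `T` by a constant enlarges the first two bounds, and makes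
the last two coincide. So the region is determined by the first two bounds
(`relaxedRegion_subset`). They involve `T` through `P_{X₁X₂S}` and two sums over the values of `T`,
which gives the bound on the alphabet of `T` (`exists_sparse_reweighting`): among the reweightings
of these values that fix `P_{X₁X₂S}` and the first sum, and do not decrease the second, one with
small support exists. With bounded alphabets the region is closed
(`isClosed_iUnion_rateRegion`).

*Converse.* With `Tᵢ = (W₁, Y^{i-1}, S_{i+1}^n)`, Fano's inequality and the Csiszár sum identity
(`csiszar_sum`) bound `R₁`. For `R₂`, Fano's inequality gives `H(Zⁿ|W₁Sⁿ)`, and degradedness allows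
one to pass from `Z^{i-1}` to `Y^{i-1}` in the conditions of its chain rule (`condEntropy_seq_le`).
A uniformly distributed time index, made part of `T`, turns the averages into a single-letter
expression (`convVars_mem`).

*Achievability.* Every message `w₁` has a random codeword `x` and about `2^{nI(X₁T;S)}` random
auxiliary codewords `t`, so that for typical state sequences some `t` is jointly typical with
`(x, s)`. Output sequences `z` are coloured at random with the messages `w₂`. As `Z` is a function
of the inputs and the state, encoder 2 can steer the channel to any of the `2^{nH(Z|X₁TS)}` typical
outputs given `(x, s, t)`, and it chooses one of colour `w₂`. Decoder 1 looks for the auxiliary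
codeword, which is possible if `R₁ + I(X₁T;S) < I(X₁T;Y)`, and `I(X₁T;S) = I(T;S|X₁)` because
`X₁` and `S` are independent. Decoder 2 reads `w₂` off the colour, and finds `w₁` by degrading its
output and applying decoder 1. `RandomCode.exists_code` is the one-shot form of this scheme,
`exists_good_randomCode` supplies its ingredients from bounds on information densities, and these
concentrate for product laws by Chebyshev's inequality (`eventually_sum_ind_le`).
-/

open scoped BigOperators Topology

noncomputable section

namespace CognitiveIC

/-! ### Entropies on a finite space -/

section Law

variable {Ω α β : Type*} [Fintype Ω] {p : Ω → ℝ}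

theorem law_nonneg (hp : ∀ ω, 0 ≤ p ω) (A : Ω → α) (a : α) : 0 ≤ law p A a := by
  unfold law
  exact Finset.sum_nonneg fun ω _ => by split_ifs <;> simp [hp]

theorem sum_law_mul [Fintype α] (p : Ω → ℝ) (A : Ω → α) (f : α → ℝ) :
    ∑ a, law p A a * f a = ∑ ω, p ω * f (A ω) := by
  classical
  unfold law
  simp_rw [Finset.sum_mul]
  rw [Finset.sum_comm]
  refine Finset.sum_congr rfl fun ω _ => ?_
  rw [Finset.sum_eq_single (A ω)] <;> simp +contextual [eq_comm]

theorem sum_law [Fintype α] (p : Ω → ℝ) (A : Ω → α) : ∑ a, law p A a = ∑ ω, p ω := by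
  simpa using sum_law_mul p A fun _ => 1

theorem law_congr {A : Ω → α} {B : Ω → β} {a : α} {b : β} (h : ∀ ω, A ω = a ↔ B ω = b) :
    law p A a = law p B b := by
  classical
  unfold law
  exact Finset.sum_congr rfl fun ω _ => by simp only [h]

theorem law_id (p : Ω → ℝ) : law p id = p := by
  classical
  funext ω
  simp [law]

theorem law_law [Fintype α] (p : Ω → ℝ) (A : Ω → α) (g : α → β) :
    law (law p A) g = law p (fun ω => g (A ω)) := by
  classical
  funext b
  have := sum_law_mul p A fun a => if g a = b then 1 else 0
  simpa [law] using this

theorem le_law (hp : ∀ ω, 0 ≤ p ω) (A : Ω → α) (ω : Ω) : p ω ≤ law p A (A ω) := by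
  classical
  unfold law
  refine le_trans ?_ (Finset.single_le_sum (f := fun ω' => if A ω' = A ω then p ω' else 0)
    (fun ω' _ => by split_ifs <;> simp [hp]) (Finset.mem_univ ω))
  simp

theorem law_pos (hp : ∀ ω, 0 ≤ p ω) (A : Ω → α) {ω : Ω} (h : 0 < p ω) : 0 < law p A (A ω) :=
  h.trans_le (le_law hp A ω)

theorem law_le_law_of_imp (hp : ∀ ω, 0 ≤ p ω) {A : Ω → α} {B : Ω → β} {a : α} {b : β}
    (h : ∀ ω, A ω = a → B ω = b) : law p A a ≤ law p B b := by
  classical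
  unfold law
  refine Finset.sum_le_sum fun ω _ => ?_
  by_cases h1 : A ω = a
  · simp [h1, h ω h1]
  · simp only [h1, if_false]
    split_ifs <;> simp [hp]

theorem sum_law_fst [Fintype α] (p : Ω → ℝ) (A : Ω → α) (B : Ω → β) (b : β) :
    ∑ a, law p (fun ω => (A ω, B ω)) (a, b) = law p B b := by
  classical
  unfold law
  rw [Finset.sum_comm]
  refine Finset.sum_congr rfl fun ω _ => ?_
  rw [Finset.sum_eq_single (A ω)] <;> simp +contextual [eq_comm]

theorem sum_law_snd [Fintype β] (p : Ω → ℝ) (A : Ω → α) (B : Ω → β) (a : α) :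
    ∑ b, law p (fun ω => (A ω, B ω)) (a, b) = law p A a := by
  rw [← sum_law_fst p B A a]
  exact Finset.sum_congr rfl fun b _ => law_congr fun ω => by simp [and_comm]

theorem law_mem_stdSimplex [Fintype α] (hp : p ∈ stdSimplex ℝ Ω) (A : Ω → α) :
    law p A ∈ stdSimplex ℝ α :=
  ⟨law_nonneg hp.1 A, by rw [sum_law, hp.2]⟩

theorem law_const (p : Ω → ℝ) (c : β) : law p (fun _ => c) c = ∑ ω, p ω := by
  simp [law]

end Law

section Entropy

variable {Ω α β γ : Type*} [Fintype Ω] [Fintype α] [Fintype β] [Fintype γ] {p : Ω → ℝ}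

/-- Entropy as an expectation over the underlying space. -/
theorem entropy_eq (p : Ω → ℝ) (A : Ω → α) :
    entropy p A = -∑ ω, p ω * Real.logb 2 (law p A (A ω)) := by
  rw [entropy, sum_law_mul p A fun a => Real.logb 2 (law p A a)]

/-- Random variables that generate the same partition have the same entropy. -/
theorem entropy_congr (p : Ω → ℝ) {A : Ω → α} {B : Ω → β}
    (h : ∀ ω ω', A ω = A ω' ↔ B ω = B ω') : entropy p A = entropy p B := by
  rw [entropy_eq, entropy_eq]
  congr 1
  exact Finset.sum_congr rfl fun ω _ => by rw [law_congr fun ω' => h ω' ω]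

theorem entropy_law (p : Ω → ℝ) (A : Ω → α) (g : α → β) :
    entropy (law p A) g = entropy p (fun ω => g (A ω)) := by
  unfold entropy
  rw [law_law]

theorem condEntropy_eq (hp : ∀ ω, 0 ≤ p ω) (A : Ω → α) (B : Ω → β) :
    condEntropy p A B = entropy p (fun ω => (A ω, B ω)) - entropy p B := by
  have h := sum_law_mul p (fun ω => (A ω, B ω)) fun c =>
    Real.logb 2 (law p (fun ω => (A ω, B ω)) c / law p B c.2)
  rw [Fintype.sum_prod_type] at h
  rw [condEntropy, h, entropy_eq, entropy_eq, sub_neg_eq_add, neg_add_eq_sub, ← neg_sub,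
    ← Finset.sum_sub_distrib]
  congr 1
  refine Finset.sum_congr rfl fun ω _ => ?_
  rcases (hp ω).eq_or_lt with h0 | h0
  · simp [← h0]
  · rw [Real.logb_div (law_pos hp (fun ω => (A ω, B ω)) h0).ne' (law_pos hp B h0).ne', mul_sub]

theorem mutualInfo_eq (hp : ∀ ω, 0 ≤ p ω) (A : Ω → α) (B : Ω → β) :
    mutualInfo p A B = entropy p A + entropy p B - entropy p (fun ω => (A ω, B ω)) := by
  rw [mutualInfo, condEntropy_eq hp]
  ring

theorem condMutualInfo_eq (hp : ∀ ω, 0 ≤ p ω) (A : Ω → α) (B : Ω → β) (C : Ω → γ) :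
    condMutualInfo p A B C = entropy p (fun ω => (A ω, C ω)) + entropy p (fun ω => (B ω, C ω))
      - entropy p (fun ω => (A ω, B ω, C ω)) - entropy p C := by
  rw [condMutualInfo, condEntropy_eq hp, condEntropy_eq hp]
  ring

theorem entropy_le_pair (hp : ∀ ω, 0 ≤ p ω) (A : Ω → α) (B : Ω → β) :
    entropy p B ≤ entropy p (fun ω => (A ω, B ω)) := by
  rw [entropy_eq, entropy_eq]
  refine neg_le_neg (Finset.sum_le_sum fun ω _ => ?_)
  rcases (hp ω).eq_or_lt with h0 | h0
  · simp [← h0]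
  · refine mul_le_mul_of_nonneg_left ?_ h0.le
    exact Real.logb_le_logb_of_le one_lt_two (law_pos hp _ h0)
      (law_le_law_of_imp hp fun ω' h => (Prod.ext_iff.1 h).2)

/-- Gibbs' inequality, for a sub-normalized second argument. -/
theorem sum_mul_logb_le {ι : Type*} [Fintype ι] {P Q : ι → ℝ} (hP : ∀ i, 0 ≤ P i)
    (hQ : ∀ i, 0 ≤ Q i) (hPQ : ∀ i, 0 < P i → 0 < Q i) (h : ∑ i, Q i ≤ ∑ i, P i) :
    ∑ i, P i * Real.logb 2 (Q i) ≤ ∑ i, P i * Real.logb 2 (P i) := by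
  have h2 : (0 : ℝ) < Real.log 2 := Real.log_pos one_lt_two
  have key : ∀ i, P i * Real.logb 2 (Q i) - P i * Real.logb 2 (P i)
      ≤ (Q i - P i) / Real.log 2 := by
    intro i
    rcases (hP i).eq_or_lt with h0 | h0
    · rw [← h0]
      simpa using div_nonneg (hQ i) h2.le
    · have hq := hPQ i h0
      have h1 : Real.log (Q i / P i) ≤ Q i / P i - 1 := Real.log_le_sub_one_of_pos (by positivity)
      rw [← mul_sub, ← Real.logb_div hq.ne' h0.ne', Real.logb, ← mul_div_assoc]
      refine div_le_div_of_nonneg_right ?_ h2.le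
      calc P i * Real.log (Q i / P i) ≤ P i * (Q i / P i - 1) :=
            mul_le_mul_of_nonneg_left h1 h0.le
        _ = Q i - P i := by field_simp
  have := Finset.sum_le_sum fun i (_ : i ∈ Finset.univ) => key i
  rw [Finset.sum_sub_distrib, ← Finset.sum_div, Finset.sum_sub_distrib] at this
  have h3 : (∑ i, Q i - ∑ i, P i) / Real.log 2 ≤ 0 :=
    div_nonpos_of_nonpos_of_nonneg (by linarith) h2.le
  linarith

/-- Submodularity of entropy: conditioning on more does not increase conditional entropy. -/
theorem entropy_submodular (hp : ∀ ω, 0 ≤ p ω) (A : Ω → α) (B : Ω → β) (C : Ω → γ) :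
    entropy p (fun ω => (A ω, B ω, C ω)) + entropy p C
      ≤ entropy p (fun ω => (A ω, C ω)) + entropy p (fun ω => (B ω, C ω)) := by
  set Q : α × β × γ → ℝ := fun i => law p (fun ω => (A ω, C ω)) (i.1, i.2.2) *
    law p (fun ω => (B ω, C ω)) i.2 / law p C i.2.2 with hQ
  have h1 := sum_mul_logb_le (P := law p (fun ω => (A ω, B ω, C ω))) (Q := Q)
    (law_nonneg hp _) (fun i => div_nonneg (mul_nonneg (law_nonneg hp _ _) (law_nonneg hp _ _))
      (law_nonneg hp _ _)) ?_ ?_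
  · rw [sum_law_mul, sum_law_mul p _ fun i => Real.logb 2 (law p (fun ω => (A ω, B ω, C ω)) i)]
      at h1
    simp only [entropy_eq]
    have h2 : ∑ ω, p ω * Real.logb 2 (Q (A ω, B ω, C ω)) =
        ∑ ω, p ω * Real.logb 2 (law p (fun ω => (A ω, C ω)) (A ω, C ω)) +
        ∑ ω, p ω * Real.logb 2 (law p (fun ω => (B ω, C ω)) (B ω, C ω)) -
        ∑ ω, p ω * Real.logb 2 (law p C (C ω)) := by
      rw [← Finset.sum_add_distrib, ← Finset.sum_sub_distrib]
      refine Finset.sum_congr rfl fun ω _ => ?_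
      rcases (hp ω).eq_or_lt with h0 | h0
      · simp [← h0]
      · have a1 := law_pos hp (fun ω => (A ω, C ω)) h0
        have a2 := law_pos hp (fun ω => (B ω, C ω)) h0
        have a3 := law_pos hp C h0
        simp only [hQ]
        rw [Real.logb_div (mul_pos a1 a2).ne' a3.ne', Real.logb_mul a1.ne' a2.ne']
        ring
    linarith
  · intro i hi
    have e1 : law p (fun ω => (A ω, B ω, C ω)) i ≤ law p (fun ω => (A ω, C ω)) (i.1, i.2.2) :=
      law_le_law_of_imp hp fun ω h => by rw [← h]
    have e2 : law p (fun ω => (A ω, B ω, C ω)) i ≤ law p (fun ω => (B ω, C ω)) i.2 :=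
      law_le_law_of_imp hp fun ω h => by rw [← h]
    have e3 : law p (fun ω => (A ω, B ω, C ω)) i ≤ law p C i.2.2 :=
      law_le_law_of_imp hp fun ω h => by rw [← h]
    have := hi.trans_le e1
    have := hi.trans_le e2
    have := hi.trans_le e3
    simp only [hQ]
    positivity
  · rw [sum_law, ← sum_law p C]
    simp only [hQ, Fintype.sum_prod_type]
    simp_rw [mul_div_assoc]
    calc _ = ∑ a, ∑ c, ∑ b, law p (fun ω => (A ω, C ω)) (a, c) *
          (law p (fun ω => (B ω, C ω)) (b, c) / law p C c) := by
          exact Finset.sum_congr rfl fun a _ => Finset.sum_comm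
      _ = ∑ c, ∑ a, law p (fun ω => (A ω, C ω)) (a, c) * (law p C c / law p C c) := by
          rw [Finset.sum_comm]
          simp_rw [← Finset.mul_sum, ← Finset.sum_div, sum_law_fst]
      _ ≤ ∑ c, law p C c := by
          refine Finset.sum_le_sum fun c _ => ?_
          rw [← Finset.sum_mul, sum_law_fst]
          rcases (law_nonneg hp C c).eq_or_lt with h0 | h0
          · simp [← h0]
          · rw [div_self h0.ne', mul_one]

/-- Conditional independence turns submodularity into an equality. -/
theorem entropy_of_condIndep (hp : ∀ ω, 0 ≤ p ω) (A : Ω → α) (B : Ω → β) (C : Ω → γ)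
    (h : ∀ ω, 0 < p ω → law p (fun ω => (A ω, B ω, C ω)) (A ω, B ω, C ω) * law p C (C ω) =
      law p (fun ω => (A ω, C ω)) (A ω, C ω) * law p (fun ω => (B ω, C ω)) (B ω, C ω)) :
    entropy p (fun ω => (A ω, B ω, C ω)) + entropy p C
      = entropy p (fun ω => (A ω, C ω)) + entropy p (fun ω => (B ω, C ω)) := by
  simp only [entropy_eq]
  rw [← neg_add, ← neg_add, ← Finset.sum_add_distrib, ← Finset.sum_add_distrib]
  congr 1
  refine Finset.sum_congr rfl fun ω _ => ?_
  rcases (hp ω).eq_or_lt with h0 | h0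
  · simp [← h0]
  · rw [← mul_add, ← mul_add, ← Real.logb_mul (law_pos hp (fun ω => (A ω, B ω, C ω)) h0).ne'
      (law_pos hp C h0).ne', h ω h0, Real.logb_mul (law_pos hp (fun ω => (A ω, C ω)) h0).ne'
      (law_pos hp (fun ω => (B ω, C ω)) h0).ne']

theorem entropy_const (hp : ∑ ω, p ω = 1) (c : γ) : entropy p (fun _ => c) = 0 := by
  rw [entropy_eq, law_const, hp]
  simp

theorem entropy_of_indep (hp : p ∈ stdSimplex ℝ Ω) (A : Ω → α) (B : Ω → β)
    (h : ∀ a b, law p (fun ω => (A ω, B ω)) (a, b) = law p A a * law p B b) :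
    entropy p (fun ω => (A ω, B ω)) = entropy p A + entropy p B := by
  have := entropy_of_condIndep hp.1 A B (fun _ => ()) fun ω _ => by
    rw [law_const, hp.2, mul_one,
      law_congr (B := fun ω => (A ω, B ω)) (b := (A ω, B ω)) (by simp),
      law_congr (A := fun ω => (A ω, ())) (B := A) (b := A ω) (by simp),
      law_congr (A := fun ω => (B ω, ())) (B := B) (b := B ω) (by simp), h]
  rw [entropy_const hp.2, entropy_congr p (B := fun ω => (A ω, B ω)) (by simp),
      entropy_congr p (A := fun ω => (A ω, ())) (B := A) (by simp),
      entropy_congr p (A := fun ω => (B ω, ())) (B := B) (by simp)] at this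
  linarith

theorem entropy_pair_le (hp : p ∈ stdSimplex ℝ Ω) (A : Ω → α) (B : Ω → β) :
    entropy p (fun ω => (A ω, B ω)) ≤ entropy p A + entropy p B := by
  have := entropy_submodular hp.1 A B (fun _ => ())
  rw [entropy_const hp.2, entropy_congr p (B := fun ω => (A ω, B ω)) (by simp),
      entropy_congr p (A := fun ω => (A ω, ())) (B := A) (by simp),
      entropy_congr p (A := fun ω => (B ω, ())) (B := B) (by simp)] at this
  linarith

/-- Fano's inequality, with the binary entropy bounded by one bit. It is Gibbs' inequality against
the guess that puts half of its mass on `g (B ω)` and spreads the other half evenly. -/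
theorem fano (hp : p ∈ stdSimplex ℝ Ω) (A : Ω → α) (B : Ω → β) (g : β → α) {ε : ℝ}
    (hε : (open Classical in ∑ ω, if g (B ω) = A ω then 0 else p ω) ≤ ε) :
    entropy p (fun ω => (A ω, B ω)) - entropy p B
      ≤ 1 + ε * Real.logb 2 (Fintype.card α) := by
  classical
  have hne : Nonempty Ω := by
    by_contra hcon
    rw [not_nonempty_iff] at hcon
    simpa using hp.2
  obtain ⟨ω₀⟩ := hne
  have hα : 0 < Fintype.card α := Fintype.card_pos_iff.2 ⟨A ω₀⟩
  have hα' : (0 : ℝ) < Fintype.card α := by exact_mod_cast hα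
  have hα1 : (1 : ℝ) ≤ Fintype.card α := by exact_mod_cast hα
  set Q : α × β → ℝ := fun i => (if g i.2 = i.1 then 1 / 2 else 1 / (2 * (Fintype.card α : ℝ))) *
    law p B i.2 with hQ
  have hq : ∀ i : α × β, 0 < (if g i.2 = i.1 then 1 / 2 else 1 / (2 * (Fintype.card α : ℝ))) := by
    intro i; split_ifs <;> positivity
  have h1 := sum_mul_logb_le (P := law p (fun ω => (A ω, B ω))) (Q := Q)
    (law_nonneg hp.1 _) (fun i => mul_nonneg (hq i).le (law_nonneg hp.1 _ _)) ?_ ?_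
  · rw [sum_law_mul, sum_law_mul p _ fun i => Real.logb 2 (law p (fun ω => (A ω, B ω)) i)] at h1
    have h2 : ∑ ω, p ω * Real.logb 2 (Q (A ω, B ω)) =
        ∑ ω, p ω * Real.logb 2 (law p B (B ω)) - 1 -
        (∑ ω, if g (B ω) = A ω then 0 else p ω) * Real.logb 2 (Fintype.card α) := by
      rw [← hp.2, Finset.sum_mul, ← Finset.sum_sub_distrib, ← Finset.sum_sub_distrib]
      refine Finset.sum_congr rfl fun ω _ => ?_
      rcases (hp.1 ω).eq_or_lt with h0 | h0
      · simp [← h0]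
      · simp only [hQ]
        rw [Real.logb_mul (hq (A ω, B ω)).ne' (law_pos hp.1 B h0).ne']
        have l2 : Real.logb 2 (2 : ℝ) = 1 := Real.logb_self_eq_one one_lt_two
        split_ifs
        · rw [one_div, Real.logb_inv, l2]; ring
        · rw [one_div, Real.logb_inv, Real.logb_mul two_ne_zero hα'.ne', l2]; ring
    have h3 : 0 ≤ Real.logb 2 (Fintype.card α) := Real.logb_nonneg one_lt_two hα1
    have h4 := mul_le_mul_of_nonneg_right hε h3
    rw [entropy_eq, entropy_eq]
    linarith
  · intro i hi
    have e3 : law p (fun ω => (A ω, B ω)) i ≤ law p B i.2 :=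
      law_le_law_of_imp hp.1 fun ω h => by rw [← h]
    exact mul_pos (hq i) (hi.trans_le e3)
  · rw [sum_law, ← sum_law p B, Fintype.sum_prod_type_right]
    refine Finset.sum_le_sum fun b _ => ?_
    simp only [hQ]
    rw [← Finset.sum_mul]
    refine mul_le_of_le_one_left (law_nonneg hp.1 _ _) ?_
    calc _ ≤ ∑ a, ((if g b = a then 1 / 2 else 0) + 1 / (2 * (Fintype.card α : ℝ))) := by
          refine Finset.sum_le_sum fun a _ => ?_
          have : (0 : ℝ) ≤ 1 / (2 * (Fintype.card α : ℝ)) := by positivity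
          split_ifs <;> linarith
      _ = 1 := by
          rw [Finset.sum_add_distrib]
          simp only [Finset.sum_ite_eq, Finset.mem_univ, if_true, Finset.sum_const,
            Finset.card_univ, nsmul_eq_mul]
          field_simp
          norm_num

theorem entropy_of_uniform (hp : p ∈ stdSimplex ℝ Ω) {A : Ω → α} {M : ℝ}
    (h : ∀ a, law p A a = 1 / M) : entropy p A = Real.logb 2 M := by
  rw [entropy_eq]
  simp_rw [h]
  rw [← Finset.sum_mul, hp.2]
  simp

end Entropy

/-! ### Product mass functions -/

section Product

variable {ι κ : Type*} [Fintype ι] [DecidableEq ι] [Fintype κ]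

theorem sum_prod_pi (f : ι → κ → ℝ) : ∑ v : ι → κ, ∏ i, f i (v i) = ∏ i, ∑ a, f i a := by
  rw [Finset.prod_univ_sum, Fintype.piFinset_univ]

theorem pi_mem_stdSimplex {τ : ι → κ → ℝ} (h : ∀ i, τ i ∈ stdSimplex ℝ κ) :
    (fun v : ι → κ => ∏ i, τ i (v i)) ∈ stdSimplex ℝ (ι → κ) :=
  ⟨fun _ => Finset.prod_nonneg fun i _ => (h i).1 _, by
    rw [sum_prod_pi]; exact Finset.prod_eq_one fun i _ => (h i).2⟩

/-- Under a product law, one coordinate may be replaced by an independent copy of it. -/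
theorem sum_resample {τ : ι → κ → ℝ} (i : ι) (h : ∑ b, τ i b = 1) (H : (ι → κ) → ℝ) :
    ∑ v : ι → κ, H v * ∏ j, τ j (v j) =
      ∑ v : ι → κ, (∑ b, τ i b * H (Function.update v i b)) * ∏ j, τ j (v j) := by
  have split : ∀ G : (ι → κ) → ℝ, ∑ v : ι → κ, G v * ∏ j, τ j (v j) =
      ∑ v' : {j // j ≠ i} → κ, ∑ a, G ((Equiv.funSplitAt i κ).symm (a, v')) *
        (τ i a * ∏ j : {j // j ≠ i}, τ j (v' j)) := by
    intro G
    rw [← (Equiv.funSplitAt i κ).symm.sum_comp, Fintype.sum_prod_type_right]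
    refine Finset.sum_congr rfl fun v' _ => Finset.sum_congr rfl fun a _ => ?_
    rw [Fintype.prod_eq_mul_prod_subtype_ne _ i]
    congr 2
    · simp [Equiv.funSplitAt, Equiv.piSplitAt]
    · refine Finset.prod_congr rfl fun j _ => ?_
      have := j.2
      simp [Equiv.funSplitAt, Equiv.piSplitAt, this]
  have hupd : ∀ (a b : κ) (v' : {j // j ≠ i} → κ),
      Function.update ((Equiv.funSplitAt i κ).symm (a, v')) i b =
        (Equiv.funSplitAt i κ).symm (b, v') := by
    intro a b v'
    funext j
    by_cases hj : j = i
    · subst hj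
      simp [Equiv.funSplitAt, Equiv.piSplitAt]
    · simp [Equiv.funSplitAt, Equiv.piSplitAt, hj]
  rw [split, split]
  refine Finset.sum_congr rfl fun v' _ => ?_
  simp_rw [hupd]
  rw [← Finset.mul_sum, ← Finset.sum_mul, h, one_mul, Finset.sum_mul]
  exact Finset.sum_congr rfl fun b _ => by ring

theorem sum_mul_coord {τ : ι → κ → ℝ} (i : ι) (h : ∑ b, τ i b = 1) {G : (ι → κ) → ℝ}
    (hG : ∀ v b, G (Function.update v i b) = G v) (f : κ → ℝ) :
    ∑ v : ι → κ, G v * f (v i) * ∏ j, τ j (v j) =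
      (∑ b, τ i b * f b) * ∑ v : ι → κ, G v * ∏ j, τ j (v j) := by
  rw [sum_resample i h, Finset.mul_sum]
  refine Finset.sum_congr rfl fun v _ => ?_
  simp_rw [hG, Function.update_self]
  rw [← mul_assoc]
  congr 1
  rw [Finset.sum_mul]
  exact Finset.sum_congr rfl fun b _ => by ring

theorem sum_coord {τ : ι → κ → ℝ} (hτ : ∀ i, ∑ b, τ i b = 1) (i : ι) (f : κ → ℝ) :
    ∑ v : ι → κ, f (v i) * ∏ j, τ j (v j) = ∑ b, τ i b * f b := by
  have := sum_mul_coord i (hτ i) (G := fun _ => 1) (fun _ _ => rfl) f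
  simp only [one_mul] at this
  rw [this, sum_prod_pi, Finset.prod_eq_one fun i _ => hτ i, mul_one]

theorem law_pi {Ω α : Type*} [Fintype Ω] (p : Ω → ℝ) (A : Ω → α) (a : ι → α) :
    law (fun ω : ι → Ω => ∏ i, p (ω i)) (fun ω i => A (ω i)) a = ∏ i, law p A (a i) := by
  classical
  unfold law
  rw [← sum_prod_pi]
  refine Finset.sum_congr rfl fun ω _ => ?_
  by_cases h : (fun i => A (ω i)) = a
  · subst h
    simp
  · rw [if_neg h]
    obtain ⟨i, hi⟩ := Function.ne_iff.1 h
    exact (Finset.prod_eq_zero (Finset.mem_univ i) (if_neg hi)).symm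

end Product

/-- The second moment of a sum of `n` independent centred variables. -/
theorem sum_sq_of_centred {Ω : Type*} [Fintype Ω] {p : Ω → ℝ} (hp : p ∈ stdSimplex ℝ Ω)
    {h : Ω → ℝ} (h0 : ∑ ω, p ω * h ω = 0) (n : ℕ) :
    ∑ v : Fin n → Ω, (∑ i, h (v i)) ^ 2 * ∏ i, p (v i) = n * ∑ ω, p ω * h ω ^ 2 := by
  have expand : ∀ v : Fin n → Ω, (∑ i, h (v i)) ^ 2 * ∏ i, p (v i) =
      ∑ i, ∑ j, h (v j) * h (v i) * ∏ k, p (v k) := by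
    intro v
    rw [sq, Finset.sum_mul_sum, Finset.sum_mul]
    refine Finset.sum_congr rfl fun i _ => ?_
    rw [Finset.sum_mul]
    exact Finset.sum_congr rfl fun j _ => by ring
  simp_rw [expand]
  rw [Finset.sum_comm]
  have inner : ∀ i : Fin n, ∑ v : Fin n → Ω, ∑ j, h (v j) * h (v i) * ∏ k, p (v k) =
      ∑ ω, p ω * h ω ^ 2 := by
    intro i
    rw [Finset.sum_comm, Finset.sum_eq_single i]
    · simp_rw [← sq]
      exact sum_coord (τ := fun _ : Fin n => p) (fun _ => hp.2) i fun ω => h ω ^ 2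
    · intro j _ hj
      rw [sum_mul_coord (τ := fun _ : Fin n => p) i hp.2 (G := fun v => h (v j))
        (fun v b => by simp [Function.update_of_ne hj]) h, h0, zero_mul]
    · simp
  rw [Finset.sum_congr rfl fun i _ => inner i]
  simp

/-- The weak law of large numbers, by Chebyshev's inequality. -/
theorem sum_deviation_le {Ω : Type*} [Fintype Ω] {p : Ω → ℝ} (hp : p ∈ stdSimplex ℝ Ω)
    (g : Ω → ℝ) {m : ℝ} (hm : ∑ ω, p ω * g ω = m) {d : ℝ} (hd : 0 < d) {n : ℕ} (hn : 0 < n)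
    (E : (Fin n → Ω) → Prop) (hE : ∀ v, 0 < ∏ i, p (v i) → E v → n * d ≤ |∑ i, g (v i) - n * m|) :
    (open Classical in ∑ v : Fin n → Ω, if E v then ∏ i, p (v i) else 0)
      ≤ (∑ ω, p ω * (g ω - m) ^ 2) / (n * d ^ 2) := by
  classical
  have h0 : ∑ ω, p ω * (g ω - m) = 0 := by
    simp_rw [mul_sub]
    rw [Finset.sum_sub_distrib, ← Finset.sum_mul, hp.2, hm]
    ring
  have hn' : (0 : ℝ) < n := by exact_mod_cast hn
  rw [le_div_iff₀ (by positivity), ← mul_le_mul_iff_right₀ hn', ← sum_sq_of_centred hp h0 n,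
    Finset.sum_mul, Finset.mul_sum]
  refine Finset.sum_le_sum fun v _ => ?_
  have hpv : 0 ≤ ∏ i, p (v i) := Finset.prod_nonneg fun i _ => hp.1 _
  rcases hpv.eq_or_lt with hz | hz
  · simp [← hz]
  by_cases hv : E v
  · have h1 := hE v hz hv
    have h2 : ∑ i, (g (v i) - m) = ∑ i, g (v i) - n * m := by
      rw [Finset.sum_sub_distrib]; simp
    rw [if_pos hv, h2]
    have h3 : (n * d) ^ 2 ≤ (∑ i, g (v i) - n * m) ^ 2 := by
      rw [← sq_abs (∑ i, g (v i) - n * m)]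
      exact pow_le_pow_left₀ (by positivity) h1 2
    nlinarith [mul_le_mul_of_nonneg_right h3 hpv]
  · rw [if_neg hv]
    simp only [zero_mul, mul_zero]
    positivity

/-- Some point does at least as well as the average. -/
theorem exists_le_of_sum_le {Ω : Type*} [Fintype Ω] {p : Ω → ℝ} (hp : p ∈ stdSimplex ℝ Ω)
    {f : Ω → ℝ} {b : ℝ} (h : ∑ ω, p ω * f ω ≤ b) : ∃ ω, f ω ≤ b := by
  by_contra! hcon
  have h1 : ∑ ω, p ω * b < ∑ ω, p ω * f ω := by
    refine Finset.sum_lt_sum (fun ω _ => mul_le_mul_of_nonneg_left (hcon ω).le (hp.1 ω)) ?_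
    by_contra! h2
    have : ∑ ω, p ω ≤ 0 := Finset.sum_nonpos fun ω hω => by
      by_contra! h3
      exact absurd (h2 ω hω) (not_le.2 (mul_lt_mul_of_pos_left (hcon ω) h3))
    rw [hp.2] at this
    linarith
  rw [← Finset.sum_mul, hp.2] at h1
  linarith

/-! ### Sparse reweighting -/

section Sparse

variable {ι T : Type*} [Fintype ι] [Fintype T]

/-- `c` reweights the vectors `a t` without changing their sum or that of the `g₁ t`, and without
decreasing that of the `g₂ t`. -/
def IsReweighting (a : T → ι → ℝ) (g₁ g₂ : T → ℝ) (c : T → ℝ) : Prop :=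
  (∀ t, 0 ≤ c t) ∧ (∀ i, ∑ t, c t * a t i = ∑ t, a t i) ∧ ∑ t, c t * g₁ t = ∑ t, g₁ t ∧
    ∑ t, g₂ t ≤ ∑ t, c t * g₂ t

/-- A linear dependence on the support of `c`, along which the weights can be moved until one of
them vanishes, as long as the support has more points than there are equality constraints. -/
theorem exists_direction {a : T → ι → ℝ} (ha : ∀ t i, 0 ≤ a t i) {g₁ g₂ : T → ℝ}
    (h0 : ∀ t, (∀ i, a t i = 0) → g₂ t = 0) (A : Finset T)
    (hA : Fintype.card ι + 1 < A.card) :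
    ∃ v : T → ℝ, (∀ t ∉ A, v t = 0) ∧ (∀ i, ∑ t, v t * a t i = 0) ∧ ∑ t, v t * g₁ t = 0 ∧
      0 ≤ ∑ t, v t * g₂ t ∧ ∃ t, v t < 0 := by
  classical
  let M : Matrix (Option ι) A ℝ := fun o t => o.elim (g₁ t) fun i => a t i
  obtain ⟨w, hw, hw0⟩ : ∃ w : A → ℝ, M.mulVec w = 0 ∧ w ≠ 0 := by
    have := LinearMap.ker_ne_bot_of_finrank_lt (f := M.mulVecLin) (by simpa using hA)
    obtain ⟨w, hw, hw0⟩ := Submodule.exists_mem_ne_zero_of_ne_bot this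
    exact ⟨w, by simpa using hw, hw0⟩
  let v : T → ℝ := fun t => if h : t ∈ A then w ⟨t, h⟩ else 0
  have hsum : ∀ f : T → ℝ, ∑ t, v t * f t = ∑ t : A, f t * w t := by
    intro f
    rw [← Finset.sum_subset (Finset.subset_univ A), ← Finset.sum_coe_sort A]
    · refine Finset.sum_congr rfl fun t _ => ?_
      simp [v, mul_comm]
    · intro t _ ht
      simp [v, ht]
  have hvA : ∀ t ∉ A, v t = 0 := fun t ht => by simp [v, ht]
  have hva : ∀ i, ∑ t, v t * a t i = 0 := fun i => by
    rw [hsum fun t => a t i]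
    simpa [M, Matrix.mulVec, dotProduct] using congrFun hw (some i)
  have hvg : ∑ t, v t * g₁ t = 0 := by
    rw [hsum g₁]
    simpa [M, Matrix.mulVec, dotProduct] using congrFun hw none
  obtain ⟨t₀, ht₀⟩ : ∃ t, v t ≠ 0 := by
    obtain ⟨t, ht⟩ := Function.ne_iff.1 hw0
    exact ⟨t, by simpa [v] using ht⟩
  -- It suffices to treat a direction that does not decrease the sum of the `g₂ t`.
  have main : ∀ u : T → ℝ, (∀ t ∉ A, u t = 0) → (∀ i, ∑ t, u t * a t i = 0) →
      ∑ t, u t * g₁ t = 0 → u t₀ ≠ 0 → 0 ≤ ∑ t, u t * g₂ t →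
      ∃ v : T → ℝ, (∀ t ∉ A, v t = 0) ∧ (∀ i, ∑ t, v t * a t i = 0) ∧ ∑ t, v t * g₁ t = 0 ∧
      0 ≤ ∑ t, v t * g₂ t ∧ ∃ t, v t < 0 := by
    intro u h1 h2 h3 h4 h5
    by_cases hneg : ∃ t, u t < 0
    · exact ⟨u, h1, h2, h3, h5, hneg⟩
    · push Not at hneg
      have hz : ∀ t, u t * g₂ t = 0 := by
        intro t
        rcases (hneg t).eq_or_lt with h | h
        · rw [← h, zero_mul]
        · rw [h0 t fun i => ?_, mul_zero]
          have := (Finset.sum_eq_zero_iff_of_nonneg fun t _ => mul_nonneg (hneg t) (ha t i)).1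
            (h2 i) t (Finset.mem_univ t)
          exact (mul_eq_zero.1 this).resolve_left h.ne'
      refine ⟨fun t => -u t, fun t ht => by simp [h1 t ht], fun i => by simp [h2 i],
        by simp [h3], by simp [hz], t₀, ?_⟩
      exact neg_neg_of_pos ((hneg t₀).lt_of_ne' h4)
  rcases le_total 0 (∑ t, v t * g₂ t) with h | h
  · exact main v hvA hva hvg ht₀ h
  · exact main (fun t => -v t) (fun t ht => by simp [hvA t ht]) (fun i => by simp [hva i])
      (by simp [hvg]) (by simpa using ht₀) (by simpa using h)

/-- Carathéodory's argument: a reweighting of minimal support has at most as many points as there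
are equality constraints. The inequality for `g₂` costs nothing, because the direction of movement
is free up to sign. -/
theorem exists_sparse_reweighting {a : T → ι → ℝ} (ha : ∀ t i, 0 ≤ a t i) {g₁ g₂ : T → ℝ}
    (h0 : ∀ t, (∀ i, a t i = 0) → g₂ t = 0) :
    ∃ c : T → ℝ, IsReweighting a g₁ g₂ c ∧
      (open Classical in {t | c t ≠ 0} : Finset T).card ≤ Fintype.card ι + 1 := by
  classical
  have key : ∀ n : ℕ, ∀ c : T → ℝ, IsReweighting a g₁ g₂ c →
      ({t | c t ≠ 0} : Finset T).card = n → ∃ c : T → ℝ, IsReweighting a g₁ g₂ c ∧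
      ({t | c t ≠ 0} : Finset T).card ≤ Fintype.card ι + 1 := by
    intro n
    induction n using Nat.strong_induction_on with
    | _ n ih =>
      intro c hc hn
      by_cases hle : n ≤ Fintype.card ι + 1
      · exact ⟨c, hc, hn ▸ hle⟩
      push Not at hle
      obtain ⟨v, hvA, hva, hvg, hv2, t₁, ht₁⟩ := exists_direction ha h0 (g₁ := g₁) (g₂ := g₂)
        {t | c t ≠ 0} (hn ▸ hle)
      -- move along `v` until the first weight vanishes, which is that of `t₀`
      obtain ⟨t₀, ht₀, hmin⟩ := Finset.exists_min_image ({t | v t < 0} : Finset T)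
        (fun t => c t / -v t) ⟨t₁, by simpa using ht₁⟩
      have hv0 : v t₀ < 0 := by simpa using ht₀
      set r := c t₀ / -v t₀ with hr
      have hr0 : 0 ≤ r := div_nonneg (hc.1 _) (by linarith)
      have hc' : IsReweighting a g₁ g₂ fun t => c t + r * v t := by
        refine ⟨fun t => ?_, fun i => ?_, ?_, ?_⟩
        · rcases lt_or_ge (v t) 0 with h | h
          · have h1 := hmin t (by simpa using h)
            rw [le_div_iff₀ (by linarith)] at h1
            linarith
          · exact add_nonneg (hc.1 t) (mul_nonneg hr0 h)
        · simp_rw [add_mul, mul_assoc]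
          rw [Finset.sum_add_distrib, ← Finset.mul_sum, hva, hc.2.1]
          ring
        · simp_rw [add_mul, mul_assoc]
          rw [Finset.sum_add_distrib, ← Finset.mul_sum, hvg, hc.2.2.1]
          ring
        · simp_rw [add_mul, mul_assoc]
          rw [Finset.sum_add_distrib, ← Finset.mul_sum]
          exact hc.2.2.2.trans (le_add_of_nonneg_right (mul_nonneg hr0 hv2))
      refine ih _ ?_ _ hc' rfl
      rw [← hn]
      refine Finset.card_lt_card (Finset.ssubset_iff_of_subset ?_ |>.2 ⟨t₀, ?_, ?_⟩)
      · intro t ht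
        simp only [Finset.mem_filter, Finset.mem_univ, true_and] at ht ⊢
        intro h
        exact ht (by rw [hvA t (by simpa using h), h]; ring)
      · simp only [Finset.mem_filter, Finset.mem_univ, true_and]
        intro h
        exact hv0.ne (hvA t₀ (by simpa using h))
      · simp only [Finset.mem_filter, Finset.mem_univ, true_and, not_not]
        rw [hr, div_neg, neg_mul, div_mul_cancel₀ _ hv0.ne, add_neg_cancel]
  exact key _ (fun _ => 1) ⟨fun _ => zero_le_one, by simp, by simp, by simp⟩ rfl

end Sparse

/-! ### The single-letter region without its redundant constraint -/

section Region

variable {X₁ X₂ S Y Z T : Type*} [Fintype X₁] [Fintype X₂] [Fintype S] [Fintype Y] [Fintype Z]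
  [Fintype T]

/-- `I(X₁T;Y) - I(T;S|X₁)` in terms of joint entropies. -/
def rateOne (P : X₁ × S × T × X₂ × Y × Z → ℝ) : ℝ :=
  entropy P (fun ω => ω.2.2.2.2.1) + entropy P (fun ω => ω.1) - entropy P (fun ω => (ω.1, ω.2.1))
    + (entropy P (fun ω => (ω.1, ω.2.1, ω.2.2.1)) -
      entropy P (fun ω => (ω.1, ω.2.2.1, ω.2.2.2.2.1)))

/-- `H(Z|X₁TS)` in terms of joint entropies. -/
def rateTwo (P : X₁ × S × T × X₂ × Y × Z → ℝ) : ℝ :=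
  entropy P (fun ω => (ω.1, ω.2.1, ω.2.2.1, ω.2.2.2.2.2)) -
    entropy P (fun ω => (ω.1, ω.2.1, ω.2.2.1))

/-- `H(Z|X₁) - I(TZ;S|X₁)` in terms of joint entropies. -/
def rateThree (P : X₁ × S × T × X₂ × Y × Z → ℝ) : ℝ :=
  entropy P (fun ω => (ω.1, ω.2.2.2.2.2)) - entropy P (fun ω => (ω.1, ω.2.2.1, ω.2.2.2.2.2)) -
    entropy P (fun ω => (ω.1, ω.2.1)) + entropy P (fun ω => (ω.1, ω.2.1, ω.2.2.1, ω.2.2.2.2.2))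

theorem rateOne_eq {P : X₁ × S × T × X₂ × Y × Z → ℝ} (hP : ∀ ω, 0 ≤ P ω) :
    mutualInfo P (fun ω => (ω.1, ω.2.2.1)) (fun ω => ω.2.2.2.2.1) -
      condMutualInfo P (fun ω => ω.2.2.1) (fun ω => ω.2.1) (fun ω => ω.1) = rateOne P := by
  rw [mutualInfo_eq hP, condMutualInfo_eq hP, rateOne,
    entropy_congr P (A := fun ω => ((ω.1, ω.2.2.1), ω.2.2.2.2.1))
      (B := fun ω => (ω.1, ω.2.2.1, ω.2.2.2.2.1)) (by grind),
    entropy_congr P (A := fun ω => (ω.2.2.1, ω.1)) (B := fun ω => (ω.1, ω.2.2.1)) (by grind),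
    entropy_congr P (A := fun ω => (ω.2.1, ω.1)) (B := fun ω => (ω.1, ω.2.1)) (by grind),
    entropy_congr P (A := fun ω => (ω.2.2.1, ω.2.1, ω.1))
      (B := fun ω => (ω.1, ω.2.1, ω.2.2.1)) (by grind)]
  ring

theorem rateTwo_eq {P : X₁ × S × T × X₂ × Y × Z → ℝ} (hP : ∀ ω, 0 ≤ P ω) :
    condEntropy P (fun ω => ω.2.2.2.2.2) (fun ω => (ω.1, ω.2.2.1, ω.2.1)) = rateTwo P := by
  rw [condEntropy_eq hP, rateTwo,
    entropy_congr P (A := fun ω => (ω.2.2.2.2.2, ω.1, ω.2.2.1, ω.2.1))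
      (B := fun ω => (ω.1, ω.2.1, ω.2.2.1, ω.2.2.2.2.2)) (by grind),
    entropy_congr P (A := fun ω => (ω.1, ω.2.2.1, ω.2.1))
      (B := fun ω => (ω.1, ω.2.1, ω.2.2.1)) (by grind)]

theorem rateThree_eq {P : X₁ × S × T × X₂ × Y × Z → ℝ} (hP : ∀ ω, 0 ≤ P ω) :
    condEntropy P (fun ω => ω.2.2.2.2.2) (fun ω => ω.1) -
      condMutualInfo P (fun ω => (ω.2.2.1, ω.2.2.2.2.2)) (fun ω => ω.2.1) (fun ω => ω.1)
        = rateThree P := by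
  rw [condEntropy_eq hP, condMutualInfo_eq hP, rateThree,
    entropy_congr P (A := fun ω => (ω.2.2.2.2.2, ω.1)) (B := fun ω => (ω.1, ω.2.2.2.2.2))
      (by grind),
    entropy_congr P (A := fun ω => ((ω.2.2.1, ω.2.2.2.2.2), ω.1))
      (B := fun ω => (ω.1, ω.2.2.1, ω.2.2.2.2.2)) (by grind),
    entropy_congr P (A := fun ω => (ω.2.1, ω.1)) (B := fun ω => (ω.1, ω.2.1)) (by grind),
    entropy_congr P (A := fun ω => ((ω.2.2.1, ω.2.2.2.2.2), ω.2.1, ω.1))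
      (B := fun ω => (ω.1, ω.2.1, ω.2.2.1, ω.2.2.2.2.2)) (by grind)]
  ring

/-- The admissible pairs `(P_{X₁}, P_{TX₂|SX₁})`. -/
def inputLaws (X₁ X₂ S T : Type*) [Fintype X₁] [Fintype X₂] [Fintype T] :
    Set ((X₁ → ℝ) × (S → X₁ → T × X₂ → ℝ)) :=
  {u | u.1 ∈ stdSimplex ℝ X₁ ∧ ∀ s x, u.2 s x ∈ stdSimplex ℝ (T × X₂)}

theorem isCompact_inputLaws {X₁ X₂ S T : Type*} [Fintype X₁] [Fintype X₂] [Fintype T] :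
    IsCompact (inputLaws X₁ X₂ S T) := by
  have : inputLaws X₁ X₂ S T = stdSimplex ℝ X₁ ×ˢ
      Set.pi Set.univ fun _ => Set.pi Set.univ fun _ => stdSimplex ℝ (T × X₂) := by
    ext u
    simp [inputLaws, Set.mem_pi]
  rw [this]
  exact (isCompact_stdSimplex ℝ X₁).prod
    (isCompact_univ_pi fun _ => isCompact_univ_pi fun _ => isCompact_stdSimplex ℝ _)

variable {ch : Channel X₁ X₂ S Y Z} {pX : X₁ → ℝ} {q : S → X₁ → T × X₂ → ℝ}

theorem jointLaw_mem (h : (pX, q) ∈ inputLaws X₁ X₂ S T) :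
    ch.jointLaw pX q ∈ stdSimplex ℝ (X₁ × S × T × X₂ × Y × Z) := by
  refine ⟨fun ⟨x, s, t, x₂, y, z⟩ => mul_nonneg (mul_nonneg (mul_nonneg (h.1.1 x)
    (ch.stateLaw_mem.1 s)) ((h.2 s x).1 _)) ((ch.trans_mem x x₂ s).1 _), ?_⟩
  have h1 : ∀ x x₂ s, ∑ y, ∑ z, ch.trans x x₂ s (y, z) = 1 := fun x x₂ s => by
    rw [← Fintype.sum_prod_type']; exact (ch.trans_mem x x₂ s).2
  have h2 : ∀ s x, ∑ t, ∑ x₂, q s x (t, x₂) = 1 := fun s x => by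
    rw [← Fintype.sum_prod_type']; exact (h.2 s x).2
  simp only [Fintype.sum_prod_type, Channel.jointLaw, ← Finset.mul_sum, h1, mul_one, h2]
  rw [ch.stateLaw_mem.2]
  simpa using h.1.2

theorem mem_rateRegion_iff {R : ℝ × ℝ} : R ∈ ch.rateRegion T ↔ 0 ≤ R.1 ∧ 0 ≤ R.2 ∧
    ∃ u ∈ inputLaws X₁ X₂ S T, R.1 ≤ rateOne (ch.jointLaw u.1 u.2) ∧
      R.2 ≤ rateTwo (ch.jointLaw u.1 u.2) ∧ R.2 ≤ rateThree (ch.jointLaw u.1 u.2) := by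
  refine and_congr_right fun _ => and_congr_right fun _ => ⟨?_, ?_⟩
  · rintro ⟨pX, hpX, q, hq, h⟩
    have hP := (jointLaw_mem (ch := ch) (pX := pX) (q := q) ⟨hpX, hq⟩).1
    refine ⟨(pX, q), ⟨hpX, hq⟩, ?_⟩
    rw [← rateOne_eq hP, ← rateTwo_eq hP, ← rateThree_eq hP]
    exact h
  · rintro ⟨⟨pX, q⟩, hu, h⟩
    have hP := (jointLaw_mem (ch := ch) hu).1
    refine ⟨pX, hu.1, q, hu.2, ?_⟩
    rw [← rateOne_eq hP, ← rateTwo_eq hP, ← rateThree_eq hP] at h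
    exact h

theorem continuous_entropy {Ω α U : Type*} [Fintype Ω] [Fintype α] [TopologicalSpace U]
    {p : U → Ω → ℝ} (hp : ∀ ω, Continuous fun u => p u ω) (A : Ω → α) :
    Continuous fun u => entropy (p u) A := by
  classical
  have hl : ∀ a, Continuous fun u => law (p u) A a := fun a => by
    unfold law
    refine continuous_finsetSum _ fun ω _ => ?_
    split_ifs
    exacts [hp ω, continuous_const]
  unfold entropy
  refine (continuous_finsetSum _ fun a _ => ?_).neg
  have := (Real.continuous_mul_log.comp (hl a)).div_const (Real.log 2)
  simpa [Real.logb, mul_div_assoc, Function.comp_def] using this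

theorem isClosed_rateRegion : IsClosed (ch.rateRegion T) := by
  have : CompactSpace (inputLaws X₁ X₂ S T) := isCompact_iff_compactSpace.1 isCompact_inputLaws
  have hc : ∀ ω, Continuous fun u : (ℝ × ℝ) × inputLaws X₁ X₂ S T =>
      ch.jointLaw u.2.1.1 u.2.1.2 ω := by
    rintro ⟨x, s, t, x₂, y, z⟩
    unfold Channel.jointLaw
    fun_prop
  have he : ch.rateRegion T = Prod.fst '' {u : (ℝ × ℝ) × inputLaws X₁ X₂ S T |
      0 ≤ u.1.1 ∧ 0 ≤ u.1.2 ∧ u.1.1 ≤ rateOne (ch.jointLaw u.2.1.1 u.2.1.2) ∧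
      u.1.2 ≤ rateTwo (ch.jointLaw u.2.1.1 u.2.1.2) ∧
      u.1.2 ≤ rateThree (ch.jointLaw u.2.1.1 u.2.1.2)} := by
    ext R
    rw [mem_rateRegion_iff]
    constructor
    · rintro ⟨h1, h2, u, hu, h⟩
      exact ⟨(R, ⟨u, hu⟩), ⟨h1, h2, h⟩, rfl⟩
    · rintro ⟨⟨R, u⟩, ⟨h1, h2, h⟩, rfl⟩
      exact ⟨h1, h2, u.1, u.2, h⟩
  rw [he]
  refine isClosedMap_fst_of_compactSpace _ ?_
  have c1 : Continuous fun u : (ℝ × ℝ) × inputLaws X₁ X₂ S T => u.1.1 := by fun_prop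
  have c2 : Continuous fun u : (ℝ × ℝ) × inputLaws X₁ X₂ S T => u.1.2 := by fun_prop
  refine (isClosed_le continuous_const c1).inter ((isClosed_le continuous_const c2).inter
    ((isClosed_le c1 ?_).inter ((isClosed_le c2 ?_).inter (isClosed_le c2 ?_))))
  · exact ((((continuous_entropy hc _).add (continuous_entropy hc _)).sub
      (continuous_entropy hc _))).add ((continuous_entropy hc _).sub (continuous_entropy hc _))
  · exact (continuous_entropy hc _).sub (continuous_entropy hc _)
  · exact (((continuous_entropy hc _).sub (continuous_entropy hc _)).sub
      (continuous_entropy hc _)).add (continuous_entropy hc _)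

/-- The marginal law of everything but the auxiliary variable depends on `P_{TX₂|SX₁}` only
through `P_{X₂|SX₁}`. -/
theorem law_jointLaw_without_aux (pX : X₁ → ℝ) (q : S → X₁ → T × X₂ → ℝ) :
    law (ch.jointLaw pX q) (fun ω => (ω.1, ω.2.1, ω.2.2.2)) = fun i =>
      pX i.1 * ch.stateLaw i.2.1 * (∑ t, q i.2.1 i.1 (t, i.2.2.1)) *
        ch.trans i.1 i.2.2.1 i.2.1 i.2.2.2 := by
  classical
  funext ⟨x, s, x₂, y, z⟩
  have h := sum_law_fst (ch.jointLaw pX q) (fun ω => ω.2.2.1)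
    (fun ω => (ω.1, ω.2.1, ω.2.2.2)) (x, s, x₂, y, z)
  rw [← h, Finset.mul_sum, Finset.sum_mul]
  refine Finset.sum_congr rfl fun t _ => ?_
  rw [law_congr (B := id) (b := (x, s, t, x₂, y, z)) (by grind), law_id]
  rfl

theorem entropy_jointLaw_congr {T' α : Type*} [Fintype T'] [Fintype α]
    {q' : S → X₁ → T' × X₂ → ℝ} (h : ∀ s x x₂, ∑ t, q s x (t, x₂) = ∑ t, q' s x (t, x₂))
    (A : X₁ × S × X₂ × Y × Z → α) :
    entropy (ch.jointLaw pX q) (fun ω => A (ω.1, ω.2.1, ω.2.2.2)) =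
      entropy (ch.jointLaw pX q') (fun ω => A (ω.1, ω.2.1, ω.2.2.2)) := by
  have e := entropy_law (ch.jointLaw pX q) (fun ω => (ω.1, ω.2.1, ω.2.2.2)) A
  have e' := entropy_law (ch.jointLaw pX q') (fun ω => (ω.1, ω.2.1, ω.2.2.2)) A
  rw [law_jointLaw_without_aux] at e e'
  simp_rw [h] at e
  exact e.symm.trans e'

/-- The rate pairs allowed by the constraints `R₁ ≤ I(X₁T;Y) - I(T;S|X₁)` and `R₂ ≤ H(Z|X₁TS)`
alone; the rates may be negative. -/
def Channel.relaxedRegion (ch : Channel X₁ X₂ S Y Z) (T : Type*) [Fintype T] : Set (ℝ × ℝ) :=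
  {R | ∃ u ∈ inputLaws X₁ X₂ S T, R.1 ≤ rateOne (ch.jointLaw u.1 u.2) ∧
      R.2 ≤ rateTwo (ch.jointLaw u.1 u.2)}

/-- If `B` depends on `W` only through `ζ(W)`, with conditional law `κ`, then the same holds for
any function of `W` that determines `ζ(W)`. -/
theorem law_of_kernel {Ω β 𝒲 α γ : Type*} [Fintype Ω] [Fintype β] [Fintype 𝒲]
    {p : Ω → ℝ} {B : Ω → β} {W : Ω → 𝒲} {ζ : 𝒲 → γ} {κ : γ → β → ℝ}
    (h : ∀ b w, law p (fun ω => (B ω, W ω)) (b, w) = κ (ζ w) b * law p W w) {g : 𝒲 → α}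
    {ξ : α → γ} (hg : ∀ w, ξ (g w) = ζ w) (b : β) (a : α) :
    law p (fun ω => (B ω, g (W ω))) (b, a) = κ (ξ a) b * law p (fun ω => g (W ω)) a := by
  classical
  rw [← law_law p W g, ← law_law p (fun ω => (B ω, W ω)) (fun i => (i.1, g i.2))]
  rw [law, law, Fintype.sum_prod_type, Finset.sum_eq_single b, Finset.mul_sum]
  · refine Finset.sum_congr rfl fun w _ => ?_
    by_cases hw : g w = a
    · rw [if_pos (by rw [hw]), if_pos hw, h b w, ← hg w, hw]
    · rw [if_neg (by simpa using hw), if_neg hw, mul_zero]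
  · intro b' _ hb
    exact Finset.sum_eq_zero fun w _ => by simp [hb]
  · simp

/-- The Markov chain `B - ζ(W) - g(W)`. -/
theorem entropy_of_kernel {Ω β 𝒲 α γ : Type*} [Fintype Ω] [Fintype β] [Fintype 𝒲] [Fintype α]
    [Fintype γ] {p : Ω → ℝ} (hp : ∀ ω, 0 ≤ p ω) {B : Ω → β} {W : Ω → 𝒲} {ζ : 𝒲 → γ}
    {κ : γ → β → ℝ} (h : ∀ b w, law p (fun ω => (B ω, W ω)) (b, w) = κ (ζ w) b * law p W w)
    (g : 𝒲 → α) :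
    entropy p (fun ω => (B ω, g (W ω), ζ (W ω))) + entropy p (fun ω => ζ (W ω)) =
      entropy p (fun ω => (B ω, ζ (W ω))) + entropy p (fun ω => (g (W ω), ζ (W ω))) := by
  refine entropy_of_condIndep hp B _ _ fun ω _ => ?_
  rw [law_of_kernel h (g := fun w => (g w, ζ w)) (ξ := Prod.snd) (fun _ => rfl),
    law_of_kernel h (g := ζ) (ξ := id) (fun _ => rfl)]
  simp only [id]
  ring

/-- In a degraded channel `Y` depends on all the other variables through `Z` only. -/
theorem law_output_eq {K : Z → Y → ℝ} (hK : ∀ z, K z ∈ stdSimplex ℝ Y)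
    (htr : ∀ x₁ x₂ s y z, ch.trans x₁ x₂ s (y, z) = ch.transZ x₁ x₂ s z * K z y) (y : Y)
    (w : X₁ × S × T × X₂ × Z) :
    law (ch.jointLaw pX q) (fun ω => (ω.2.2.2.2.1,
      (ω.1, ω.2.1, ω.2.2.1, ω.2.2.2.1, ω.2.2.2.2.2))) (y, w) = K w.2.2.2.2 y *
      law (ch.jointLaw pX q) (fun ω => (ω.1, ω.2.1, ω.2.2.1, ω.2.2.2.1, ω.2.2.2.2.2)) w := by
  set P := ch.jointLaw pX q with hP
  have hW : ∀ y (w : X₁ × S × T × X₂ × Z),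
      law P (fun ω => (ω.2.2.2.2.1, (ω.1, ω.2.1, ω.2.2.1, ω.2.2.2.1, ω.2.2.2.2.2))) (y, w) =
      K w.2.2.2.2 y * (pX w.1 * ch.stateLaw w.2.1 * q w.2.1 w.1 (w.2.2.1, w.2.2.2.1) *
        ch.transZ w.1 w.2.2.2.1 w.2.1 w.2.2.2.2) := by
    rintro y ⟨x, s, t, x₂, z⟩
    rw [law_congr (B := id) (b := (x, s, t, x₂, y, z)) (by grind), law_id, hP]
    simp only [Channel.jointLaw, htr]
    ring
  rw [← sum_law_fst P (fun ω => ω.2.2.2.2.1)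
    (fun ω => (ω.1, ω.2.1, ω.2.2.1, ω.2.2.2.1, ω.2.2.2.2.2)) w, hW,
    Finset.sum_congr rfl fun y _ => hW y w, ← Finset.sum_mul, (hK _).2, one_mul]

/-- Degradedness makes `T - (X₁,Z) - Y` a Markov chain, so `I(T;Y|X₁) ≤ I(T;Z|X₁)`. -/
theorem data_processing (hdeg : ch.IsDegraded) (h : (pX, q) ∈ inputLaws X₁ X₂ S T) :
    entropy (ch.jointLaw pX q) (fun ω => (ω.1, ω.2.2.2.2.1)) -
      entropy (ch.jointLaw pX q) (fun ω => (ω.1, ω.2.2.1, ω.2.2.2.2.1)) ≤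
    entropy (ch.jointLaw pX q) (fun ω => (ω.1, ω.2.2.2.2.2)) -
      entropy (ch.jointLaw pX q) (fun ω => (ω.1, ω.2.2.1, ω.2.2.2.2.2)) := by
  obtain ⟨K, hK, htr⟩ := hdeg
  have hk := law_output_eq (pX := pX) (q := q) hK htr
  set P := ch.jointLaw pX q with hP
  have hP0 : ∀ ω, 0 ≤ P ω := (jointLaw_mem h).1
  have e := entropy_of_kernel (ζ := fun w : X₁ × S × T × X₂ × Z => (w.1, w.2.2.2.2))
    (κ := fun c => K c.2) hP0 hk (fun w => w.2.2.1)
  have sm := entropy_submodular hP0 (fun ω => ω.2.2.1) (fun ω => ω.2.2.2.2.2)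
    (fun ω => (ω.1, ω.2.2.2.2.1))
  rw [entropy_congr P (A := fun ω => (ω.2.2.1, ω.2.2.2.2.2, ω.1, ω.2.2.2.2.1))
      (B := fun ω => (ω.2.2.2.2.1, ω.2.2.1, ω.1, ω.2.2.2.2.2)) (by grind),
    entropy_congr P (A := fun ω => (ω.2.2.1, ω.1, ω.2.2.2.2.1))
      (B := fun ω => (ω.1, ω.2.2.1, ω.2.2.2.2.1)) (by grind),
    entropy_congr P (A := fun ω => (ω.2.2.2.2.2, ω.1, ω.2.2.2.2.1))
      (B := fun ω => (ω.2.2.2.2.1, ω.1, ω.2.2.2.2.2)) (by grind)] at sm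
  rw [entropy_congr P (A := fun ω => (ω.2.2.1, ω.1, ω.2.2.2.2.2))
      (B := fun ω => (ω.1, ω.2.2.1, ω.2.2.2.2.2)) (by grind)] at e
  linarith

/-- The third constraint costs nothing: where it would bite, already `I(T;Y|X₁) < I(T;S|X₁)`, and
a constant auxiliary variable allows larger rates. -/
theorem relaxedRegion_subset (hdeg : ch.IsDegraded) {R : ℝ × ℝ} (hR : R ∈ ch.relaxedRegion T) :
    (max R.1 0, max R.2 0) ∈ ch.rateRegion T ∨ (max R.1 0, max R.2 0) ∈ ch.rateRegion (Fin 1) := by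
  obtain ⟨⟨pX, q⟩, hu, h1, h2⟩ := hR
  simp only at h1 h2
  have hP := jointLaw_mem (ch := ch) hu
  have dp := data_processing hdeg hu
  set P := ch.jointLaw pX q with hPdef
  have sY := entropy_pair_le hP (fun ω => ω.1) (fun ω => ω.2.2.2.2.1)
  have s2 : 0 ≤ rateTwo P := by
    have := entropy_le_pair hP.1 (fun ω => ω.2.2.2.2.2) (fun ω => (ω.1, ω.2.1, ω.2.2.1))
    rw [entropy_congr P (A := fun ω => (ω.2.2.2.2.2, ω.1, ω.2.1, ω.2.2.1))
      (B := fun ω => (ω.1, ω.2.1, ω.2.2.1, ω.2.2.2.2.2)) (by grind)] at this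
    unfold rateTwo
    linarith
  -- the sign of `I(T;Y|X₁) - I(T;S|X₁)` decides whether `T` is kept
  rcases le_total 0 (entropy P (fun ω => (ω.1, ω.2.2.2.2.1)) -
      entropy P (fun ω => (ω.1, ω.2.2.1, ω.2.2.2.2.1)) -
      entropy P (fun ω => (ω.1, ω.2.1)) +
      entropy P (fun ω => (ω.1, ω.2.1, ω.2.2.1))) with hD | hD
  · left
    have h3 : rateTwo P ≤ rateThree P := by
      unfold rateTwo rateThree
      linarith
    have s1 : 0 ≤ rateOne P := by
      unfold rateOne
      linarith
    exact mem_rateRegion_iff.2 ⟨le_max_right _ _, le_max_right _ _, (pX, q), hu, max_le h1 s1,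
      max_le h2 s2, (max_le h2 s2).trans h3⟩
  · right
    set q' : S → X₁ → Fin 1 × X₂ → ℝ := fun s x i => ∑ t, q s x (t, i.2) with hq'
    have hu' : (pX, q') ∈ inputLaws X₁ X₂ S (Fin 1) := by
      refine ⟨hu.1, fun s x => ⟨fun i => Finset.sum_nonneg fun t _ => (hu.2 s x).1 _, ?_⟩⟩
      rw [Fintype.sum_prod_type, ← (hu.2 s x).2, Fintype.sum_prod_type]
      simp only [hq', Finset.univ_unique, Finset.sum_singleton]
      exact Finset.sum_comm
    have hs : ∀ s x x₂, ∑ t, q' s x (t, x₂) = ∑ t, q s x (t, x₂) := by simp [hq']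
    have eY := entropy_jointLaw_congr (ch := ch) (pX := pX) hs (fun i => i.2.2.2.1)
    have eX := entropy_jointLaw_congr (ch := ch) (pX := pX) hs (fun i => i.1)
    have eXY := entropy_jointLaw_congr (ch := ch) (pX := pX) hs (fun i => (i.1, i.2.2.2.1))
    have eXS := entropy_jointLaw_congr (ch := ch) (pX := pX) hs (fun i => (i.1, i.2.1))
    have eXSZ := entropy_jointLaw_congr (ch := ch) (pX := pX) hs
      (fun i => (i.1, i.2.1, i.2.2.2.2))
    simp only [← hPdef] at eY eX eXY eXS eXSZ
    set P' := ch.jointLaw pX q' with hP'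
    have k1 := entropy_congr P' (A := fun ω => (ω.1, ω.2.1, ω.2.2.1))
      (B := fun ω => (ω.1, ω.2.1)) (by simp)
    have k2 := entropy_congr P' (A := fun ω => (ω.1, ω.2.2.1, ω.2.2.2.2.1))
      (B := fun ω => (ω.1, ω.2.2.2.2.1)) (by simp)
    have k3 := entropy_congr P' (A := fun ω => (ω.1, ω.2.1, ω.2.2.1, ω.2.2.2.2.2))
      (B := fun ω => (ω.1, ω.2.1, ω.2.2.2.2.2)) (by simp)
    have k4 := entropy_congr P' (A := fun ω => (ω.1, ω.2.2.1, ω.2.2.2.2.2))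
      (B := fun ω => (ω.1, ω.2.2.2.2.2)) (by simp)
    have sm := entropy_submodular hP.1 (fun ω => ω.2.2.2.2.2) (fun ω => ω.2.2.1)
      (fun ω => (ω.1, ω.2.1))
    rw [entropy_congr P (A := fun ω => (ω.2.2.2.2.2, ω.2.2.1, ω.1, ω.2.1))
        (B := fun ω => (ω.1, ω.2.1, ω.2.2.1, ω.2.2.2.2.2)) (by grind),
      entropy_congr P (A := fun ω => (ω.2.2.2.2.2, ω.1, ω.2.1))
        (B := fun ω => (ω.1, ω.2.1, ω.2.2.2.2.2)) (by grind),
      entropy_congr P (A := fun ω => (ω.2.2.1, ω.1, ω.2.1))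
        (B := fun ω => (ω.1, ω.2.1, ω.2.2.1)) (by grind)] at sm
    have r1 : rateOne P ≤ rateOne P' := by
      unfold rateOne
      linarith
    have r2 : rateTwo P ≤ rateTwo P' := by
      unfold rateTwo
      linarith
    have r3 : rateThree P' = rateTwo P' := by
      unfold rateTwo rateThree
      linarith
    have s1 : 0 ≤ rateOne P' := by
      unfold rateOne
      linarith
    refine mem_rateRegion_iff.2 ⟨le_max_right _ _, le_max_right _ _, (pX, q'), hu',
      max_le (h1.trans r1) s1, max_le (h2.trans r2) (s2.trans r2), ?_⟩
    exact (max_le (h2.trans r2) (s2.trans r2)).trans r3.ge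

end Region

/-! ### The cardinality of the auxiliary alphabet -/

section Cardinality

theorem law_reweight {Ω α : Type*} [Fintype Ω] (p c : Ω → ℝ) {A : Ω → α}
    (hA : ∀ ω ω', A ω = A ω' → c ω = c ω') (ω : Ω) :
    law (fun ω => p ω * c ω) A (A ω) = law p A (A ω) * c ω := by
  classical
  unfold law
  rw [Finset.sum_mul]
  refine Finset.sum_congr rfl fun ω' _ => ?_
  by_cases h : A ω' = A ω
  · rw [if_pos h, if_pos h, ← hA _ _ h]
  · rw [if_neg h, if_neg h, zero_mul]

/-- A difference of two entropies is linear in a weight that both variables determine. -/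
theorem entropy_sub_reweight {Ω α β : Type*} [Fintype Ω] [Fintype α] [Fintype β] {p c : Ω → ℝ}
    (hp : ∀ ω, 0 ≤ p ω) (hc : ∀ ω, 0 ≤ c ω) {A : Ω → α} {B : Ω → β}
    (hA : ∀ ω ω', A ω = A ω' → c ω = c ω') (hB : ∀ ω ω', B ω = B ω' → c ω = c ω') :
    entropy (fun ω => p ω * c ω) A - entropy (fun ω => p ω * c ω) B =
      ∑ ω, p ω * (Real.logb 2 (law p B (B ω)) - Real.logb 2 (law p A (A ω))) * c ω := by
  rw [entropy_eq, entropy_eq, neg_sub_neg, ← Finset.sum_sub_distrib]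
  refine Finset.sum_congr rfl fun ω _ => ?_
  rw [law_reweight p c hA, law_reweight p c hB]
  rcases (hp ω).eq_or_lt with h0 | h0
  · simp [← h0]
  rcases (hc ω).eq_or_lt with h1 | h1
  · simp [← h1]
  rw [Real.logb_mul (law_pos hp A h0).ne' h1.ne', Real.logb_mul (law_pos hp B h0).ne' h1.ne']
  ring

theorem entropy_sub {Ω α β : Type*} [Fintype Ω] [Fintype α] [Fintype β] (p : Ω → ℝ)
    (A : Ω → α) (B : Ω → β) : entropy p A - entropy p B =
      ∑ ω, p ω * (Real.logb 2 (law p B (B ω)) - Real.logb 2 (law p A (A ω))) := by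
  rw [entropy_eq, entropy_eq, neg_sub_neg, ← Finset.sum_sub_distrib]
  exact Finset.sum_congr rfl fun ω _ => by ring

theorem law_eq_zero_of {Ω α : Type*} [Fintype Ω] {f : Ω → ℝ} {A : Ω → α} {a : α}
    (h : ∀ ω, A ω = a → f ω = 0) : law f A a = 0 := by
  classical
  unfold law
  exact Finset.sum_eq_zero fun ω _ => by
    by_cases h1 : A ω = a
    · rw [if_pos h1, h ω h1]
    · rw [if_neg h1]

variable {X₁ X₂ S Y Z T : Type*} [Fintype X₁] [Fintype X₂] [Fintype S] [Fintype Y] [Fintype Z]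
  [Fintype T] {ch : Channel X₁ X₂ S Y Z} {pX : X₁ → ℝ} {q : S → X₁ → T × X₂ → ℝ}

/-- Reweighting the values of the auxiliary variable so that few of them keep positive weight.
The equality constraints are the `|X₁||X₂||S|` values of `P_{X₂|SX₁}` and the part of `rateOne`
that depends on the auxiliary variable; `rateTwo` may only grow. -/
theorem exists_sparse_aux (hu : (pX, q) ∈ inputLaws X₁ X₂ S T) :
    ∃ c : T → ℝ, (open Classical in {t | c t ≠ 0} : Finset T).card ≤
        Fintype.card X₁ * Fintype.card X₂ * Fintype.card S + 1 ∧
      (pX, fun s x i => q s x i * c i.1) ∈ inputLaws X₁ X₂ S T ∧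
      rateOne (ch.jointLaw pX q) ≤ rateOne (ch.jointLaw pX fun s x i => q s x i * c i.1) ∧
      rateTwo (ch.jointLaw pX q) ≤ rateTwo (ch.jointLaw pX fun s x i => q s x i * c i.1) := by
  classical
  set P := ch.jointLaw pX q with hPdef
  have hP : ∀ ω, 0 ≤ P ω := (jointLaw_mem hu).1
  -- the differences of entropies in the two bounds are sums over `t` of terms linear in its weight
  set f₁ : X₁ × S × T × X₂ × Y × Z → ℝ := fun ω => P ω *
    (Real.logb 2 (law P (fun ω => (ω.1, ω.2.2.1, ω.2.2.2.2.1)) (ω.1, ω.2.2.1, ω.2.2.2.2.1)) -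
    Real.logb 2 (law P (fun ω => (ω.1, ω.2.1, ω.2.2.1)) (ω.1, ω.2.1, ω.2.2.1))) with hf₁
  set f₂ : X₁ × S × T × X₂ × Y × Z → ℝ := fun ω => P ω *
    (Real.logb 2 (law P (fun ω => (ω.1, ω.2.1, ω.2.2.1)) (ω.1, ω.2.1, ω.2.2.1)) -
    Real.logb 2 (law P (fun ω => (ω.1, ω.2.1, ω.2.2.1, ω.2.2.2.2.2))
      (ω.1, ω.2.1, ω.2.2.1, ω.2.2.2.2.2))) with hf₂
  obtain ⟨c, ⟨hc0, hca, hc1, hc2⟩, hcard⟩ := exists_sparse_reweighting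
    (a := fun t (i : X₁ × X₂ × S) => q i.2.2 i.1 (t, i.2.1)) (fun t i => (hu.2 _ _).1 _)
    (g₁ := law f₁ fun ω => ω.2.2.1) (g₂ := law f₂ fun ω => ω.2.2.1) fun t ht =>
      law_eq_zero_of fun ⟨x, s, t', x₂, y, z⟩ h => by
        have hz : P (x, s, t', x₂, y, z) = 0 := by
          subst h
          have := ht (x, x₂, s)
          simp only at this
          simp [hPdef, Channel.jointLaw, this]
        rw [hf₂]
        simp only [hz, zero_mul]
  have hs : ∀ s x x₂, ∑ t, q s x (t, x₂) * c t = ∑ t, q s x (t, x₂) := fun s x x₂ => by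
    rw [← hca (x, x₂, s)]
    exact Finset.sum_congr rfl fun t _ => mul_comm _ _
  refine ⟨c, ?_, ⟨hu.1, fun s x => ⟨fun i => mul_nonneg ((hu.2 s x).1 i) (hc0 _), ?_⟩⟩, ?_⟩
  · refine hcard.trans (le_of_eq ?_)
    simp only [Fintype.card_prod]
    ring
  · rw [← (hu.2 s x).2, Fintype.sum_prod_type_right, Fintype.sum_prod_type_right]
    exact Finset.sum_congr rfl fun x₂ _ => hs s x x₂
  have hP' : ch.jointLaw pX (fun s x i => q s x i * c i.1) = fun ω => P ω * c ω.2.2.1 := by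
    funext ⟨x, s, t, x₂, y, z⟩
    simp only [hPdef, Channel.jointLaw]
    ring
  have eY := entropy_jointLaw_congr (ch := ch) (pX := pX)
    (q := fun s x i => q s x i * c i.1) hs (fun i => i.2.2.2.1)
  have eX := entropy_jointLaw_congr (ch := ch) (pX := pX)
    (q := fun s x i => q s x i * c i.1) hs (fun i => i.1)
  have eXS := entropy_jointLaw_congr (ch := ch) (pX := pX)
    (q := fun s x i => q s x i * c i.1) hs (fun i => (i.1, i.2.1))
  rw [hP'] at eY eX eXS ⊢
  constructor
  · unfold rateOne
    rw [eX, eY, eXS, entropy_sub_reweight hP (fun ω => hc0 _) (by grind) (by grind), entropy_sub]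
    refine add_le_add_right (le_of_eq ?_) _
    have h1 := sum_law_mul f₁ (fun ω => ω.2.2.1) c
    have h2 := sum_law f₁ (fun ω => ω.2.2.1)
    rw [← h1, ← h2, ← hc1]
    exact Finset.sum_congr rfl fun t _ => mul_comm _ _
  · unfold rateTwo
    rw [entropy_sub_reweight hP (fun ω => hc0 _) (by grind) (by grind), entropy_sub]
    have h1 := sum_law_mul f₂ (fun ω => ω.2.2.1) c
    have h2 := sum_law f₂ (fun ω => ω.2.2.1)
    rw [← h1, ← h2]
    refine hc2.trans (le_of_eq ?_)
    exact Finset.sum_congr rfl fun t _ => mul_comm _ _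

/-- Values of the auxiliary variable of weight zero can be removed from its alphabet. -/
theorem rate_restrict {T' : Type*} [Fintype T'] {e : T' → T} (he : Function.Injective e)
    (hq : ∀ s x t x₂, (∀ j, e j ≠ t) → q s x (t, x₂) = 0) (hu : (pX, q) ∈ inputLaws X₁ X₂ S T) :
    (pX, fun s x i => q s x (e i.1, i.2)) ∈ inputLaws X₁ X₂ S T' ∧
      rateOne (ch.jointLaw pX fun s x (i : T' × X₂) => q s x (e i.1, i.2)) =
        rateOne (ch.jointLaw pX q) ∧
      rateTwo (ch.jointLaw pX fun s x (i : T' × X₂) => q s x (e i.1, i.2)) =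
        rateTwo (ch.jointLaw pX q) := by
  classical
  set P' := ch.jointLaw pX fun s x (i : T' × X₂) => q s x (e i.1, i.2) with hP'
  have hlaw : law P' (fun ω => (ω.1, ω.2.1, e ω.2.2.1, ω.2.2.2)) = ch.jointLaw pX q := by
    funext ⟨x, s, t, x₂, y, z⟩
    by_cases ht : ∃ j, e j = t
    · obtain ⟨j, rfl⟩ := ht
      rw [law_congr (B := id) (b := (x, s, j, x₂, y, z)) (by
        rintro ⟨x', s', j', x₂', y', z'⟩
        simp [he.eq_iff]), law_id]
      rfl
    · push Not at ht
      rw [law_eq_zero_of fun ω h => absurd (congrArg (fun i => i.2.2.1) h) (ht _)]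
      simp [Channel.jointLaw, hq s x t x₂ ht]
  refine ⟨⟨hu.1, fun s x => ⟨fun i => (hu.2 s x).1 _, ?_⟩⟩, ?_, ?_⟩
  · rw [← (hu.2 s x).2, Fintype.sum_prod_type_right, Fintype.sum_prod_type_right]
    refine Finset.sum_congr rfl fun x₂ _ => ?_
    refine Fintype.sum_of_injective e he _ _ (fun t ht => hq s x t x₂ fun j hj => ht ⟨j, hj⟩) ?_
    exact fun _ => rfl
  · unfold rateOne
    rw [← hlaw]
    simp only [entropy_law]
    rw [entropy_congr P' (A := fun ω => (ω.1, ω.2.1, e ω.2.2.1))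
      (B := fun ω => (ω.1, ω.2.1, ω.2.2.1)) (by simp [he.eq_iff]),
      entropy_congr P' (A := fun ω => (ω.1, e ω.2.2.1, ω.2.2.2.2.1))
      (B := fun ω => (ω.1, ω.2.2.1, ω.2.2.2.2.1)) (by simp [he.eq_iff])]
  · unfold rateTwo
    rw [← hlaw]
    simp only [entropy_law]
    rw [entropy_congr P' (A := fun ω => (ω.1, ω.2.1, e ω.2.2.1))
      (B := fun ω => (ω.1, ω.2.1, ω.2.2.1)) (by simp [he.eq_iff]),
      entropy_congr P' (A := fun ω => (ω.1, ω.2.1, e ω.2.2.1, ω.2.2.2.2.2))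
      (B := fun ω => (ω.1, ω.2.1, ω.2.2.1, ω.2.2.2.2.2)) (by simp [he.eq_iff])]

theorem relaxedRegion_card_bound {R : ℝ × ℝ} (hR : R ∈ ch.relaxedRegion T) :
    ∃ k ≤ Fintype.card X₁ * Fintype.card X₂ * Fintype.card S + 1,
      R ∈ ch.relaxedRegion (Fin k) := by
  classical
  obtain ⟨⟨pX, q⟩, hu, h1, h2⟩ := hR
  obtain ⟨c, hcard, hu', h1', h2'⟩ := exists_sparse_aux (ch := ch) hu
  let A : Finset T := {t | c t ≠ 0}
  let e : Fin A.card → T := fun j => A.equivFin.symm j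
  obtain ⟨hu'', h1'', h2''⟩ := rate_restrict (ch := ch) (e := e)
    (Subtype.val_injective.comp A.equivFin.symm.injective) (fun s x t x₂ ht => by
      have : c t = 0 := by
        by_contra hne
        have hA : t ∈ A := by simpa [A] using hne
        exact ht (A.equivFin ⟨t, hA⟩) (by simp [e])
      simp [this]) hu'
  exact ⟨A.card, hcard, _, hu'', (h1.trans h1').trans h1''.ge, (h2.trans h2').trans h2''.ge⟩

theorem relaxedRegion_subset_iUnion (hdeg : ch.IsDegraded) {R : ℝ × ℝ}
    (hR : R ∈ ch.relaxedRegion T) :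
    ∃ k ≤ Fintype.card X₁ * Fintype.card X₂ * Fintype.card S + 1,
      (max R.1 0, max R.2 0) ∈ ch.rateRegion (Fin k) := by
  obtain ⟨k, hk, h⟩ := relaxedRegion_card_bound hR
  rcases relaxedRegion_subset hdeg h with h | h
  · exact ⟨k, hk, h⟩
  · exact ⟨1, Nat.le_add_left _ _, h⟩

theorem isClosed_iUnion_rateRegion (N : ℕ) :
    IsClosed {R | ∃ k ≤ N, R ∈ ch.rateRegion (Fin k)} := by
  have : {R | ∃ k ≤ N, R ∈ ch.rateRegion (Fin k)} =
      ⋃ k ∈ Set.Iic N, ch.rateRegion (Fin k) := by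
    ext R
    simp
  rw [this]
  exact (Set.finite_Iic N).isClosed_biUnion fun k _ => isClosed_rateRegion

/-- A probability space on which `X₁` is independent of the state and the channel acts as it
should yields a point of the relaxed region. -/
theorem mem_relaxedRegion_of_law {Ω : Type*} [Fintype Ω] {p : Ω → ℝ} (hp : p ∈ stdSimplex ℝ Ω)
    (A : Ω → X₁ × S × T × X₂ × Y × Z)
    (hXS : ∀ x s, law p (fun ω => ((A ω).1, (A ω).2.1)) (x, s) =
      law p (fun ω => (A ω).1) x * ch.stateLaw s)
    (hch : ∀ x s t x₂ yz, law p A (x, s, t, x₂, yz) =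
      law p (fun ω => ((A ω).2.2.1, (A ω).2.2.2.1, (A ω).1, (A ω).2.1)) (t, x₂, x, s) *
        ch.trans x x₂ s yz) :
    (rateOne (law p A), rateTwo (law p A)) ∈ ch.relaxedRegion T := by
  set q : S → X₁ → T × X₂ → ℝ := fun s x i =>
    if law p (fun ω => ((A ω).1, (A ω).2.1)) (x, s) = 0 then
      law p (fun ω => ((A ω).2.2.1, (A ω).2.2.2.1)) i
    else law p (fun ω => ((A ω).2.2.1, (A ω).2.2.2.1, (A ω).1, (A ω).2.1)) (i.1, i.2, x, s) /
      law p (fun ω => ((A ω).1, (A ω).2.1)) (x, s) with hq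
  have hq' : ∀ x s t x₂, law p (fun ω => ((A ω).1, (A ω).2.1)) (x, s) * q s x (t, x₂) =
      law p (fun ω => ((A ω).2.2.1, (A ω).2.2.2.1, (A ω).1, (A ω).2.1)) (t, x₂, x, s) := by
    intro x s t x₂
    simp only [hq]
    split_ifs with h
    · rw [h, zero_mul]
      refine (le_antisymm ?_ (law_nonneg hp.1 _ _)).symm
      rw [← h]
      exact law_le_law_of_imp hp.1 (by grind)
    · field_simp
  have hA : law p A = ch.jointLaw (law p fun ω => (A ω).1) q := by
    funext ⟨x, s, t, x₂, y, z⟩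
    rw [hch, ← hq', hXS]
    rfl
  refine ⟨(_, q), ⟨law_mem_stdSimplex hp _, fun s x => ⟨fun i => ?_, ?_⟩⟩,
    (congrArg rateOne hA).le, (congrArg rateTwo hA).le⟩
  · simp only [hq]
    split_ifs
    · exact law_nonneg hp.1 _ _
    · exact div_nonneg (law_nonneg hp.1 _ _) (law_nonneg hp.1 _ _)
  · simp only [hq]
    split_ifs with h
    · exact (law_mem_stdSimplex hp _).2
    · rw [← Finset.sum_div, div_eq_one_iff_eq h, ← sum_law_fst p
        (fun ω => ((A ω).2.2.1, (A ω).2.2.2.1)) (fun ω => ((A ω).1, (A ω).2.1)) (x, s)]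
      exact Finset.sum_congr rfl fun i _ => law_congr (by grind)

end Cardinality

/-! ### Chain rules for sequences -/

section Sequences

variable {n : ℕ} {α : Type*}

/-- The entries of `v` before position `k`. -/
def initSeg (k : ℕ) (v : Fin n → α) : Fin n → Option α :=
  fun j => if j.1 < k then some (v j) else none

/-- The entries of `v` from position `k` on. -/
def finalSeg (k : ℕ) (v : Fin n → α) : Fin n → Option α :=
  fun j => if k ≤ j.1 then some (v j) else none

theorem initSeg_eq_iff {k : ℕ} {v v' : Fin n → α} :
    initSeg k v = initSeg k v' ↔ ∀ j : Fin n, j.1 < k → v j = v' j := by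
  refine funext_iff.trans (forall_congr' fun j => ?_)
  unfold initSeg
  by_cases h : j.1 < k <;> simp [h]

theorem finalSeg_eq_iff {k : ℕ} {v v' : Fin n → α} :
    finalSeg k v = finalSeg k v' ↔ ∀ j : Fin n, k ≤ j.1 → v j = v' j := by
  refine funext_iff.trans (forall_congr' fun j => ?_)
  unfold finalSeg
  by_cases h : k ≤ j.1 <;> simp [h]

theorem initSeg_succ_eq_iff {i : Fin n} {v v' : Fin n → α} :
    initSeg (i.1 + 1) v = initSeg (i.1 + 1) v' ↔ initSeg i.1 v = initSeg i.1 v' ∧ v i = v' i := by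
  simp only [initSeg_eq_iff]
  refine ⟨fun h => ⟨fun j hj => h j (by omega), h i (by omega)⟩, fun h j hj => ?_⟩
  rcases Nat.lt_succ_iff_lt_or_eq.1 hj with h1 | h1
  · exact h.1 j h1
  · rw [Fin.ext h1]; exact h.2

theorem finalSeg_eq_iff_succ {i : Fin n} {v v' : Fin n → α} :
    finalSeg i.1 v = finalSeg i.1 v' ↔
      finalSeg (i.1 + 1) v = finalSeg (i.1 + 1) v' ∧ v i = v' i := by
  simp only [finalSeg_eq_iff]
  refine ⟨fun h => ⟨fun j hj => h j (by omega), h i le_rfl⟩, fun h j hj => ?_⟩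
  rcases hj.eq_or_lt with h1 | h1
  · rw [← Fin.ext h1]; exact h.2
  · exact h.1 j h1

theorem initSeg_zero_eq {v v' : Fin n → α} : initSeg 0 v = initSeg 0 v' :=
  initSeg_eq_iff.2 fun j hj => absurd hj (by omega)

theorem finalSeg_length_eq {v v' : Fin n → α} : finalSeg n v = finalSeg n v' :=
  finalSeg_eq_iff.2 fun j hj => absurd hj (by omega)

theorem initSeg_length_eq_iff {v v' : Fin n → α} : initSeg n v = initSeg n v' ↔ v = v' := by
  rw [initSeg_eq_iff, funext_iff]
  exact forall_congr' fun j => by simp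

theorem finalSeg_zero_eq_iff {v v' : Fin n → α} : finalSeg 0 v = finalSeg 0 v' ↔ v = v' := by
  rw [finalSeg_eq_iff, funext_iff]
  exact forall_congr' fun j => by simp

theorem sum_fin_sub (F : ℕ → ℝ) (n : ℕ) : ∑ i : Fin n, (F (i.1 + 1) - F i.1) = F n - F 0 := by
  rw [Fin.sum_univ_eq_sum_range (fun i => F (i + 1) - F i), Finset.sum_range_sub]

variable {Ω β γ δ : Type*} [Fintype Ω] [Fintype α] [Fintype β] [Fintype γ] {p : Ω → ℝ}

theorem entropy_seq_le (hp : p ∈ stdSimplex ℝ Ω) (V : Ω → Fin n → α) :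
    entropy p V ≤ ∑ i, entropy p (fun ω => V ω i) := by
  have h := sum_fin_sub (fun k => entropy p fun ω => initSeg k (V ω)) n
  have h0 : entropy p (fun ω => initSeg 0 (V ω)) = 0 := by
    rw [← entropy_const hp.2 ()]
    exact entropy_congr p fun ω ω' => iff_of_true initSeg_zero_eq rfl
  have hn : entropy p (fun ω => initSeg n (V ω)) = entropy p V :=
    entropy_congr p fun ω ω' => initSeg_length_eq_iff
  rw [h0, hn, sub_zero] at h
  rw [← h]
  refine Finset.sum_le_sum fun i _ => ?_
  have e : entropy p (fun ω => initSeg (i.1 + 1) (V ω)) =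
      entropy p (fun ω => (initSeg i.1 (V ω), V ω i)) :=
    entropy_congr p fun ω ω' => by rw [initSeg_succ_eq_iff, Prod.mk.injEq]
  have := entropy_pair_le hp (fun ω => initSeg i.1 (V ω)) (fun ω => V ω i)
  linarith

/-- The Csiszár sum identity in telescoped form: with `Tᵢ = (W, Y^{i-1}, S_{i+1}^n)` the entropies
`H(W, Y^{i-1}, S_i^n)` telescope to `H(W, Y^n) - H(W, S^n)`. -/
theorem csiszar_sum (p : Ω → ℝ) (W : Ω → γ) (U : Ω → Fin n → α) (V : Ω → Fin n → β) :
    ∑ i : Fin n, (entropy p (fun ω => ((W ω, initSeg i.1 (U ω), finalSeg (i.1 + 1) (V ω)), V ω i)) -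
      entropy p (fun ω => ((W ω, initSeg i.1 (U ω), finalSeg (i.1 + 1) (V ω)), U ω i))) =
    entropy p (fun ω => (W ω, V ω)) - entropy p (fun ω => (W ω, U ω)) := by
  have h := sum_fin_sub (fun k => entropy p fun ω => (W ω, initSeg k (U ω), finalSeg k (V ω))) n
  have h0 : entropy p (fun ω => (W ω, initSeg 0 (U ω), finalSeg 0 (V ω))) =
      entropy p (fun ω => (W ω, V ω)) := entropy_congr p fun ω ω' => by
    have := initSeg_zero_eq (v := U ω) (v' := U ω')
    simp only [Prod.mk.injEq, finalSeg_zero_eq_iff]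
    tauto
  have hn : entropy p (fun ω => (W ω, initSeg n (U ω), finalSeg n (V ω))) =
      entropy p (fun ω => (W ω, U ω)) := entropy_congr p fun ω ω' => by
    have := finalSeg_length_eq (v := V ω) (v' := V ω')
    simp only [Prod.mk.injEq, initSeg_length_eq_iff]
    tauto
  rw [h0, hn] at h
  rw [← neg_sub, ← h, ← Finset.sum_neg_distrib]
  refine Finset.sum_congr rfl fun i _ => ?_
  rw [neg_sub]
  congr 1
  · exact entropy_congr p fun ω ω' => by
      simp only [Prod.mk.injEq, finalSeg_eq_iff_succ (i := i)]
      tauto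
  · exact entropy_congr p fun ω ω' => by
      simp only [Prod.mk.injEq, initSeg_succ_eq_iff (i := i)]
      tauto

/-- If `Y^{i-1} - Z^{i-1} - (W, S^n, Z_i)` are Markov chains, then the terms of the chain rule for
`H(Z^n|W, S^n)` are at most `H(Z_i|T_i, S_i)`, where `Tᵢ = (W, Y^{i-1}, S_{i+1}^n)`. -/
theorem condEntropy_seq_le (hp : ∀ ω, 0 ≤ p ω) [Fintype δ] (W : Ω → γ) (U : Ω → Fin n → α)
    (V : Ω → Fin n → β) (D : Ω → Fin n → δ)
    (h₁ : ∀ i : Fin n,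
      entropy p (fun ω => (initSeg i.1 (U ω), (W ω, V ω, D ω i), initSeg i.1 (D ω))) +
        entropy p (fun ω => initSeg i.1 (D ω)) =
      entropy p (fun ω => (initSeg i.1 (U ω), initSeg i.1 (D ω))) +
        entropy p (fun ω => ((W ω, V ω, D ω i), initSeg i.1 (D ω))))
    (h₂ : ∀ i : Fin n,
      entropy p (fun ω => (initSeg i.1 (U ω), (W ω, V ω), initSeg i.1 (D ω))) +
        entropy p (fun ω => initSeg i.1 (D ω)) =
      entropy p (fun ω => (initSeg i.1 (U ω), initSeg i.1 (D ω))) +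
        entropy p (fun ω => ((W ω, V ω), initSeg i.1 (D ω)))) :
    entropy p (fun ω => (D ω, W ω, V ω)) - entropy p (fun ω => (W ω, V ω)) ≤
      ∑ i : Fin n, (entropy p (fun ω =>
          (((W ω, initSeg i.1 (U ω), finalSeg (i.1 + 1) (V ω)), V ω i), D ω i)) -
        entropy p (fun ω => ((W ω, initSeg i.1 (U ω), finalSeg (i.1 + 1) (V ω)), V ω i))) := by
  have h := sum_fin_sub (fun k => entropy p fun ω => (initSeg k (D ω), W ω, V ω)) n
  have h0 : entropy p (fun ω => (initSeg 0 (D ω), W ω, V ω)) =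
      entropy p (fun ω => (W ω, V ω)) := entropy_congr p fun ω ω' => by
    have := initSeg_zero_eq (v := D ω) (v' := D ω')
    simp only [Prod.mk.injEq]
    tauto
  have hn : entropy p (fun ω => (initSeg n (D ω), W ω, V ω)) =
      entropy p (fun ω => (D ω, W ω, V ω)) := entropy_congr p fun ω ω' => by
    simp only [Prod.mk.injEq, initSeg_length_eq_iff]
  rw [h0, hn] at h
  rw [← h]
  refine Finset.sum_le_sum fun i _ => ?_
  have sm := entropy_submodular hp (fun ω => D ω i) (fun ω => (V ω, initSeg i.1 (D ω)))
    (fun ω => ((W ω, initSeg i.1 (U ω), finalSeg (i.1 + 1) (V ω)), V ω i))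
  have e1 : entropy p (fun ω => (initSeg (i.1 + 1) (D ω), W ω, V ω)) =
      entropy p (fun ω => ((W ω, V ω, D ω i), initSeg i.1 (D ω))) :=
    entropy_congr p fun ω ω' => by
      simp only [Prod.mk.injEq, initSeg_succ_eq_iff (i := i)]
      tauto
  have e2 : entropy p (fun ω => (initSeg i.1 (D ω), W ω, V ω)) =
      entropy p (fun ω => ((W ω, V ω), initSeg i.1 (D ω))) :=
    entropy_congr p fun ω ω' => by
      simp only [Prod.mk.injEq]
      tauto
  have e3 : entropy p (fun ω => (D ω i, (V ω, initSeg i.1 (D ω)),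
        ((W ω, initSeg i.1 (U ω), finalSeg (i.1 + 1) (V ω)), V ω i))) =
      entropy p (fun ω => (initSeg i.1 (U ω), (W ω, V ω, D ω i), initSeg i.1 (D ω))) :=
    entropy_congr p fun ω ω' => by
      have : V ω = V ω' → finalSeg (i.1 + 1) (V ω) = finalSeg (i.1 + 1) (V ω') ∧
        V ω i = V ω' i := fun h => by rw [h]; exact ⟨rfl, rfl⟩
      simp only [Prod.mk.injEq]
      tauto
  have e4 : entropy p (fun ω => ((V ω, initSeg i.1 (D ω)),
        ((W ω, initSeg i.1 (U ω), finalSeg (i.1 + 1) (V ω)), V ω i))) =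
      entropy p (fun ω => (initSeg i.1 (U ω), (W ω, V ω), initSeg i.1 (D ω))) :=
    entropy_congr p fun ω ω' => by
      have : V ω = V ω' → finalSeg (i.1 + 1) (V ω) = finalSeg (i.1 + 1) (V ω') ∧
        V ω i = V ω' i := fun h => by rw [h]; exact ⟨rfl, rfl⟩
      simp only [Prod.mk.injEq]
      tauto
  have e5 : entropy p (fun ω => (D ω i,
        ((W ω, initSeg i.1 (U ω), finalSeg (i.1 + 1) (V ω)), V ω i))) =
      entropy p (fun ω =>
        (((W ω, initSeg i.1 (U ω), finalSeg (i.1 + 1) (V ω)), V ω i), D ω i)) :=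
    entropy_congr p fun ω ω' => by
      simp only [Prod.mk.injEq]
      tauto
  have := h₁ i
  have := h₂ i
  linarith

end Sequences

/-! ### Time sharing -/

section TimeSharing

variable {n : ℕ} {Ω α : Type*} [Fintype Ω] {p : Ω → ℝ}

/-- The law of a uniform index `Q` together with an independent point of `Ω`. -/
def timeShare (n : ℕ) (p : Ω → ℝ) : Fin n × Ω → ℝ := fun u => 1 / (n : ℝ) * p u.2

theorem timeShare_mem (hn : 0 < n) (hp : p ∈ stdSimplex ℝ Ω) :
    timeShare n p ∈ stdSimplex ℝ (Fin n × Ω) := by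
  have : (n : ℝ) ≠ 0 := by exact_mod_cast hn.ne'
  refine ⟨fun u => mul_nonneg (by positivity) (hp.1 _), ?_⟩
  simp only [timeShare, Fintype.sum_prod_type, ← Finset.mul_sum, hp.2]
  simp [this]

theorem law_timeShare (B : Fin n × Ω → α) (b : α) :
    law (timeShare n p) B b = 1 / (n : ℝ) * ∑ i, law p (fun ω => B (i, ω)) b := by
  classical
  unfold law timeShare
  rw [Fintype.sum_prod_type, Finset.mul_sum]
  refine Finset.sum_congr rfl fun i _ => ?_
  rw [Finset.mul_sum]
  exact Finset.sum_congr rfl fun ω _ => by rw [mul_ite, mul_zero]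

theorem law_timeShare_of_index (B : Fin n × Ω → α) (b : α) (i : Fin n)
    (h : ∀ u, B u = b → u.1 = i) :
    law (timeShare n p) B b = 1 / (n : ℝ) * law p (fun ω => B (i, ω)) b := by
  rw [law_timeShare, Finset.sum_eq_single i]
  · exact fun j _ hj => law_eq_zero_of fun ω hω => absurd (h _ hω) hj
  · simp

theorem entropy_timeShare [Fintype α] (hn : 0 < n) (hp : p ∈ stdSimplex ℝ Ω)
    {B : Fin n × Ω → α} (h : ∀ u u', B u = B u' → u.1 = u'.1) :
    entropy (timeShare n p) B =
      1 / (n : ℝ) * ∑ i, entropy p (fun ω => B (i, ω)) + Real.logb 2 n := by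
  have hn' : (n : ℝ) ≠ 0 := by exact_mod_cast hn.ne'
  have key : ∀ i : Fin n, entropy p (fun ω => B (i, ω)) + Real.logb 2 n =
      -∑ ω, p ω * Real.logb 2 (law (timeShare n p) B (B (i, ω))) := by
    intro i
    rw [entropy_eq, neg_add_eq_sub, eq_neg_iff_add_eq_zero, ← one_mul (Real.logb 2 n), ← hp.2,
      Finset.sum_mul, ← Finset.sum_sub_distrib, ← Finset.sum_add_distrib]
    refine Finset.sum_eq_zero fun ω _ => ?_
    rcases (hp.1 ω).eq_or_lt with h0 | h0
    · simp [← h0]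
    · rw [law_timeShare_of_index B _ i fun u hu => h _ _ hu,
        Real.logb_mul (one_div_ne_zero hn') (law_pos hp.1 (fun ω => B (i, ω)) h0).ne',
        one_div, Real.logb_inv]
      ring
  have e : entropy (timeShare n p) B =
      1 / (n : ℝ) * ∑ i, (entropy p (fun ω => B (i, ω)) + Real.logb 2 n) := by
    rw [entropy_eq, Fintype.sum_prod_type, Finset.mul_sum, ← Finset.sum_neg_distrib]
    refine Finset.sum_congr rfl fun i _ => ?_
    rw [key, mul_neg, Finset.mul_sum]
    simp only [timeShare, mul_assoc]
  rw [e, Finset.sum_add_distrib, mul_add]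
  simp [hn']

/-- Entropy is concave: mixing increases it. -/
theorem sum_entropy_le_timeShare [Fintype α] (hn : 0 < n) (hp : p ∈ stdSimplex ℝ Ω)
    (B : Fin n × Ω → α) :
    1 / (n : ℝ) * ∑ i, entropy p (fun ω => B (i, ω)) ≤ entropy (timeShare n p) B := by
  have h1 := entropy_pair_le (timeShare_mem hn hp) B Prod.fst
  rw [entropy_timeShare hn hp (B := fun u => (B u, u.1)) (by simp +contextual),
    entropy_timeShare hn hp (B := Prod.fst) (by simp)] at h1
  have h2 : ∀ i : Fin n, entropy p (fun ω => (B (i, ω), i)) = entropy p (fun ω => B (i, ω)) :=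
    fun i => entropy_congr p (by simp)
  simp only [h2, entropy_const hp.2] at h1
  simpa using h1

end TimeSharing

/-! ### Converse -/

section Converse

theorem law_eq_sum_mul {Ω α : Type*} [Fintype Ω] [DecidableEq α] (p : Ω → ℝ) (A : Ω → α)
    (a : α) : law p A a = ∑ ω, p ω * if A ω = a then 1 else 0 := by
  unfold law
  refine Finset.sum_congr rfl fun ω _ => ?_
  by_cases h : A ω = a <;> simp [h]

variable {X₁ X₂ S Y Z : Type*} [Fintype S] [Fintype Y] [Fintype Z] {M₁ M₂ n : ℕ}

/-- The joint law of messages, state sequence and output sequences induced by a code. -/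
def codeLaw (c : Code X₁ X₂ S Y Z M₁ M₂ n) (ch : Channel X₁ X₂ S Y Z) :
    (Fin M₁ × Fin M₂ × (Fin n → S)) × (Fin n → Y × Z) → ℝ := fun ω =>
  1 / ((M₁ : ℝ) * (M₂ : ℝ)) * (∏ i, ch.stateLaw (ω.1.2.2 i)) *
    ∏ i, ch.trans (c.enc₁ ω.1.1 i) (c.enc₂ ω.1.1 ω.1.2.1 ω.1.2.2 i) (ω.1.2.2 i) (ω.2 i)

variable {c : Code X₁ X₂ S Y Z M₁ M₂ n} {ch : Channel X₁ X₂ S Y Z}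

theorem sum_prod_trans (c : Code X₁ X₂ S Y Z M₁ M₂ n) (ch : Channel X₁ X₂ S Y Z)
    (m : Fin M₁ × Fin M₂ × (Fin n → S)) : ∑ v : Fin n → Y × Z,
      ∏ i, ch.trans (c.enc₁ m.1 i) (c.enc₂ m.1 m.2.1 m.2.2 i) (m.2.2 i) (v i) = 1 := by
  rw [sum_prod_pi]
  exact Finset.prod_eq_one fun i _ => (ch.trans_mem _ _ _).2

/-- Expectations of functions of the messages and the state sequence. -/
theorem sum_codeLaw (f : Fin M₁ × Fin M₂ × (Fin n → S) → ℝ) :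
    ∑ ω, codeLaw c ch ω * f ω.1 =
      1 / ((M₁ : ℝ) * (M₂ : ℝ)) * ∑ w₁, ∑ w₂, ∑ s, f (w₁, w₂, s) * ∏ i, ch.stateLaw (s i) := by
  rw [Fintype.sum_prod_type]
  simp only [codeLaw]
  have : ∀ m : Fin M₁ × Fin M₂ × (Fin n → S), ∑ v : Fin n → Y × Z,
      1 / ((M₁ : ℝ) * (M₂ : ℝ)) * (∏ i, ch.stateLaw (m.2.2 i)) *
        (∏ i, ch.trans (c.enc₁ m.1 i) (c.enc₂ m.1 m.2.1 m.2.2 i) (m.2.2 i) (v i)) * f m =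
      1 / ((M₁ : ℝ) * (M₂ : ℝ)) * (f m * ∏ i, ch.stateLaw (m.2.2 i)) := by
    intro m
    rw [← Finset.sum_mul, ← Finset.mul_sum, sum_prod_trans, mul_one]
    ring
  rw [Finset.sum_congr rfl fun m _ => this m, ← Finset.mul_sum, Fintype.sum_prod_type]
  simp_rw [Fintype.sum_prod_type]

theorem sum_state (ch : Channel X₁ X₂ S Y Z) (n : ℕ) :
    ∑ s : Fin n → S, ∏ i, ch.stateLaw (s i) = 1 :=
  (pi_mem_stdSimplex fun _ : Fin n => ch.stateLaw_mem).2

theorem codeLaw_mem (h₁ : 0 < M₁) (h₂ : 0 < M₂) :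
    codeLaw c ch ∈ stdSimplex ℝ ((Fin M₁ × Fin M₂ × (Fin n → S)) × (Fin n → Y × Z)) := by
  refine ⟨fun ω => mul_nonneg (mul_nonneg (by positivity)
    (Finset.prod_nonneg fun i _ => ch.stateLaw_mem.1 _))
    (Finset.prod_nonneg fun i _ => (ch.trans_mem _ _ _).1 _), ?_⟩
  have := sum_codeLaw (c := c) (ch := ch) fun _ => 1
  have h₁' : (M₁ : ℝ) ≠ 0 := by exact_mod_cast h₁.ne'
  have h₂' : (M₂ : ℝ) ≠ 0 := by exact_mod_cast h₂.ne'
  simp only [mul_one, one_mul, sum_state, Finset.sum_const, Finset.card_univ, Fintype.card_fin,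
    nsmul_eq_mul] at this
  rw [this]
  field_simp

theorem law_codeLaw_input (w₁ : Fin M₁) (w₂ : Fin M₂) (s : Fin n → S) :
    law (codeLaw c ch) (fun ω => (ω.1.2.1, ω.1.1, ω.1.2.2)) (w₂, w₁, s) =
      1 / ((M₁ : ℝ) * (M₂ : ℝ)) * ∏ i, ch.stateLaw (s i) := by
  classical
  rw [law_eq_sum_mul, sum_codeLaw fun m => if (m.2.1, m.1, m.2.2) = (w₂, w₁, s) then 1 else 0,
    Finset.sum_eq_single w₁, Finset.sum_eq_single w₂, Finset.sum_eq_single s]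
  all_goals simp +contextual

theorem law_codeLaw_msg₁_state (h₂ : 0 < M₂) (w₁ : Fin M₁) (s : Fin n → S) :
    law (codeLaw c ch) (fun ω => (ω.1.1, ω.1.2.2)) (w₁, s) =
      1 / (M₁ : ℝ) * ∏ i, ch.stateLaw (s i) := by
  have h₂' : (M₂ : ℝ) ≠ 0 := by exact_mod_cast h₂.ne'
  rw [← sum_law_fst (codeLaw c ch) (fun ω => ω.1.2.1) (fun ω => (ω.1.1, ω.1.2.2)) (w₁, s)]
  simp_rw [law_codeLaw_input]
  simp only [Finset.sum_const, Finset.card_univ, Fintype.card_fin, nsmul_eq_mul]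
  field_simp

theorem law_codeLaw_msg₁ (h₂ : 0 < M₂) (w₁ : Fin M₁) :
    law (codeLaw c ch) (fun ω => ω.1.1) w₁ = 1 / (M₁ : ℝ) := by
  rw [← sum_law_snd (codeLaw c ch) (fun ω => ω.1.1) (fun ω => ω.1.2.2) w₁]
  simp_rw [law_codeLaw_msg₁_state h₂]
  rw [← Finset.mul_sum, sum_state, mul_one]

theorem law_codeLaw_msg₂ (h₁ : 0 < M₁) (w₂ : Fin M₂) :
    law (codeLaw c ch) (fun ω => ω.1.2.1) w₂ = 1 / (M₂ : ℝ) := by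
  have h₁' : (M₁ : ℝ) ≠ 0 := by exact_mod_cast h₁.ne'
  rw [← sum_law_snd (codeLaw c ch) (fun ω => ω.1.2.1) (fun ω => (ω.1.1, ω.1.2.2)) w₂,
    Fintype.sum_prod_type]
  simp_rw [law_codeLaw_input]
  simp only [← Finset.mul_sum, sum_state, Finset.sum_const, Finset.card_univ, Fintype.card_fin,
    nsmul_eq_mul]
  field_simp

/-- The input of encoder 1 is independent of the state at the same time. -/
theorem law_codeLaw_input_state (i : Fin n) {α : Type*}
    (g : Fin M₁ → α) (a : α) (s : S) :
    law (codeLaw c ch) (fun ω => (g ω.1.1, ω.1.2.2 i)) (a, s) =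
      law (codeLaw c ch) (fun ω => g ω.1.1) a * ch.stateLaw s := by
  classical
  rw [law_eq_sum_mul, law_eq_sum_mul,
    sum_codeLaw fun m => if (g m.1, m.2.2 i) = (a, s) then 1 else 0,
    sum_codeLaw fun m => if g m.1 = a then 1 else 0, mul_assoc, Finset.sum_mul]
  congr 1
  refine Finset.sum_congr rfl fun w₁ _ => ?_
  rw [Finset.sum_mul]
  refine Finset.sum_congr rfl fun w₂ _ => ?_
  by_cases h : g w₁ = a
  · have := sum_coord (τ := fun _ : Fin n => ch.stateLaw) (fun _ => ch.stateLaw_mem.2) i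
      (fun b => if b = s then 1 else 0)
    simp only [h, Prod.mk.injEq, true_and, if_true, one_mul, sum_state, this]
    simp
  · simp [h]

theorem law_codeLaw_state (h₁ : 0 < M₁) (h₂ : 0 < M₂) (i : Fin n) (s : S) :
    law (codeLaw c ch) (fun ω => ω.1.2.2 i) s = ch.stateLaw s := by
  have := law_codeLaw_input_state (c := c) (ch := ch) i (fun _ => ()) () s
  rw [law_const, (codeLaw_mem h₁ h₂).2, one_mul] at this
  rw [← this]
  exact law_congr (by simp)

theorem entropy_msg₁_state (h₁ : 0 < M₁) (h₂ : 0 < M₂) :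
    entropy (codeLaw c ch) (fun ω => (ω.1.1, ω.1.2.2)) =
      entropy (codeLaw c ch) (fun ω => ω.1.1) +
        ∑ i, entropy (codeLaw c ch) (fun ω => ω.1.2.2 i) := by
  have hp := codeLaw_mem (c := c) (ch := ch) h₁ h₂
  simp only [entropy_eq]
  rw [Finset.sum_neg_distrib, ← neg_add, Finset.sum_comm, ← Finset.sum_add_distrib]
  congr 1
  refine Finset.sum_congr rfl fun ω _ => ?_
  rcases (hp.1 ω).eq_or_lt with h0 | h0
  · simp [← h0]
  · rw [← Finset.mul_sum, ← mul_add, law_codeLaw_msg₁_state h₂, law_codeLaw_msg₁ h₂]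
    simp_rw [law_codeLaw_state h₁ h₂]
    have hs : ∀ i, ch.stateLaw (ω.1.2.2 i) ≠ 0 := fun i => by
      rw [← law_codeLaw_state (c := c) h₁ h₂ i]
      exact (law_pos hp.1 (fun ω => ω.1.2.2 i) h0).ne'
    have h₁' : (M₁ : ℝ) ≠ 0 := by exact_mod_cast h₁.ne'
    rw [Real.logb_mul (one_div_ne_zero h₁') (Finset.prod_ne_zero_iff.2 fun i _ => hs i),
      Real.logb_prod _ _ fun i _ => hs i]

theorem entropy_msgs_state (h₁ : 0 < M₁) (h₂ : 0 < M₂) :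
    entropy (codeLaw c ch) (fun ω => (ω.1.2.1, ω.1.1, ω.1.2.2)) =
      Real.logb 2 M₂ + entropy (codeLaw c ch) (fun ω => (ω.1.1, ω.1.2.2)) := by
  have hp := codeLaw_mem (c := c) (ch := ch) h₁ h₂
  rw [entropy_of_indep hp (fun ω => ω.1.2.1) (fun ω => (ω.1.1, ω.1.2.2)),
    entropy_of_uniform hp (law_codeLaw_msg₂ h₁)]
  rintro w₂ ⟨w₁, s⟩
  rw [law_codeLaw_input, law_codeLaw_msg₂ h₁, law_codeLaw_msg₁_state h₂]
  ring

/-- Given the messages and the state sequence, the outputs at time `i` depend on the inputs and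
the state at time `i` only; `G` may depend on the outputs at other times. -/
theorem law_codeLaw_output (i : Fin n) {α : Type*}
    (G : (Fin M₁ × Fin M₂ × (Fin n → S)) × (Fin n → Y × Z) → α)
    (hG : ∀ m v b, G (m, Function.update v i b) = G (m, v)) (x : X₁) (x₂ : X₂) (s : S) (a : α)
    (hx : ∀ m v, G (m, v) = a → c.enc₁ m.1 i = x ∧ c.enc₂ m.1 m.2.1 m.2.2 i = x₂ ∧ m.2.2 i = s)
    (yz : Y × Z) :
    law (codeLaw c ch) (fun ω => (G ω, ω.2 i)) (a, yz) =
      law (codeLaw c ch) G a * ch.trans x x₂ s yz := by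
  classical
  rw [law_eq_sum_mul, law_eq_sum_mul, Fintype.sum_prod_type,
    Fintype.sum_prod_type (f := fun ω => codeLaw c ch ω * if G ω = a then 1 else 0),
    Finset.sum_mul]
  refine Finset.sum_congr rfl fun m _ => ?_
  have hτ : ∑ b : Y × Z, ch.trans (c.enc₁ m.1 i) (c.enc₂ m.1 m.2.1 m.2.2 i) (m.2.2 i) b = 1 :=
    (ch.trans_mem _ _ _).2
  have h := sum_mul_coord (τ := fun j => ch.trans (c.enc₁ m.1 j) (c.enc₂ m.1 m.2.1 m.2.2 j)
    (m.2.2 j)) i hτ (G := fun v => if G (m, v) = a then 1 else 0)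
    (fun v b => by simp only [hG]) (fun b => if b = yz then 1 else 0)
  simp only [mul_ite, mul_one, mul_zero, Finset.sum_ite_eq', Finset.mem_univ, if_true] at h
  have e1 : ∀ v : Fin n → Y × Z, codeLaw c ch (m, v) * (if (G (m, v), v i) = (a, yz) then 1 else 0)
      = 1 / ((M₁ : ℝ) * (M₂ : ℝ)) * (∏ i, ch.stateLaw (m.2.2 i)) *
        ((if v i = yz then (if G (m, v) = a then (1 : ℝ) else 0) else 0) *
          ∏ j, ch.trans (c.enc₁ m.1 j) (c.enc₂ m.1 m.2.1 m.2.2 j) (m.2.2 j) (v j)) := by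
    intro v
    by_cases h1 : v i = yz <;> by_cases h2 : G (m, v) = a <;> simp [h1, h2, codeLaw]
  have e2 : ∀ v : Fin n → Y × Z, codeLaw c ch (m, v) * (if G (m, v) = a then 1 else 0)
      = 1 / ((M₁ : ℝ) * (M₂ : ℝ)) * (∏ i, ch.stateLaw (m.2.2 i)) *
        ((if G (m, v) = a then (1 : ℝ) else 0) *
          ∏ j, ch.trans (c.enc₁ m.1 j) (c.enc₂ m.1 m.2.1 m.2.2 j) (m.2.2 j) (v j)) := by
    intro v
    by_cases h2 : G (m, v) = a <;> simp [h2, codeLaw]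
  rw [Finset.sum_congr rfl fun v _ => e1 v, Finset.sum_congr rfl fun v _ => e2 v,
    ← Finset.mul_sum, ← Finset.mul_sum, h]
  by_cases hm : ∃ v, G (m, v) = a
  · obtain ⟨v, hv⟩ := hm
    obtain ⟨h1, h2, h3⟩ := hx m v hv
    rw [h1, h2, h3]
    ring
  · push Not at hm
    simp [hm]

/-- Degradedness makes `Y^{k} - Z^{k} - (W₁, W₂, S^n, Z^n)` a Markov chain for every initial
segment. -/
theorem law_codeLaw_initSeg {K : Z → Y → ℝ} (hK : ∀ z, K z ∈ stdSimplex ℝ Y)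
    (htr : ∀ x₁ x₂ s y z, ch.trans x₁ x₂ s (y, z) = ch.transZ x₁ x₂ s z * K z y) (k : ℕ) :
    ∃ κ : (Fin n → Option Z) → (Fin n → Option Y) → ℝ,
      ∀ b (w : (Fin M₁ × Fin M₂ × (Fin n → S)) × (Fin n → Z)),
        law (codeLaw c ch) (fun ω => (initSeg k (fun j => (ω.2 j).1), (ω.1, fun j => (ω.2 j).2)))
          (b, w) = κ (initSeg k w.2) b *
            law (codeLaw c ch) (fun ω => (ω.1, fun j => (ω.2 j).2)) w := by
  classical
  let κ₁ : Option Z → Option Y → ℝ := fun o b =>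
    o.elim (if b = none then 1 else 0) fun z => ∑ y, if some y = b then K z y else 0
  have hκ : ∀ (j : Fin n) (z : Z) (b : Option Y),
      ∑ y, (if (if j.1 < k then some y else none) = b then K z y else 0) =
        κ₁ (if j.1 < k then some z else none) b := by
    intro j z b
    by_cases hj : j.1 < k
    · simp [κ₁, hj]
    · by_cases hb : b = none
      · simp [κ₁, hj, hb, (hK z).2]
      · simp [κ₁, hj, hb, eq_comm (a := none)]
  refine ⟨fun ζ b => ∏ j, κ₁ (ζ j) (b j), fun b ⟨m, z⟩ => ?_⟩
  let C : ℝ := 1 / ((M₁ : ℝ) * (M₂ : ℝ)) * ∏ i, ch.stateLaw (m.2.2 i)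
  let τ : Fin n → Y × Z → ℝ := fun j =>
    ch.trans (c.enc₁ m.1 j) (c.enc₂ m.1 m.2.1 m.2.2 j) (m.2.2 j)
  let t : Fin n → ℝ := fun j =>
    ch.transZ (c.enc₁ m.1 j) (c.enc₂ m.1 m.2.1 m.2.2 j) (m.2.2 j) (z j)
  have h1 : law (codeLaw c ch) (fun ω => (ω.1, fun j => (ω.2 j).2)) (m, z) = C * ∏ j, t j := by
    rw [law_eq_sum_mul, Fintype.sum_prod_type, Finset.sum_eq_single m]
    · have : ∀ v : Fin n → Y × Z, codeLaw c ch (m, v) *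
          (if (m, fun j => (v j).2) = (m, z) then 1 else 0) =
          C * ∏ j, (if (v j).2 = z j then τ j (v j) else 0) := by
        intro v
        by_cases hv : (fun j => (v j).2) = z
        · subst hv
          simp [codeLaw, C, τ]
        · obtain ⟨j, hj⟩ := Function.ne_iff.1 hv
          rw [if_neg (by simpa using hv), mul_zero,
            Finset.prod_eq_zero (Finset.mem_univ j) (if_neg hj), mul_zero]
      refine (Finset.sum_congr rfl fun v _ => this v).trans ?_
      rw [← Finset.mul_sum, sum_prod_pi (fun j u => if u.2 = z j then τ j u else 0)]
      congr 1
      refine Finset.prod_congr rfl fun j _ => ?_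
      simp [Fintype.sum_prod_type, τ, t, Channel.transZ]
    · intro m' _ hm
      simp [hm]
    · simp
  have h2 : law (codeLaw c ch)
      (fun ω => (initSeg k (fun j => (ω.2 j).1), (ω.1, fun j => (ω.2 j).2))) (b, (m, z)) =
      C * ∏ j, (t j * κ₁ (initSeg k z j) (b j)) := by
    rw [law_eq_sum_mul, Fintype.sum_prod_type, Finset.sum_eq_single m]
    · have : ∀ v : Fin n → Y × Z, codeLaw c ch (m, v) *
          (if (initSeg k (fun j => (v j).1), (m, fun j => (v j).2)) = (b, (m, z)) then 1 else 0) =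
          C * ∏ j, (if (v j).2 = z j then
            (if (if j.1 < k then some (v j).1 else none) = b j then τ j (v j) else 0) else 0) := by
        intro v
        by_cases hv : (fun j => (v j).2) = z
        · by_cases hb : initSeg k (fun j => (v j).1) = b
          · subst hv hb
            simp [codeLaw, C, τ, initSeg]
          · obtain ⟨j, hj⟩ := Function.ne_iff.1 hb
            rw [if_neg (by simp [hb]), mul_zero, Finset.prod_eq_zero (Finset.mem_univ j),
              mul_zero]
            rw [if_pos (congrFun hv j)]
            exact if_neg hj
        · obtain ⟨j, hj⟩ := Function.ne_iff.1 hv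
          rw [if_neg (by simp [hv]), mul_zero,
            Finset.prod_eq_zero (Finset.mem_univ j) (if_neg hj), mul_zero]
      have e := Finset.sum_congr rfl fun v (_ : v ∈ Finset.univ) => this v
      refine Eq.trans (Finset.sum_congr rfl fun v _ => by congr) (e.trans ?_)
      rw [← Finset.mul_sum, sum_prod_pi (fun j u => if u.2 = z j then
            (if (if j.1 < k then some u.1 else none) = b j then τ j u else 0) else 0)]
      congr 1
      refine Finset.prod_congr rfl fun j _ => ?_
      rw [Fintype.sum_prod_type]
      simp only [Finset.sum_ite_eq', Finset.mem_univ, if_true, τ, htr]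
      rw [initSeg, ← hκ j (z j) (b j), Finset.mul_sum]
      exact Finset.sum_congr rfl fun y _ => by rw [mul_ite, mul_zero]
    · intro m' _ hm
      simp [hm]
    · simp
  rw [h1, h2, Finset.prod_mul_distrib]
  ring

/-- The auxiliary variable of the converse, `Tᵢ = (W₁, Y^{i-1}, S_{i+1}^n)`. -/
def convAux (i : Fin n) (ω : (Fin M₁ × Fin M₂ × (Fin n → S)) × (Fin n → Y × Z)) :
    Fin M₁ × (Fin n → Option Y) × (Fin n → Option S) :=
  (ω.1.1, initSeg i.1 (fun j => (ω.2 j).1), finalSeg (i.1 + 1) ω.1.2.2)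

/-- The single-letter variables of the converse, at a uniformly chosen time. -/
def convVars (c : Code X₁ X₂ S Y Z M₁ M₂ n)
    (u : Fin n × ((Fin M₁ × Fin M₂ × (Fin n → S)) × (Fin n → Y × Z))) :
    X₁ × S × (Fin n × Fin M₁ × (Fin n → Option Y) × (Fin n → Option S)) × X₂ × Y × Z :=
  (c.enc₁ u.2.1.1 u.1, u.2.1.2.2 u.1, (u.1, convAux u.1 u.2),
    c.enc₂ u.2.1.1 u.2.1.2.1 u.2.1.2.2 u.1, u.2.2 u.1)

/-- The single-letter variables have a joint law of the form required in the region: the inputs of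
encoder 1 are independent of the state, and `Tᵢ` contains no information on the outputs at time `i`
beyond the inputs and the state. -/
theorem convVars_mem [Fintype X₁] [Fintype X₂] (hn : 0 < n) (h₁ : 0 < M₁) (h₂ : 0 < M₂) :
    (rateOne (law (timeShare n (codeLaw c ch)) (convVars c)),
      rateTwo (law (timeShare n (codeLaw c ch)) (convVars c))) ∈
      ch.relaxedRegion (Fin n × Fin M₁ × (Fin n → Option Y) × (Fin n → Option S)) := by
  refine mem_relaxedRegion_of_law (timeShare_mem hn (codeLaw_mem h₁ h₂)) _ (fun x s => ?_)
    (fun x s t x₂ yz => ?_)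
  · rw [law_timeShare, law_timeShare, mul_assoc, Finset.sum_mul]
    congr 1
    exact Finset.sum_congr rfl fun i _ =>
      law_codeLaw_input_state i (fun w => c.enc₁ w i) x s
  · rw [law_timeShare_of_index _ _ t.1 (fun u hu => by
        rw [← congrArg (fun a => a.2.2.1.1) hu]; rfl),
      law_timeShare_of_index _ _ t.1 (fun u hu => by
        rw [← congrArg (fun a => a.1.1) hu]; rfl), mul_assoc]
    congr 1
    have := law_codeLaw_output (c := c) (ch := ch) t.1
      (fun ω => ((t.1, convAux t.1 ω), c.enc₂ ω.1.1 ω.1.2.1 ω.1.2.2 t.1, c.enc₁ ω.1.1 t.1,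
        ω.1.2.2 t.1)) (fun m v b => by
          have : initSeg t.1.1 (fun j => (Function.update v t.1 b j).1) =
              initSeg t.1.1 (fun j => (v j).1) := initSeg_eq_iff.2 fun j hj => by
            rw [Function.update_of_ne (by rintro rfl; exact lt_irrefl _ hj)]
          simp only [convAux, this]) x x₂ s (t, x₂, x, s)
      (fun m v h => by
        simp only [Prod.mk.injEq] at h
        tauto) yz
    refine Eq.trans (law_congr fun ω => ?_) this
    simp only [convVars, Prod.mk.injEq]
    tauto

theorem errorProb_eq (c : Code X₁ X₂ S Y Z M₁ M₂ n) (ch : Channel X₁ X₂ S Y Z) :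
    c.errorProb ch = ∑ ω, if c.dec₁ (fun j => (ω.2 j).1) = ω.1.1 ∧
      c.dec₂ (fun j => (ω.2 j).2) = (ω.1.1, ω.1.2.1) then 0 else codeLaw c ch ω := by
  simp only [Code.errorProb, Code.errorProbAt, Fintype.sum_prod_type, Finset.mul_sum]
  refine Finset.sum_congr rfl fun w₁ _ => Finset.sum_congr rfl fun w₂ _ =>
    Finset.sum_congr rfl fun s _ => ?_
  rw [← (Equiv.arrowProdEquivProdArrow (Fin n) (fun _ => Y) (fun _ => Z)).symm.sum_comp,
    Fintype.sum_prod_type]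
  refine Finset.sum_congr rfl fun y _ => Finset.sum_congr rfl fun z _ => ?_
  rw [mul_ite, mul_zero]
  simp only [Equiv.arrowProdEquivProdArrow, Equiv.coe_fn_symm_mk, codeLaw]
  exact if_congr Iff.rfl rfl (mul_assoc _ _ _).symm

/-- An event that holds whenever the decoders are right fails with at most the error
probability. -/
theorem sum_le_errorProb (h₁ : 0 < M₁) (h₂ : 0 < M₂)
    (E : (Fin M₁ × Fin M₂ × (Fin n → S)) × (Fin n → Y × Z) → Prop)
    (hE : ∀ ω, c.dec₁ (fun j => (ω.2 j).1) = ω.1.1 ∧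
      c.dec₂ (fun j => (ω.2 j).2) = (ω.1.1, ω.1.2.1) → E ω) :
    (open Classical in ∑ ω, if E ω then 0 else codeLaw c ch ω) ≤ c.errorProb ch := by
  classical
  rw [errorProb_eq]
  refine Finset.sum_le_sum fun ω _ => ?_
  have h0 := (codeLaw_mem (c := c) (ch := ch) h₁ h₂).1 ω
  by_cases h1 : c.dec₁ (fun j => (ω.2 j).1) = ω.1.1 ∧
      c.dec₂ (fun j => (ω.2 j).2) = (ω.1.1, ω.1.2.1)
  · rw [if_pos (hE ω h1), if_pos h1]
  · rw [if_neg h1]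
    split_ifs
    exacts [h0, le_rfl]

theorem entropy_eq_of_law_eq {Ω Ω' α : Type*} [Fintype Ω] [Fintype Ω'] [Fintype α] {p : Ω → ℝ}
    {p' : Ω' → ℝ} {A : Ω → α} {A' : Ω' → α} (h : ∀ a, law p A a = law p' A' a) :
    entropy p A = entropy p' A' := by
  unfold entropy
  simp_rw [h]

theorem entropy_convVars_state [Fintype X₁] (hn : 0 < n) (h₁ : 0 < M₁) (h₂ : 0 < M₂) :
    entropy (timeShare n (codeLaw c ch))
      (fun u => ((convVars c u).1, (convVars c u).2.1, (convVars c u).2.2.1)) =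
      1 / (n : ℝ) * ∑ i : Fin n, entropy (codeLaw c ch) (fun ω => (convAux i ω, ω.1.2.2 i)) +
        Real.logb 2 n := by
  have hp := codeLaw_mem (c := c) (ch := ch) h₁ h₂
  rw [entropy_timeShare hn hp (by simp +contextual [convVars])]
  congr 2
  refine Finset.sum_congr rfl fun i _ => entropy_congr _ fun ω ω' => ?_
  simp only [convVars, convAux, Prod.mk.injEq, true_and]
  have : ω.1.1 = ω'.1.1 → c.enc₁ ω.1.1 i = c.enc₁ ω'.1.1 i := fun h => by rw [h]
  tauto

/-- The Markov chains `Y^{i-1} - Z^{i-1} - (W₁, S^n, Z_i)` of a degraded channel bound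
`H(Z^n|W₁, S^n)`. -/
theorem condEntropy_outputs_le (hdeg : ch.IsDegraded) (h₁ : 0 < M₁) (h₂ : 0 < M₂) :
    entropy (codeLaw c ch) (fun ω => ((fun j => (ω.2 j).2), ω.1.1, ω.1.2.2)) -
      entropy (codeLaw c ch) (fun ω => (ω.1.1, ω.1.2.2)) ≤
    ∑ i : Fin n, (entropy (codeLaw c ch) (fun ω => ((convAux i ω, ω.1.2.2 i), (ω.2 i).2)) -
      entropy (codeLaw c ch) (fun ω => (convAux i ω, ω.1.2.2 i))) := by
  obtain ⟨K, hK, htr⟩ := hdeg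
  have hp := codeLaw_mem (c := c) (ch := ch) h₁ h₂
  choose κ hκ using law_codeLaw_initSeg (c := c) hK htr
  have m₁ := fun i : Fin n => entropy_of_kernel hp.1 (W := fun ω => (ω.1, fun j => (ω.2 j).2))
    (ζ := fun w => initSeg i.1 w.2) (hκ i.1) fun w => (w.1.1, w.1.2.2, w.2 i)
  have m₂ := fun i : Fin n => entropy_of_kernel hp.1 (W := fun ω => (ω.1, fun j => (ω.2 j).2))
    (ζ := fun w => initSeg i.1 w.2) (hκ i.1) fun w => (w.1.1, w.1.2.2)
  have := condEntropy_seq_le hp.1 (fun ω => ω.1.1) (fun ω j => (ω.2 j).1)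
    (fun ω => ω.1.2.2) (fun ω j => (ω.2 j).2) m₁ m₂
  exact this

/-- The bound on `R₁`: Fano's inequality for `W₁` and `Y^n`, and the Csiszár sum identity. -/
theorem le_rateOne [Fintype X₁] [Fintype X₂] (hn : 0 < n) (h₁ : 0 < M₁) (h₂ : 0 < M₂) :
    1 / (n : ℝ) * ((1 - c.errorProb ch) * Real.logb 2 M₁ - 1) ≤
      rateOne (law (timeShare n (codeLaw c ch)) (convVars c)) := by
  have hp := codeLaw_mem (c := c) (ch := ch) h₁ h₂
  have hn' : (n : ℝ) ≠ 0 := by exact_mod_cast hn.ne'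
  have hY := sum_entropy_le_timeShare hn hp (fun u => (convVars c u).2.2.2.2.1)
  have hXS := entropy_pair_le (timeShare_mem hn hp) (fun u => (convVars c u).1)
    (fun u => (convVars c u).2.1)
  have hS : entropy (timeShare n (codeLaw c ch)) (fun u => (convVars c u).2.1) =
      1 / (n : ℝ) * ∑ i : Fin n, entropy (codeLaw c ch) (fun ω => ω.1.2.2 i) := by
    have : ∀ i : Fin n, entropy (codeLaw c ch) (fun ω => ω.1.2.2 i) =
        entropy (timeShare n (codeLaw c ch)) (fun u => (convVars c u).2.1) := fun i =>
      entropy_eq_of_law_eq fun s => by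
        rw [law_timeShare, law_codeLaw_state h₁ h₂]
        simp only [convVars, law_codeLaw_state h₁ h₂]
        simp [hn']
    simp only [this]
    simp [hn']
  have hXST := entropy_convVars_state (c := c) (ch := ch) hn h₁ h₂
  have hXTY : entropy (timeShare n (codeLaw c ch))
      (fun u => ((convVars c u).1, (convVars c u).2.2.1, (convVars c u).2.2.2.2.1)) =
      1 / (n : ℝ) * ∑ i : Fin n, entropy (codeLaw c ch) (fun ω => (convAux i ω, (ω.2 i).1)) +
        Real.logb 2 n := by
    rw [entropy_timeShare hn hp (by simp +contextual [convVars])]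
    congr 2
    refine Finset.sum_congr rfl fun i _ => entropy_congr _ fun ω ω' => ?_
    simp only [convVars, convAux, Prod.mk.injEq, true_and]
    have : ω.1.1 = ω'.1.1 → c.enc₁ ω.1.1 i = c.enc₁ ω'.1.1 i := fun h => by rw [h]
    tauto
  have cs := csiszar_sum (codeLaw c ch) (fun ω => ω.1.1) (fun ω j => (ω.2 j).1)
    (fun ω => ω.1.2.2)
  have hseq := entropy_seq_le hp (fun ω j => (ω.2 j).1)
  have hfano := fano hp (fun ω => ω.1.1) (fun ω j => (ω.2 j).1) c.dec₁
    (sum_le_errorProb (c := c) (ch := ch) h₁ h₂ _ fun ω h => h.1)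
  have hW := entropy_of_uniform hp (law_codeLaw_msg₁ h₂)
  rw [Fintype.card_fin] at hfano
  rw [Finset.sum_sub_distrib, entropy_msg₁_state h₁ h₂] at cs
  simp only [rateOne, entropy_law]
  rw [hXST, hXTY]
  rw [hS] at hXS
  have key : 1 / (n : ℝ) * ((1 - c.errorProb ch) * Real.logb 2 M₁ - 1) ≤
      1 / (n : ℝ) * (∑ i, entropy (codeLaw c ch) (fun ω => (ω.2 i).1) -
        ∑ i : Fin n, entropy (codeLaw c ch) (fun ω => ω.1.2.2 i) +
        (∑ i : Fin n, entropy (codeLaw c ch) (fun ω => (convAux i ω, ω.1.2.2 i)) -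
        ∑ i : Fin n, entropy (codeLaw c ch) (fun ω => (convAux i ω, (ω.2 i).1)))) := by
    refine mul_le_mul_of_nonneg_left ?_ (by positivity)
    simp only [convAux]
    rw [cs]
    linarith
  rw [mul_add, mul_sub, mul_sub (1 / (n : ℝ))] at key
  simp only [convVars] at *
  linarith

/-- The bound on `R₂`: Fano's inequality for `W₂` and `Z^n`, given `(W₁, S^n)`. -/
theorem le_rateTwo [Fintype X₁] [Fintype X₂] (hdeg : ch.IsDegraded) (hn : 0 < n) (h₁ : 0 < M₁)
    (h₂ : 0 < M₂) :
    1 / (n : ℝ) * ((1 - c.errorProb ch) * Real.logb 2 M₂ - 1) ≤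
      rateTwo (law (timeShare n (codeLaw c ch)) (convVars c)) := by
  have hp := codeLaw_mem (c := c) (ch := ch) h₁ h₂
  have hn' : (n : ℝ) ≠ 0 := by exact_mod_cast hn.ne'
  have hXST := entropy_convVars_state (c := c) (ch := ch) hn h₁ h₂
  have hXSTZ : entropy (timeShare n (codeLaw c ch))
      (fun u => ((convVars c u).1, (convVars c u).2.1, (convVars c u).2.2.1,
        (convVars c u).2.2.2.2.2)) =
      1 / (n : ℝ) * ∑ i : Fin n, entropy (codeLaw c ch)
        (fun ω => ((convAux i ω, ω.1.2.2 i), (ω.2 i).2)) + Real.logb 2 n := by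
    rw [entropy_timeShare hn hp (by simp +contextual [convVars])]
    congr 2
    refine Finset.sum_congr rfl fun i _ => entropy_congr _ fun ω ω' => ?_
    simp only [convVars, convAux, Prod.mk.injEq, true_and]
    have : ω.1.1 = ω'.1.1 → c.enc₁ ω.1.1 i = c.enc₁ ω'.1.1 i := fun h => by rw [h]
    tauto
  have hseq := condEntropy_outputs_le (c := c) (ch := ch) hdeg h₁ h₂
  have hfano := fano hp (fun ω => ω.1.2.1) (fun ω => ((fun j => (ω.2 j).2), ω.1.1, ω.1.2.2))
    (fun b => (c.dec₂ b.1).2)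
    (sum_le_errorProb (c := c) (ch := ch) h₁ h₂ _ fun ω h => by rw [h.2])
  have hW := entropy_msgs_state (c := c) (ch := ch) h₁ h₂
  have hmono := entropy_le_pair hp.1 (fun ω j => (ω.2 j).2) (fun ω => (ω.1.2.1, ω.1.1, ω.1.2.2))
  rw [entropy_congr (codeLaw c ch)
    (A := fun ω => ((fun j => (ω.2 j).2), ω.1.2.1, ω.1.1, ω.1.2.2))
    (B := fun ω => (ω.1.2.1, (fun j => (ω.2 j).2), ω.1.1, ω.1.2.2)) fun ω ω' => by
      simp only [Prod.mk.injEq]; tauto] at hmono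
  rw [Fintype.card_fin] at hfano
  rw [Finset.sum_sub_distrib] at hseq
  simp only [rateTwo, entropy_law]
  rw [hXST, hXSTZ]
  have key : 1 / (n : ℝ) * ((1 - c.errorProb ch) * Real.logb 2 M₂ - 1) ≤
      1 / (n : ℝ) * (∑ i : Fin n, entropy (codeLaw c ch)
        (fun ω => ((convAux i ω, ω.1.2.2 i), (ω.2 i).2)) -
        ∑ i : Fin n, entropy (codeLaw c ch) (fun ω => (convAux i ω, ω.1.2.2 i))) := by
    refine mul_le_mul_of_nonneg_left ?_ (by positivity)
    linarith
  rw [mul_sub] at key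
  linarith

theorem logb_numMessages_ge (n : ℕ) (R : ℝ) : n * R ≤ Real.logb 2 (numMessages n R) := by
  rw [Real.le_logb_iff_rpow_le one_lt_two]
  · exact Nat.le_ceil _
  · exact_mod_cast Nat.ceil_pos.2 (Real.rpow_pos_of_pos two_pos _)

theorem numMessages_pos (n : ℕ) (R : ℝ) : 0 < numMessages n R :=
  Nat.ceil_pos.2 (Real.rpow_pos_of_pos two_pos _)

/-- The converse: achievable pairs are limits of points of the (closed) single-letter region. -/
theorem mem_iUnion_rateRegion_of_achievable [Fintype X₁] [Fintype X₂] (hdeg : ch.IsDegraded)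
    {R : ℝ × ℝ} (hR : ch.Achievable R) :
    R ∈ {R | ∃ k ≤ Fintype.card X₁ * Fintype.card X₂ * Fintype.card S + 1,
      R ∈ ch.rateRegion (Fin k)} := by
  obtain ⟨h1, h2, c, hc⟩ := hR
  have hlim : ∀ r : ℝ, 0 ≤ r → Filter.Tendsto
      (fun n : ℕ => max ((1 - (c n).errorProb ch) * r - 1 / (n : ℝ)) 0) Filter.atTop (𝓝 r) := by
    intro r hr
    have : Filter.Tendsto (fun n : ℕ => (1 - (c n).errorProb ch) * r - 1 / (n : ℝ)) Filter.atTop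
        (𝓝 ((1 - 0) * r - 0)) :=
      ((tendsto_const_nhds.sub hc).mul_const r).sub tendsto_one_div_atTop_nhds_zero_nat
    have h3 := this.max (tendsto_const_nhds (x := (0 : ℝ)))
    rwa [sub_zero, sub_zero, one_mul, max_eq_left hr] at h3
  refine (isClosed_iUnion_rateRegion _).mem_of_tendsto ((hlim R.1 h1).prodMk_nhds (hlim R.2 h2)) ?_
  filter_upwards [Filter.eventually_gt_atTop 0, hc.eventually (gt_mem_nhds one_pos)] with n hn he
  have hM₁ := numMessages_pos n R.1
  have hM₂ := numMessages_pos n R.2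
  have hn' : (0 : ℝ) < n := by exact_mod_cast hn
  have bound : ∀ r : ℝ, (1 - (c n).errorProb ch) * r - 1 / (n : ℝ) ≤
      1 / (n : ℝ) * ((1 - (c n).errorProb ch) * Real.logb 2 (numMessages n r) - 1) := by
    intro r
    have := mul_le_mul_of_nonneg_left (logb_numMessages_ge n r) (sub_nonneg.2 he.le)
    rw [mul_sub, mul_one]
    refine sub_le_sub_right ?_ _
    rw [one_div, inv_mul_eq_div, le_div_iff₀ hn']
    linarith
  obtain ⟨u, hu, hu1, hu2⟩ := convVars_mem (c := c n) (ch := ch) hn hM₁ hM₂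
  exact relaxedRegion_subset_iUnion hdeg (R := ((1 - (c n).errorProb ch) * R.1 - 1 / (n : ℝ),
    (1 - (c n).errorProb ch) * R.2 - 1 / (n : ℝ))) ⟨u, hu,
      ((bound R.1).trans (le_rateOne hn hM₁ hM₂)).trans hu1,
      ((bound R.2).trans (le_rateTwo hdeg hn hM₁ hM₂)).trans hu2⟩

end Converse

/-! ### Random coding -/

section RandomCoding

/-- The indicator of a proposition. -/
def ind (P : Prop) : ℝ := open Classical in if P then 1 else 0

theorem ind_of {P : Prop} (h : P) : ind P = 1 := if_pos h

theorem ind_of_not {P : Prop} (h : ¬P) : ind P = 0 := if_neg h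

theorem ind_nonneg (P : Prop) : 0 ≤ ind P := by
  unfold ind; split_ifs <;> simp

theorem ind_le_one (P : Prop) : ind P ≤ 1 := by
  unfold ind; split_ifs <;> simp

theorem ind_le_of_imp {P : Prop} {a : ℝ} (ha : 0 ≤ a) (h : P → 1 ≤ a) : ind P ≤ a := by
  by_cases hP : P
  · rw [ind_of hP]; exact h hP
  · rw [ind_of_not hP]; exact ha

theorem prod_ind {ι : Type*} [Fintype ι] (P : ι → Prop) : ∏ i, ind (P i) = ind (∀ i, P i) := by
  by_cases h : ∀ i, P i
  · rw [ind_of h]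
    exact Finset.prod_eq_one fun i _ => ind_of (h i)
  · rw [ind_of_not h]
    push Not at h
    obtain ⟨i, hi⟩ := h
    exact Finset.prod_eq_zero (Finset.mem_univ i) (ind_of_not hi)

theorem ind_not (P : Prop) : ind (¬P) = 1 - ind P := by
  by_cases h : P
  · rw [ind_of h, ind_of_not (not_not.2 h), sub_self]
  · rw [ind_of h, ind_of_not h, sub_zero]

/-- A randomized map `z ↦ y` with law `K` can be replaced by a deterministic one that does at
least as well on average. -/
theorem exists_derandomize {ι 𝒵 𝒴 : Type*} [Fintype ι] [Fintype 𝒵] [Fintype 𝒴] {K : 𝒵 → 𝒴 → ℝ}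
    (hK : ∀ z, K z ∈ stdSimplex ℝ 𝒴) (zf : ι → 𝒵) (h : ι → 𝒴 → ℝ) :
    ∃ ρ : 𝒵 → 𝒴, ∑ i, h i (ρ (zf i)) ≤ ∑ i, ∑ y, K (zf i) y * h i y := by
  classical
  have hy : ∀ z, ∃ y, ∑ i with zf i = z, h i y ≤ ∑ i with zf i = z, ∑ y, K z y * h i y := by
    intro z
    refine exists_le_of_sum_le (hK z) (le_of_eq ?_)
    rw [Finset.sum_comm]
    exact Finset.sum_congr rfl fun y _ => Finset.mul_sum _ _ _
  choose ρ hρ using hy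
  refine ⟨ρ, ?_⟩
  rw [← Finset.sum_fiberwise (s := Finset.univ) (g := zf) (f := fun i => h i (ρ (zf i))),
    ← Finset.sum_fiberwise (s := Finset.univ) (g := zf) (f := fun i => ∑ y, K (zf i) y * h i y)]
  refine Finset.sum_le_sum fun z _ => ?_
  refine (Eq.le ?_).trans ((hρ z).trans (Eq.le ?_))
  · refine Finset.sum_congr rfl fun i hi => ?_
    rw [(Finset.mem_filter.1 hi).2]
  · refine Finset.sum_congr rfl fun i hi => ?_
    rw [(Finset.mem_filter.1 hi).2]

/-- Under a uniformly random colouring the colour `w` is missing from `G` with probability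
`(1 - 1/M)^|G|`. -/
theorem sum_colouring {𝒵 : Type*} [Fintype 𝒵] {M : ℕ} (hM : 0 < M) (G : Finset 𝒵) (w : Fin M) :
    (open Classical in ∑ φ : 𝒵 → Fin M, ind (∀ z ∈ G, φ z ≠ w) * ∏ _z : 𝒵, (1 / (M : ℝ))) =
      (1 - 1 / (M : ℝ)) ^ G.card := by
  classical
  have hM' : (M : ℝ) ≠ 0 := by exact_mod_cast hM.ne'
  have h1 : ∀ φ : 𝒵 → Fin M, ind (∀ z ∈ G, φ z ≠ w) * ∏ _z : 𝒵, (1 / (M : ℝ)) =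
      ∏ z, ind (z ∈ G → φ z ≠ w) * (1 / (M : ℝ)) := fun φ => by
    rw [Finset.prod_mul_distrib, prod_ind]
  rw [Finset.sum_congr rfl fun φ _ => h1 φ,
    sum_prod_pi fun z a => ind (z ∈ G → a ≠ w) * (1 / (M : ℝ)), ← Finset.prod_const]
  rw [← Finset.prod_subset (Finset.subset_univ G)]
  · refine Finset.prod_congr rfl fun z hz => ?_
    have : ∀ a : Fin M, ind (z ∈ G → a ≠ w) * (1 / (M : ℝ)) =
        1 / (M : ℝ) - if a = w then 1 / (M : ℝ) else 0 := fun a => by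
      by_cases h : a = w
      · rw [ind_of_not (by simp [hz, h]), if_pos h]; ring
      · rw [ind_of (fun _ => h), if_neg h]; ring
    rw [Finset.sum_congr rfl fun a _ => this a, Finset.sum_sub_distrib]
    simp [hM']
  · intro z _ hz
    have : ∀ a : Fin M, ind (z ∈ G → a ≠ w) = 1 := fun a => ind_of fun h => absurd h hz
    simp [this, hM']

variable {𝒳 𝒳₂ 𝒮 𝒯 𝒵 𝒴 : Type*}

/-- The data of a random code: laws of the codewords, the admissible triples `A x s t`, the set
`G x s t` of good outputs of the deterministic channel `F`, and the decoding sets `D x t`. -/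
structure RandomCode (𝒳 𝒳₂ 𝒮 𝒯 𝒵 𝒴 : Type*) where
  /-- law of a codeword of encoder 1 -/
  pX : 𝒳 → ℝ
  /-- law of an auxiliary codeword -/
  pU : 𝒳 → 𝒯 → ℝ
  /-- law of the state -/
  pS : 𝒮 → ℝ
  /-- the channel from `𝒵` to `𝒴` -/
  K : 𝒵 → 𝒴 → ℝ
  /-- the deterministic channel to `𝒵` -/
  F : 𝒳 → 𝒳₂ → 𝒮 → 𝒵
  /-- triples `(x, s, t)` for which the auxiliary codeword `t` may be used -/
  A : 𝒳 → 𝒮 → 𝒯 → Prop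
  /-- outputs that encoder 2 aims at -/
  G : 𝒳 → 𝒮 → 𝒯 → Finset 𝒵
  /-- decoding sets -/
  D : 𝒳 → 𝒯 → 𝒴 → Prop

namespace RandomCode

variable (r : RandomCode 𝒳 𝒳₂ 𝒮 𝒯 𝒵 𝒴) {M₁ M₂ L : ℕ}

/-- The law of the part of the codebook that belongs to one message of encoder 1: a codeword
`x` and `L` auxiliary codewords that are independent given `x`. -/
def bookLaw (L : ℕ) (b : 𝒳 × (Fin L → 𝒯)) : ℝ := r.pX b.1 * ∏ j, r.pU b.1 (b.2 j)

/-- `x₂` produces a good output of colour `w₂`. -/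
def Ok (b : 𝒳 × (Fin L → 𝒯)) (φ : 𝒵 → Fin M₂) (w₂ : Fin M₂) (s : 𝒮) (x₂ : 𝒳₂) : Prop :=
  ∃ j, r.A b.1 s (b.2 j) ∧ r.F b.1 x₂ s ∈ r.G b.1 s (b.2 j) ∧ φ (r.F b.1 x₂ s) = w₂

/-- Encoder 2 uses a suitable input if there is one. -/
def enc [Nonempty 𝒳₂] (b : 𝒳 × (Fin L → 𝒯)) (φ : 𝒵 → Fin M₂) (w₂ : Fin M₂) (s : 𝒮) : 𝒳₂ :=
  open Classical in if h : ∃ x₂, r.Ok b φ w₂ s x₂ then h.choose else Classical.arbitrary 𝒳₂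

/-- Encoder 2 finds no suitable input. -/
def Fails (b : 𝒳 × (Fin L → 𝒯)) (φ : 𝒵 → Fin M₂) (w₂ : Fin M₂) (s : 𝒮) : Prop :=
  ¬∃ x₂, r.Ok b φ w₂ s x₂

theorem ok_enc [Nonempty 𝒳₂] {b : 𝒳 × (Fin L → 𝒯)} {φ : 𝒵 → Fin M₂} {w₂ : Fin M₂} {s : 𝒮}
    (h : ¬r.Fails b φ w₂ s) : r.Ok b φ w₂ s (r.enc b φ w₂ s) := by
  have h' : ∃ x₂, r.Ok b φ w₂ s x₂ := not_not.1 h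
  rw [enc, dif_pos h']
  exact h'.choose_spec

/-- Decoder 1 looks for a message with an auxiliary codeword whose decoding set contains `y`. -/
def dec (hM : 0 < M₁) (B : Fin M₁ → 𝒳 × (Fin L → 𝒯)) (y : 𝒴) : Fin M₁ :=
  open Classical in if h : ∃ w, ∃ j, r.D (B w).1 ((B w).2 j) y then h.choose else ⟨0, hM⟩

/-- The number of auxiliary codewords of messages other than `w` whose decoding set contains
`y`. -/
def confusions (B : Fin M₁ → 𝒳 × (Fin L → 𝒯)) (w : Fin M₁) (y : 𝒴) : ℝ :=
  ∑ w' ∈ Finset.univ.erase w, ∑ j, ind (r.D (B w').1 ((B w').2 j) y)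

theorem ind_dec_ne_le (hM : 0 < M₁) (B : Fin M₁ → 𝒳 × (Fin L → 𝒯)) (w : Fin M₁) (j : Fin L)
    (y : 𝒴) : ind (r.dec hM B y ≠ w) ≤
      ind (¬r.D (B w).1 ((B w).2 j) y) + r.confusions B w y := by
  have h0 : 0 ≤ r.confusions B w y :=
    Finset.sum_nonneg fun w' _ => Finset.sum_nonneg fun j _ => ind_nonneg _
  refine ind_le_of_imp (add_nonneg (ind_nonneg _) h0) fun hne => ?_
  by_cases hD : r.D (B w).1 ((B w).2 j) y
  · have h : ∃ w, ∃ j, r.D (B w).1 ((B w).2 j) y := ⟨w, j, hD⟩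
    have hd : r.dec hM B y = h.choose := by rw [dec, dif_pos h]
    obtain ⟨j', hj'⟩ := h.choose_spec
    rw [← hd] at hj'
    have h1 : (1 : ℝ) ≤ r.confusions B w y := by
      calc (1 : ℝ) = ind (r.D (B (r.dec hM B y)).1 ((B (r.dec hM B y)).2 j') y) := (ind_of hj').symm
        _ ≤ ∑ j, ind (r.D (B (r.dec hM B y)).1 ((B (r.dec hM B y)).2 j) y) :=
          Finset.single_le_sum
            (f := fun j => ind (r.D (B (r.dec hM B y)).1 ((B (r.dec hM B y)).2 j) y))
            (fun j _ => ind_nonneg _) (Finset.mem_univ j')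
        _ ≤ r.confusions B w y :=
          Finset.single_le_sum (f := fun w' => ∑ j, ind (r.D (B w').1 ((B w').2 j) y))
            (fun w' _ => Finset.sum_nonneg fun j _ => ind_nonneg _)
            (Finset.mem_erase.2 ⟨hne, Finset.mem_univ _⟩)
    have := ind_nonneg (¬r.D (B w).1 ((B w).2 j) y)
    linarith
  · rw [ind_of hD]
    linarith

variable [Fintype 𝒳] [Fintype 𝒮] [Fintype 𝒯] [Fintype 𝒴]

/-- The quality of the ingredients of a random code. -/
structure Good (r : RandomCode 𝒳 𝒳₂ 𝒮 𝒯 𝒵 𝒴) (M₂ L : ℕ) (η θ ε δ : ℝ) : Prop where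
  pX_mem : r.pX ∈ stdSimplex ℝ 𝒳
  pU_mem : ∀ x, r.pU x ∈ stdSimplex ℝ 𝒯
  pS_mem : r.pS ∈ stdSimplex ℝ 𝒮
  K_mem : ∀ z, r.K z ∈ stdSimplex ℝ 𝒴
  /-- good outputs can be produced -/
  reach : ∀ x s t, r.A x s t → ∀ z ∈ r.G x s t, ∃ x₂, r.F x x₂ s = z
  /-- good outputs are rarely degraded to something outside the decoding set -/
  miss : ∀ x s t, r.A x s t → ∀ z ∈ r.G x s t, ∑ y, r.K z y * ind (¬r.D x t y) ≤ ε
  /-- independent codewords rarely have `y` in their decoding set -/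
  confuse : ∀ y, ∑ x, r.pX x * ∑ t, r.pU x t * ind (r.D x t y) ≤ δ
  /-- rarely is none of `L` auxiliary codewords admissible -/
  cover : ∑ x, r.pX x * ∑ s, r.pS s * (∑ t, r.pU x t * ind (¬r.A x s t)) ^ L ≤ η
  /-- rarely does a colour miss all good outputs, see `sum_colouring` -/
  colour : ∀ x s t, r.A x s t → (1 - 1 / (M₂ : ℝ)) ^ (r.G x s t).card ≤ θ
  ε_nonneg : 0 ≤ ε
  θ_nonneg : 0 ≤ θ

variable {r} {η θ ε δ : ℝ}

theorem bookLaw_mem (h : r.Good M₂ L η θ ε δ) :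
    r.bookLaw L ∈ stdSimplex ℝ (𝒳 × (Fin L → 𝒯)) := by
  refine ⟨fun b => mul_nonneg (h.pX_mem.1 _) (Finset.prod_nonneg fun j _ => (h.pU_mem _).1 _), ?_⟩
  rw [Fintype.sum_prod_type]
  simp only [bookLaw, ← Finset.mul_sum]
  have : ∀ x, ∑ t : Fin L → 𝒯, ∏ j, r.pU x (t j) = 1 := fun x =>
    (pi_mem_stdSimplex fun _ : Fin L => h.pU_mem x).2
  simp only [this, mul_one, h.pX_mem.2]

/-- Decoder 1 errs only if encoder 2 fails, the output misses the decoding set of the auxiliary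
codeword in use, or it hits the decoding set of another message. -/
theorem sum_dec_ne_le [Nonempty 𝒳₂] (h : r.Good M₂ L η θ ε δ) (hM : 0 < M₁)
    (B : Fin M₁ → 𝒳 × (Fin L → 𝒯)) (φ : 𝒵 → Fin M₂) (w₁ : Fin M₁) (w₂ : Fin M₂) (s : 𝒮) :
    ∑ y, r.K (r.F (B w₁).1 (r.enc (B w₁) φ w₂ s) s) y * ind (r.dec hM B y ≠ w₁) ≤
      ind (r.Fails (B w₁) φ w₂ s) + ε +
        ∑ y, r.K (r.F (B w₁).1 (r.enc (B w₁) φ w₂ s) s) y * r.confusions B w₁ y := by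
  set z := r.F (B w₁).1 (r.enc (B w₁) φ w₂ s) s with hz
  have hc : 0 ≤ ∑ y, r.K z y * r.confusions B w₁ y := Finset.sum_nonneg fun y _ =>
    mul_nonneg ((h.K_mem z).1 y)
      (Finset.sum_nonneg fun w' _ => Finset.sum_nonneg fun j _ => ind_nonneg _)
  by_cases hf : r.Fails (B w₁) φ w₂ s
  · have h1 : ∑ y, r.K z y * ind (r.dec hM B y ≠ w₁) ≤ ∑ y, r.K z y :=
      Finset.sum_le_sum fun y _ => mul_le_of_le_one_right ((h.K_mem z).1 y) (ind_le_one _)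
    rw [(h.K_mem z).2] at h1
    rw [ind_of hf]
    linarith [h.ε_nonneg]
  · obtain ⟨j, hA, hG, _⟩ := r.ok_enc hf
    rw [ind_of_not hf, zero_add]
    calc _ ≤ ∑ y, r.K z y * (ind (¬r.D (B w₁).1 ((B w₁).2 j) y) + r.confusions B w₁ y) :=
          Finset.sum_le_sum fun y _ => mul_le_mul_of_nonneg_left
            (r.ind_dec_ne_le hM B w₁ j y) ((h.K_mem z).1 y)
      _ ≤ _ := by
          simp_rw [mul_add]
          rw [Finset.sum_add_distrib]
          exact add_le_add_left (h.miss _ _ _ hA z hG) _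

/-- Averaged over the colouring, encoder 2 fails with probability at most `θ`, unless no auxiliary
codeword is admissible. -/
theorem sum_fails_le [Fintype 𝒵] (h : r.Good M₂ L η θ ε δ) (hM₂ : 0 < M₂) (b : 𝒳 × (Fin L → 𝒯))
    (w₂ : Fin M₂) (s : 𝒮) :
    (open Classical in ∑ φ : 𝒵 → Fin M₂, ind (r.Fails b φ w₂ s) * ∏ _z : 𝒵, (1 / (M₂ : ℝ))) ≤
      ind (∀ j, ¬r.A b.1 s (b.2 j)) + θ := by
  classical
  have h0 : ∀ φ : 𝒵 → Fin M₂, (0 : ℝ) ≤ ∏ _z : 𝒵, (1 / (M₂ : ℝ)) := fun φ =>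
    Finset.prod_nonneg fun _ _ => by positivity
  by_cases hj : ∃ j, r.A b.1 s (b.2 j)
  · obtain ⟨j, hA⟩ := hj
    have h1 : ∀ φ : 𝒵 → Fin M₂, ind (r.Fails b φ w₂ s) ≤
        ind (∀ z ∈ r.G b.1 s (b.2 j), φ z ≠ w₂) := fun φ =>
      ind_le_of_imp (ind_nonneg _) fun hf => by
        rw [ind_of]
        intro z hz hφ
        obtain ⟨x₂, rfl⟩ := h.reach _ _ _ hA z hz
        exact hf ⟨x₂, j, hA, hz, hφ⟩
    calc _ ≤ ∑ φ : 𝒵 → Fin M₂, ind (∀ z ∈ r.G b.1 s (b.2 j), φ z ≠ w₂) *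
            ∏ _z : 𝒵, (1 / (M₂ : ℝ)) :=
          Finset.sum_le_sum fun φ _ => mul_le_mul_of_nonneg_right (h1 φ) (h0 φ)
      _ ≤ θ := (sum_colouring hM₂ _ w₂).le.trans (h.colour _ _ _ hA)
      _ ≤ _ := le_add_of_nonneg_left (ind_nonneg _)
  · push Not at hj
    rw [ind_of hj]
    have h1 : ∑ φ : 𝒵 → Fin M₂, ∏ _z : 𝒵, (1 / (M₂ : ℝ)) = 1 := by
      rw [sum_prod_pi fun _ _ => 1 / (M₂ : ℝ)]
      have : (M₂ : ℝ) ≠ 0 := by exact_mod_cast hM₂.ne'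
      exact Finset.prod_eq_one fun _ _ => by simp [this]
    have h2 : ∑ φ : 𝒵 → Fin M₂, ind (r.Fails b φ w₂ s) * ∏ _z : 𝒵, (1 / (M₂ : ℝ)) ≤
        ∑ φ : 𝒵 → Fin M₂, ∏ _z : 𝒵, (1 / (M₂ : ℝ)) :=
      Finset.sum_le_sum fun φ _ => mul_le_of_le_one_left (h0 φ) (ind_le_one _)
    linarith [h.θ_nonneg]

/-- Averaged over a part of the codebook, no auxiliary codeword is admissible with probability at
most `η`. -/
theorem sum_not_covered_le (h : r.Good M₂ L η θ ε δ) :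
    ∑ b, r.bookLaw L b * ∑ s, r.pS s * ind (∀ j, ¬r.A b.1 s (b.2 j)) ≤ η := by
  refine le_trans (le_of_eq ?_) h.cover
  rw [Fintype.sum_prod_type]
  refine Finset.sum_congr rfl fun x _ => ?_
  simp only [bookLaw]
  simp_rw [mul_assoc, ← Finset.mul_sum]
  congr 1
  simp_rw [Finset.mul_sum]
  rw [Finset.sum_comm]
  refine Finset.sum_congr rfl fun s _ => ?_
  have h1 : ∀ t : Fin L → 𝒯, (∏ j, r.pU x (t j)) * (r.pS s * ind (∀ j, ¬r.A x s (t j))) =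
      r.pS s * ∏ j, r.pU x (t j) * ind (¬r.A x s (t j)) := fun t => by
    rw [Finset.prod_mul_distrib, prod_ind]
    ring
  rw [Finset.sum_congr rfl fun t _ => h1 t, ← Finset.mul_sum,
    sum_prod_pi fun (_ : Fin L) t => r.pU x t * ind (¬r.A x s t)]
  simp

/-- A fresh part of the codebook contains on average at most `L δ` codewords whose decoding sets
contain a given `y`. -/
theorem sum_hits_le (h : r.Good M₂ L η θ ε δ) (y : 𝒴) :
    ∑ b, r.bookLaw L b * ∑ j, ind (r.D b.1 (b.2 j) y) ≤ L * δ := by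
  have h1 : ∀ j : Fin L, ∑ b, r.bookLaw L b * ind (r.D b.1 (b.2 j) y) ≤ δ := by
    intro j
    refine le_trans (le_of_eq ?_) (h.confuse y)
    rw [Fintype.sum_prod_type]
    refine Finset.sum_congr rfl fun x _ => ?_
    rw [← sum_coord (τ := fun _ : Fin L => r.pU x) (fun _ => (h.pU_mem x).2) j
      fun t => ind (r.D x t y), Finset.mul_sum]
    exact Finset.sum_congr rfl fun t _ => by rw [bookLaw]; ring
  simp_rw [Finset.mul_sum]
  rw [Finset.sum_comm]
  calc _ ≤ ∑ _j : Fin L, δ := Finset.sum_le_sum fun j _ => h1 j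
    _ = L * δ := by simp

/-- The parts of the codebook that belong to other messages are independent of the output
`zf (B w)`, so each of them is a fresh one. -/
theorem sum_confusions_le [Fintype 𝒵] (h : r.Good M₂ L η θ ε δ) (w : Fin M₁)
    (zf : 𝒳 × (Fin L → 𝒯) → 𝒵) :
    ∑ B : Fin M₁ → 𝒳 × (Fin L → 𝒯),
      (∑ y, r.K (zf (B w)) y * r.confusions B w y) * ∏ i, r.bookLaw L (B i) ≤
      (M₁ - 1 : ℝ) * (L * δ) := by
  have hb := bookLaw_mem h
  have hB : (fun B : Fin M₁ → 𝒳 × (Fin L → 𝒯) => ∏ i, r.bookLaw L (B i)) ∈ stdSimplex ℝ _ :=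
    pi_mem_stdSimplex fun _ : Fin M₁ => hb
  have h1 : ∀ w' ∈ Finset.univ.erase w, ∑ B : Fin M₁ → 𝒳 × (Fin L → 𝒯),
      (∑ y, r.K (zf (B w)) y * ∑ j, ind (r.D (B w').1 ((B w').2 j) y)) *
        ∏ i, r.bookLaw L (B i) ≤ L * δ := by
    intro w' hw'
    have hne : w ≠ w' := (Finset.ne_of_mem_erase hw').symm
    rw [sum_resample (τ := fun _ : Fin M₁ => r.bookLaw L) w' hb.2]
    simp only [Function.update_self, Function.update_of_ne hne]
    calc _ ≤ ∑ B : Fin M₁ → 𝒳 × (Fin L → 𝒯), L * δ * ∏ i, r.bookLaw L (B i) := by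
          refine Finset.sum_le_sum fun B _ => mul_le_mul_of_nonneg_right ?_ (hB.1 B)
          simp_rw [Finset.mul_sum (s := (Finset.univ : Finset 𝒴))]
          rw [Finset.sum_comm]
          calc _ = ∑ y, r.K (zf (B w)) y *
                ∑ b, r.bookLaw L b * ∑ j, ind (r.D b.1 (b.2 j) y) := by
                refine Finset.sum_congr rfl fun y _ => ?_
                rw [Finset.mul_sum]
                exact Finset.sum_congr rfl fun b _ => by ring
            _ ≤ ∑ y, r.K (zf (B w)) y * (L * δ) := Finset.sum_le_sum fun y _ =>
                mul_le_mul_of_nonneg_left (sum_hits_le h y) ((h.K_mem _).1 y)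
            _ = L * δ := by rw [← Finset.sum_mul, (h.K_mem _).2, one_mul]
      _ = L * δ := by rw [← Finset.mul_sum, hB.2, mul_one]
  have h2 : ∀ B : Fin M₁ → 𝒳 × (Fin L → 𝒯),
      (∑ y, r.K (zf (B w)) y * r.confusions B w y) * ∏ i, r.bookLaw L (B i) =
      ∑ w' ∈ Finset.univ.erase w,
        (∑ y, r.K (zf (B w)) y * ∑ j, ind (r.D (B w').1 ((B w').2 j) y)) *
        ∏ i, r.bookLaw L (B i) := by
    intro B
    rw [← Finset.sum_mul, Finset.sum_comm]
    simp_rw [← Finset.mul_sum]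
    rfl
  rw [Finset.sum_congr rfl fun B _ => h2 B, Finset.sum_comm]
  refine (Finset.sum_le_sum h1).trans (le_of_eq ?_)
  have hM : 0 < M₁ := Fin.pos w
  rw [Finset.sum_const, Finset.card_erase_of_mem (Finset.mem_univ _), Finset.card_univ,
    Fintype.card_fin, nsmul_eq_mul, Nat.cast_sub hM, Nat.cast_one]

/-- A random code with good ingredients has good realizations. Decoder 2 reads `w₂` off the colour
of its output and finds `w₁` by applying decoder 1 to a degraded version of its output. -/
theorem exists_code [Fintype 𝒵] [Nonempty 𝒳₂] (h : r.Good M₂ L η θ ε δ) (hM₁ : 0 < M₁)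
    (hM₂ : 0 < M₂) :
    ∃ (e₁ : Fin M₁ → 𝒳) (e₂ : Fin M₁ → Fin M₂ → 𝒮 → 𝒳₂) (d₁ : 𝒴 → Fin M₁)
      (d₂ : 𝒵 → Fin M₁ × Fin M₂),
      1 / ((M₁ : ℝ) * M₂) * ∑ w₁, ∑ w₂, ∑ s, r.pS s *
        ∑ y, r.K (r.F (e₁ w₁) (e₂ w₁ w₂ s) s) y *
          ind (¬(d₁ y = w₁ ∧ d₂ (r.F (e₁ w₁) (e₂ w₁ w₂ s) s) = (w₁, w₂))) ≤
        3 * (η + θ + ε + (M₁ - 1 : ℝ) * (L * δ)) := by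
  classical
  have hb := bookLaw_mem h
  have hB : (fun B : Fin M₁ → 𝒳 × (Fin L → 𝒯) => ∏ i, r.bookLaw L (B i)) ∈ stdSimplex ℝ _ :=
    pi_mem_stdSimplex fun _ : Fin M₁ => hb
  have hM₁' : (0 : ℝ) < M₁ := by exact_mod_cast hM₁
  have hM₂' : (0 : ℝ) < M₂ := by exact_mod_cast hM₂
  have hφ : (fun φ : 𝒵 → Fin M₂ => ∏ _z : 𝒵, (1 / (M₂ : ℝ))) ∈ stdSimplex ℝ (𝒵 → Fin M₂) :=
    pi_mem_stdSimplex (τ := fun _ _ => 1 / (M₂ : ℝ)) fun _ => ⟨fun _ => by positivity, by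
      simp [hM₂'.ne']⟩
  set zf : 𝒳 × (Fin L → 𝒯) → (𝒵 → Fin M₂) → Fin M₂ → 𝒮 → 𝒵 := fun b φ w₂ s =>
    r.F b.1 (r.enc b φ w₂ s) s with hzf
  -- the bound on the conditional error probability, up to the factor 3
  let f : (Fin M₁ → 𝒳 × (Fin L → 𝒯)) → (𝒵 → Fin M₂) → Fin M₁ → Fin M₂ → 𝒮 → ℝ :=
    fun B φ w₁ w₂ s => ind (r.Fails (B w₁) φ w₂ s) + ε +
      ∑ y, r.K (zf (B w₁) φ w₂ s) y * r.confusions B w₁ y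
  have favg : ∀ w₁ w₂, ∑ B : Fin M₁ → 𝒳 × (Fin L → 𝒯), ∑ φ : 𝒵 → Fin M₂,
      (∏ i, r.bookLaw L (B i)) * (∏ _z : 𝒵, (1 / (M₂ : ℝ))) * ∑ s, r.pS s * f B φ w₁ w₂ s ≤
      η + θ + ε + (M₁ - 1 : ℝ) * (L * δ) := by
    intro w₁ w₂
    have t1 : ∑ B : Fin M₁ → 𝒳 × (Fin L → 𝒯), (∏ i, r.bookLaw L (B i)) * ∑ s, r.pS s *
        ∑ φ : 𝒵 → Fin M₂, ind (r.Fails (B w₁) φ w₂ s) * ∏ _z : 𝒵, (1 / (M₂ : ℝ)) ≤ η + θ := by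
      have := sum_coord (τ := fun _ : Fin M₁ => r.bookLaw L) (fun _ => hb.2) w₁ fun b =>
        ∑ s, r.pS s * ∑ φ : 𝒵 → Fin M₂, ind (r.Fails b φ w₂ s) * ∏ _z : 𝒵, (1 / (M₂ : ℝ))
      simp_rw [mul_comm (∏ i, r.bookLaw L _)]
      rw [this]
      calc _ ≤ ∑ b, r.bookLaw L b * ∑ s, r.pS s * (ind (∀ j, ¬r.A b.1 s (b.2 j)) + θ) :=
            Finset.sum_le_sum fun b _ => mul_le_mul_of_nonneg_left
              (Finset.sum_le_sum fun s _ => mul_le_mul_of_nonneg_left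
                (sum_fails_le h hM₂ b w₂ s) (h.pS_mem.1 s)) (hb.1 b)
        _ = ∑ b, r.bookLaw L b * ∑ s, r.pS s * ind (∀ j, ¬r.A b.1 s (b.2 j)) + θ := by
            simp_rw [mul_add, Finset.sum_add_distrib, ← Finset.sum_mul, h.pS_mem.2, one_mul,
              mul_add, Finset.sum_add_distrib, ← Finset.sum_mul, hb.2, one_mul]
        _ ≤ η + θ := add_le_add_left (sum_not_covered_le h) _
    have t2 : ∑ φ : 𝒵 → Fin M₂, (∏ _z : 𝒵, (1 / (M₂ : ℝ))) * ∑ s, r.pS s *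
        ∑ B : Fin M₁ → 𝒳 × (Fin L → 𝒯),
          (∑ y, r.K (zf (B w₁) φ w₂ s) y * r.confusions B w₁ y) * ∏ i, r.bookLaw L (B i) ≤
        (M₁ - 1 : ℝ) * (L * δ) := by
      calc _ ≤ ∑ φ : 𝒵 → Fin M₂, (∏ _z : 𝒵, (1 / (M₂ : ℝ))) * ∑ s, r.pS s *
            ((M₁ - 1 : ℝ) * (L * δ)) :=
            Finset.sum_le_sum fun φ _ => mul_le_mul_of_nonneg_left
              (Finset.sum_le_sum fun s _ => mul_le_mul_of_nonneg_left
                (sum_confusions_le h w₁ fun b => zf b φ w₂ s) (h.pS_mem.1 s)) (hφ.1 φ)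
        _ = _ := by
            rw [← Finset.sum_mul, ← Finset.sum_mul, h.pS_mem.2, hφ.2, one_mul, one_mul]
    have split : ∑ B : Fin M₁ → 𝒳 × (Fin L → 𝒯), ∑ φ : 𝒵 → Fin M₂,
        (∏ i, r.bookLaw L (B i)) * (∏ _z : 𝒵, (1 / (M₂ : ℝ))) * ∑ s, r.pS s * f B φ w₁ w₂ s =
        ∑ B : Fin M₁ → 𝒳 × (Fin L → 𝒯), (∏ i, r.bookLaw L (B i)) * ∑ s, r.pS s *
        ∑ φ : 𝒵 → Fin M₂, ind (r.Fails (B w₁) φ w₂ s) * ∏ _z : 𝒵, (1 / (M₂ : ℝ)) + ε +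
        ∑ φ : 𝒵 → Fin M₂, (∏ _z : 𝒵, (1 / (M₂ : ℝ))) * ∑ s, r.pS s *
        ∑ B : Fin M₁ → 𝒳 × (Fin L → 𝒯),
          (∑ y, r.K (zf (B w₁) φ w₂ s) y * r.confusions B w₁ y) * ∏ i, r.bookLaw L (B i) := by
      have s1 : ∑ B : Fin M₁ → 𝒳 × (Fin L → 𝒯), (∏ i, r.bookLaw L (B i)) * ∑ s, r.pS s *
          ∑ φ : 𝒵 → Fin M₂, ind (r.Fails (B w₁) φ w₂ s) * ∏ _z : 𝒵, (1 / (M₂ : ℝ)) =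
          ∑ B : Fin M₁ → 𝒳 × (Fin L → 𝒯), ∑ φ : 𝒵 → Fin M₂, ∑ s,
          (∏ i, r.bookLaw L (B i)) * (∏ _z : 𝒵, (1 / (M₂ : ℝ))) *
            (r.pS s * ind (r.Fails (B w₁) φ w₂ s)) := by
        refine Finset.sum_congr rfl fun B _ => ?_
        rw [Finset.sum_comm, Finset.mul_sum]
        refine Finset.sum_congr rfl fun s _ => ?_
        rw [Finset.mul_sum, Finset.mul_sum]
        exact Finset.sum_congr rfl fun φ _ => by ring
      have s2 : ∑ φ : 𝒵 → Fin M₂, (∏ _z : 𝒵, (1 / (M₂ : ℝ))) * ∑ s, r.pS s *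
          ∑ B : Fin M₁ → 𝒳 × (Fin L → 𝒯),
            (∑ y, r.K (zf (B w₁) φ w₂ s) y * r.confusions B w₁ y) * ∏ i, r.bookLaw L (B i) =
          ∑ B : Fin M₁ → 𝒳 × (Fin L → 𝒯), ∑ φ : 𝒵 → Fin M₂, ∑ s,
          (∏ i, r.bookLaw L (B i)) * (∏ _z : 𝒵, (1 / (M₂ : ℝ))) *
            (r.pS s * ∑ y, r.K (zf (B w₁) φ w₂ s) y * r.confusions B w₁ y) := by
        rw [Finset.sum_comm]
        refine Finset.sum_congr rfl fun φ _ => ?_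
        rw [Finset.sum_comm, Finset.mul_sum]
        refine Finset.sum_congr rfl fun s _ => ?_
        rw [Finset.mul_sum, Finset.mul_sum]
        exact Finset.sum_congr rfl fun B _ => by ring
      have s3 : ε = ∑ B : Fin M₁ → 𝒳 × (Fin L → 𝒯), ∑ φ : 𝒵 → Fin M₂, ∑ s,
          (∏ i, r.bookLaw L (B i)) * (∏ _z : 𝒵, (1 / (M₂ : ℝ))) * (r.pS s * ε) := by
        have e1 : ∀ B : Fin M₁ → 𝒳 × (Fin L → 𝒯), ∑ φ : 𝒵 → Fin M₂, ∑ s,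
            (∏ i, r.bookLaw L (B i)) * (∏ _z : 𝒵, (1 / (M₂ : ℝ))) * (r.pS s * ε) =
            (∏ i, r.bookLaw L (B i)) * ε := fun B => by
          have e0 : ∑ s, r.pS s * ε = ε := by rw [← Finset.sum_mul, h.pS_mem.2, one_mul]
          have eφ : ∑ φ : 𝒵 → Fin M₂, ∏ _z : 𝒵, (1 / (M₂ : ℝ)) = 1 := hφ.2
          rw [Finset.sum_congr rfl fun φ _ => (Finset.mul_sum _ _ _).symm, e0, ← Finset.sum_mul,
            ← Finset.mul_sum, eφ, mul_one]
        rw [Finset.sum_congr rfl fun B _ => e1 B, ← Finset.sum_mul, hB.2, one_mul]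
      rw [s1, s2]
      refine Eq.trans ?_ (congrArg (fun u => _ + u + _) s3.symm)
      rw [← Finset.sum_add_distrib, ← Finset.sum_add_distrib]
      refine Finset.sum_congr rfl fun B _ => ?_
      rw [← Finset.sum_add_distrib, ← Finset.sum_add_distrib]
      refine Finset.sum_congr rfl fun φ _ => ?_
      rw [← Finset.sum_add_distrib, ← Finset.sum_add_distrib, Finset.mul_sum]
      exact Finset.sum_congr rfl fun s _ => by simp only [f]; ring
    rw [split]
    linarith
  -- a good realization of the codebook and the colouring
  obtain ⟨⟨B, φ⟩, hBφ⟩ : ∃ u : (Fin M₁ → 𝒳 × (Fin L → 𝒯)) × (𝒵 → Fin M₂),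
      ∑ w₁, ∑ w₂, ∑ s, r.pS s * f u.1 u.2 w₁ w₂ s ≤
        (M₁ * M₂ : ℝ) * (η + θ + ε + (M₁ - 1 : ℝ) * (L * δ)) := by
    refine exists_le_of_sum_le (p := fun u : (Fin M₁ → 𝒳 × (Fin L → 𝒯)) × (𝒵 → Fin M₂) =>
      (∏ i, r.bookLaw L (u.1 i)) * ∏ _z : 𝒵, (1 / (M₂ : ℝ)))
      ⟨fun u => mul_nonneg (hB.1 u.1) (hφ.1 u.2), ?_⟩ ?_
    · rw [Fintype.sum_prod_type]
      simp_rw [← Finset.mul_sum]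
      rw [hφ.2]
      simpa using hB.2
    · rw [Fintype.sum_prod_type]
      calc _ = ∑ w₁, ∑ w₂, ∑ B : Fin M₁ → 𝒳 × (Fin L → 𝒯), ∑ φ : 𝒵 → Fin M₂,
            (∏ i, r.bookLaw L (B i)) * (∏ _z : 𝒵, (1 / (M₂ : ℝ))) *
              ∑ s, r.pS s * f B φ w₁ w₂ s := by
            simp_rw [Finset.mul_sum (s := (Finset.univ : Finset (Fin M₁))),
              Finset.mul_sum (s := (Finset.univ : Finset (Fin M₂)))]
            rw [Finset.sum_congr rfl fun B _ => Finset.sum_comm, Finset.sum_comm]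
            refine Finset.sum_congr rfl fun w₁ _ => ?_
            rw [Finset.sum_congr rfl fun B _ => Finset.sum_comm, Finset.sum_comm]
        _ ≤ ∑ _w₁ : Fin M₁, ∑ _w₂ : Fin M₂, (η + θ + ε + (M₁ - 1 : ℝ) * (L * δ)) :=
            Finset.sum_le_sum fun w₁ _ => Finset.sum_le_sum fun w₂ _ => favg w₁ w₂
        _ = _ := by simp; ring
  -- decoder 2 degrades its output deterministically
  obtain ⟨ρ, hρ⟩ := exists_derandomize (ι := Fin M₁ × Fin M₂ × 𝒮) h.K_mem
    (fun i => zf (B i.1) φ i.2.1 i.2.2) (fun i y => r.pS i.2.2 * ind (r.dec hM₁ B y ≠ i.1))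
  refine ⟨fun w₁ => (B w₁).1, fun w₁ w₂ s => r.enc (B w₁) φ w₂ s, r.dec hM₁ B,
    fun z => (r.dec hM₁ B (ρ z), φ z), ?_⟩
  rw [one_div, inv_mul_le_iff₀ (by positivity)]
  simp only [Fintype.sum_prod_type] at hρ
  have hdec : ∀ w₁ w₂ s, ∑ y, r.K (zf (B w₁) φ w₂ s) y * (r.pS s * ind (r.dec hM₁ B y ≠ w₁)) ≤
      r.pS s * f B φ w₁ w₂ s := by
    intro w₁ w₂ s
    refine le_trans (le_of_eq ?_) (mul_le_mul_of_nonneg_left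
      (sum_dec_ne_le h hM₁ B φ w₁ w₂ s) (h.pS_mem.1 s))
    rw [Finset.mul_sum]
    exact Finset.sum_congr rfl fun y _ => by ring
  have hterm : ∀ w₁ w₂ s, r.pS s * ∑ y, r.K (zf (B w₁) φ w₂ s) y *
      ind (¬(r.dec hM₁ B y = w₁ ∧
        (r.dec hM₁ B (ρ (zf (B w₁) φ w₂ s)), φ (zf (B w₁) φ w₂ s)) = (w₁, w₂))) ≤
      r.pS s * f B φ w₁ w₂ s + r.pS s * ind (r.dec hM₁ B (ρ (zf (B w₁) φ w₂ s)) ≠ w₁) +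
        r.pS s * f B φ w₁ w₂ s := by
    intro w₁ w₂ s
    have hfail : ind (φ (zf (B w₁) φ w₂ s) ≠ w₂) ≤ f B φ w₁ w₂ s := by
      have hc : 0 ≤ ∑ y, r.K (zf (B w₁) φ w₂ s) y * r.confusions B w₁ y :=
        Finset.sum_nonneg fun y _ => mul_nonneg ((h.K_mem _).1 y)
          (Finset.sum_nonneg fun w' _ => Finset.sum_nonneg fun j _ => ind_nonneg _)
      have h1 : ind (φ (zf (B w₁) φ w₂ s) ≠ w₂) ≤ ind (r.Fails (B w₁) φ w₂ s) :=
        ind_le_of_imp (ind_nonneg _) fun hne => by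
          rw [ind_of]
          by_contra hf
          obtain ⟨j, _, _, h3⟩ := r.ok_enc hf
          exact hne h3
      simp only [f]
      linarith [h.ε_nonneg]
    have h1 := hdec w₁ w₂ s
    have h2 := mul_le_mul_of_nonneg_left hfail (h.pS_mem.1 s)
    have h3 : r.pS s * ∑ y, r.K (zf (B w₁) φ w₂ s) y *
        ind (¬(r.dec hM₁ B y = w₁ ∧
        (r.dec hM₁ B (ρ (zf (B w₁) φ w₂ s)), φ (zf (B w₁) φ w₂ s)) = (w₁, w₂))) ≤
        r.pS s * ∑ y, r.K (zf (B w₁) φ w₂ s) y * (ind (r.dec hM₁ B y ≠ w₁) +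
          ind (r.dec hM₁ B (ρ (zf (B w₁) φ w₂ s)) ≠ w₁) + ind (φ (zf (B w₁) φ w₂ s) ≠ w₂)) := by
      refine mul_le_mul_of_nonneg_left (Finset.sum_le_sum fun y _ =>
        mul_le_mul_of_nonneg_left ?_ ((h.K_mem _).1 y)) (h.pS_mem.1 s)
      have p1 := ind_nonneg (r.dec hM₁ B y ≠ w₁)
      have p2 := ind_nonneg (r.dec hM₁ B (ρ (zf (B w₁) φ w₂ s)) ≠ w₁)
      have p3 := ind_nonneg (φ (zf (B w₁) φ w₂ s) ≠ w₂)
      refine ind_le_of_imp (by positivity) fun hne => ?_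
      by_cases q1 : r.dec hM₁ B y = w₁
      · by_cases q2 : r.dec hM₁ B (ρ (zf (B w₁) φ w₂ s)) = w₁
        · have q3 : φ (zf (B w₁) φ w₂ s) ≠ w₂ := fun q3 => hne ⟨q1, by rw [q2, q3]⟩
          rw [ind_of q3]
          linarith
        · rw [ind_of q2]
          linarith
      · rw [ind_of q1]
        linarith
    have h4 : r.pS s * ∑ y, r.K (zf (B w₁) φ w₂ s) y * (ind (r.dec hM₁ B y ≠ w₁) +
          ind (r.dec hM₁ B (ρ (zf (B w₁) φ w₂ s)) ≠ w₁) + ind (φ (zf (B w₁) φ w₂ s) ≠ w₂)) =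
        ∑ y, r.K (zf (B w₁) φ w₂ s) y * (r.pS s * ind (r.dec hM₁ B y ≠ w₁)) +
        r.pS s * ind (r.dec hM₁ B (ρ (zf (B w₁) φ w₂ s)) ≠ w₁) +
        r.pS s * ind (φ (zf (B w₁) φ w₂ s) ≠ w₂) := by
      simp_rw [mul_add, Finset.sum_add_distrib, ← Finset.sum_mul, (h.K_mem _).2, one_mul, mul_add]
      congr 2
      rw [Finset.mul_sum]
      exact Finset.sum_congr rfl fun y _ => by ring
    linarith
  calc _ ≤ ∑ w₁, ∑ w₂, ∑ s, (r.pS s * f B φ w₁ w₂ s +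
        r.pS s * ind (r.dec hM₁ B (ρ (zf (B w₁) φ w₂ s)) ≠ w₁) + r.pS s * f B φ w₁ w₂ s) :=
        Finset.sum_le_sum fun w₁ _ => Finset.sum_le_sum fun w₂ _ =>
          Finset.sum_le_sum fun s _ => hterm w₁ w₂ s
    _ ≤ 3 * ∑ w₁, ∑ w₂, ∑ s, r.pS s * f B φ w₁ w₂ s := by
        simp_rw [Finset.sum_add_distrib]
        have h5 : ∑ w₁, ∑ w₂, ∑ s, ∑ y, r.K (zf (B w₁) φ w₂ s) y *
            (r.pS s * ind (r.dec hM₁ B y ≠ w₁)) ≤ ∑ w₁, ∑ w₂, ∑ s, r.pS s * f B φ w₁ w₂ s :=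
          Finset.sum_le_sum fun w₁ _ => Finset.sum_le_sum fun w₂ _ =>
            Finset.sum_le_sum fun s _ => hdec w₁ w₂ s
        linarith
    _ ≤ _ := by
        have := mul_le_mul_of_nonneg_left hBφ (zero_le_three (α := ℝ))
        simp only at this
        linarith

end RandomCode

end RandomCoding

/-! ### Random codes from information densities -/

/-- The elementary estimate behind the covering bound. -/
theorem pow_le_one_sub_add_exp {u c y : ℝ} (h0 : 0 ≤ u) (h : u ≤ 1 - c * y) (hy0 : 0 ≤ y)
    (hy1 : y ≤ 1) (L : ℕ) : u ^ L ≤ 1 - y + Real.exp (-(L * c)) := by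
  have h1 : u ≤ Real.exp (-(c * y)) := h.trans (by linarith [Real.add_one_le_exp (-(c * y))])
  have h2 := convexOn_exp.2 (Set.mem_univ 0) (Set.mem_univ (-(L * c)))
    (sub_nonneg.2 hy1) hy0 (sub_add_cancel 1 y)
  simp only [smul_eq_mul, mul_zero, zero_add, Real.exp_zero, mul_one] at h2
  calc u ^ L ≤ Real.exp (-(c * y)) ^ L := pow_le_pow_left₀ h0 h1 L
    _ = Real.exp (y * -(L * c)) := by rw [← Real.exp_nat_mul]; congr 1; ring
    _ ≤ 1 - y + y * Real.exp (-(L * c)) := h2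
    _ ≤ _ := add_le_add_right (mul_le_of_le_one_left (Real.exp_pos _).le hy1) _

/-- The ingredients of a good random code, for jointly distributed random variables
`(X, S, T, Z, Y)` whose information densities are under control: apart from events of probability
at most `e`, the density of `(X, T)` and `Y` exceeds `log g₁`, that of `(X, T)` and `S` is at most
`log g₂`, and that of `Z` given `(X, S, T)` is at least `log g₃`. -/
theorem exists_good_randomCode {Ω 𝒳 𝒳₂ 𝒮 𝒯 𝒵 𝒴 : Type*} [Fintype Ω] [Fintype 𝒳] [Fintype 𝒮]
    [Fintype 𝒯] [Fintype 𝒵] [Fintype 𝒴] {p : Ω → ℝ} (hp : p ∈ stdSimplex ℝ Ω) {X : Ω → 𝒳}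
    {S : Ω → 𝒮} {T : Ω → 𝒯} {Z : Ω → 𝒵} {Y : Ω → 𝒴} {F : 𝒳 → 𝒳₂ → 𝒮 → 𝒵} {K : 𝒵 → 𝒴 → ℝ}
    {pX : 𝒳 → ℝ} {pU : 𝒳 → 𝒯 → ℝ} {pS : 𝒮 → ℝ} (hpX : pX ∈ stdSimplex ℝ 𝒳)
    (hpU : ∀ x, pU x ∈ stdSimplex ℝ 𝒯) (hpS : pS ∈ stdSimplex ℝ 𝒮)
    (hK : ∀ z, K z ∈ stdSimplex ℝ 𝒴)
    (hXS : ∀ x s, law p (fun ω => (X ω, S ω)) (x, s) = pX x * pS s)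
    (hF : ∀ ω, 0 < p ω → ∃ x₂, F (X ω) x₂ (S ω) = Z ω)
    (hY : ∀ w y, law p (fun ω => ((((X ω, S ω), T ω), Z ω), Y ω)) (w, y) =
      law p (fun ω => (((X ω, S ω), T ω), Z ω)) w * K w.2 y)
    {g₁ g₂ g₃ e ε θ : ℝ} (hg₁ : 0 < g₁) (hg₂ : 0 < g₂) (hg₃ : 0 < g₃) (hε : 0 < ε)
    (hθ : 0 ≤ θ)
    (h₁ : ∑ ω, p ω * ind (law p (fun ω => ((X ω, T ω), Y ω)) ((X ω, T ω), Y ω) ≤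
      g₁ * (pX (X ω) * pU (X ω) (T ω) * law p Y (Y ω))) ≤ e)
    (h₂ : ∑ ω, p ω * ind (g₂ * (pS (S ω) * (pX (X ω) * pU (X ω) (T ω))) <
      law p (fun ω => ((X ω, S ω), T ω)) ((X ω, S ω), T ω)) ≤ e)
    (h₃ : ∑ ω, p ω * ind (law p (fun ω => ((X ω, S ω), T ω)) ((X ω, S ω), T ω) <
      g₃ * law p (fun ω => (((X ω, S ω), T ω), Z ω)) (((X ω, S ω), T ω), Z ω)) ≤ e)
    {M₂ : ℕ} (hcol : ∀ N : ℕ, 1 ≤ N → g₃ / 2 ≤ N → (1 - 1 / (M₂ : ℝ)) ^ N ≤ θ) (L : ℕ) :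
    ∃ A G D, (RandomCode.mk pX pU pS K F A G D).Good M₂ L
      (e + 2 * (e + 1 / ε * e) + Real.exp (-(L * (1 / g₂)))) θ ε (1 / g₁) := by
  classical
  set Q₃ : (𝒳 × 𝒮) × 𝒯 → ℝ := law p (fun ω => ((X ω, S ω), T ω)) with hQ₃
  set Q₄ : ((𝒳 × 𝒮) × 𝒯) × 𝒵 → ℝ := law p (fun ω => (((X ω, S ω), T ω), Z ω)) with hQ₄
  have hQ₃0 : ∀ w, 0 ≤ Q₃ w := law_nonneg hp.1 _
  have hQ₄0 : ∀ w, 0 ≤ Q₄ w := law_nonneg hp.1 _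
  have hQ₄s : ∀ w, ∑ z, Q₄ (w, z) = Q₃ w := fun w => sum_law_snd p _ Z w
  have hQ₃s : ∀ x s, ∑ t, Q₃ ((x, s), t) = pX x * pS s := fun x s => by
    rw [← hXS]; exact sum_law_snd p _ T (x, s)
  -- `D x t` holds where the density of `(x, t)` and `y` exceeds `log g₁`. Good outputs have small
  -- conditional probability and are degraded into `D x t`, and in an admissible triple they carry
  -- at least half of the conditional mass.
  set D : 𝒳 → 𝒯 → 𝒴 → Prop := fun x t y =>
    ¬law p (fun ω => ((X ω, T ω), Y ω)) ((x, t), y) ≤ g₁ * (pX x * pU x t * law p Y y) with hD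
  set G : 𝒳 → 𝒮 → 𝒯 → Finset 𝒵 := fun x s t => Finset.univ.filter fun z =>
    0 < Q₄ (((x, s), t), z) ∧ g₃ * Q₄ (((x, s), t), z) ≤ Q₃ ((x, s), t) ∧
      ∑ y, K z y * ind (¬D x t y) ≤ ε with hG
  set A : 𝒳 → 𝒮 → 𝒯 → Prop := fun x s t => 0 < Q₃ ((x, s), t) ∧
    Q₃ ((x, s), t) ≤ g₂ * (pS s * (pX x * pU x t)) ∧
      Q₃ ((x, s), t) ≤ 2 * ∑ z ∈ G x s t, Q₄ (((x, s), t), z) with hA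
  refine ⟨A, G, D, ⟨hpX, hpU, hpS, hK, ?_, ?_, ?_, ?_, ?_, hε.le, hθ⟩⟩
  · intro x s t _ z hz
    have h0 : 0 < Q₄ (((x, s), t), z) := (Finset.mem_filter.1 hz).2.1
    obtain ⟨ω, _, hω⟩ := Finset.exists_ne_zero_of_sum_ne_zero h0.ne'
    simp only [ne_eq, ite_eq_right_iff, Classical.not_imp, Prod.mk.injEq] at hω
    obtain ⟨⟨⟨⟨rfl, rfl⟩, rfl⟩, rfl⟩, hω⟩ := hω
    exact hF ω ((hp.1 ω).lt_of_ne' hω)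
  · intro x s t _ z hz
    exact (Finset.mem_filter.1 hz).2.2.2
  · intro y
    simp only
    -- on `D`, the product law of `(x, t)` and `y` is at most `1 / g₁` times the joint law
    have key : (∑ x, pX x * ∑ t, pU x t * ind (D x t y)) * (g₁ * law p Y y) ≤ law p Y y := by
      refine le_trans ?_ (sum_law_fst p (fun ω => (X ω, T ω)) Y y).le
      rw [Fintype.sum_prod_type, Finset.sum_mul]
      refine Finset.sum_le_sum fun x _ => ?_
      rw [Finset.mul_sum, Finset.sum_mul]
      refine Finset.sum_le_sum fun t _ => ?_
      by_cases h : D x t y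
      · rw [ind_of h]
        have := (not_le.1 h).le
        linarith
      · rw [ind_of_not h]
        simpa using law_nonneg hp.1 _ _
    rcases (law_nonneg hp.1 Y y).eq_or_lt with h0 | h0
    · have : ∀ x t, pU x t * ind (D x t y) = 0 := fun x t => by
        rw [ind_of_not, mul_zero]
        have hle : law p (fun ω => ((X ω, T ω), Y ω)) ((x, t), y) ≤ law p Y y :=
          law_le_law_of_imp hp.1 fun ω hω => by simp only [Prod.mk.injEq] at hω; exact hω.2
        rw [hD]
        simp only [not_not]
        rw [← h0] at hle ⊢
        simpa using hle
      simp only [this, Finset.sum_const_zero, mul_zero]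
      positivity
    · rw [le_div_iff₀ hg₁]
      refine le_of_mul_le_mul_right ?_ h0
      linarith
  · simp only
    -- the mass of the triples that are not admissible, by Markov's inequality: the factor 2 comes
    -- from the half of the conditional mass, and `1 / ε` from the bound on the degradation
    have hrej : ∑ w : (𝒳 × 𝒮) × 𝒯, Q₃ w * ind (¬A w.1.1 w.1.2 w.2) ≤
        e + 2 * (e + 1 / ε * e) := by
      have hpt : ∀ w : (𝒳 × 𝒮) × 𝒯, Q₃ w * ind (¬A w.1.1 w.1.2 w.2) ≤
          Q₃ w * ind (g₂ * (pS w.1.2 * (pX w.1.1 * pU w.1.1 w.2)) < Q₃ w) +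
          2 * (∑ z, Q₄ (w, z) * ind (Q₃ w < g₃ * Q₄ (w, z)) +
            1 / ε * ∑ z, Q₄ (w, z) * ∑ y, K z y * ind (¬D w.1.1 w.2 y)) := by
        rintro ⟨⟨x, s⟩, t⟩
        have hn1 : 0 ≤ ∑ z, Q₄ (((x, s), t), z) * ind (Q₃ ((x, s), t) < g₃ * Q₄ (((x, s), t), z)) :=
          Finset.sum_nonneg fun z _ => mul_nonneg (hQ₄0 _) (ind_nonneg _)
        have hn0 : ∀ z, 0 ≤ ∑ y, K z y * ind (¬D x t y) := fun z =>
          Finset.sum_nonneg fun y _ => mul_nonneg ((hK z).1 y) (ind_nonneg _)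
        have hn2 : 0 ≤ 1 / ε * ∑ z, Q₄ (((x, s), t), z) * ∑ y, K z y * ind (¬D x t y) :=
          mul_nonneg (by positivity) (Finset.sum_nonneg fun z _ => mul_nonneg (hQ₄0 _) (hn0 z))
        simp only
        by_cases hAx : A x s t
        · rw [ind_of_not (not_not.2 hAx), mul_zero]
          have := mul_nonneg (hQ₃0 ((x, s), t))
            (ind_nonneg (g₂ * (pS s * (pX x * pU x t)) < Q₃ ((x, s), t)))
          linarith
        rw [ind_of hAx, mul_one]
        by_cases hB : g₂ * (pS s * (pX x * pU x t)) < Q₃ ((x, s), t)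
        · rw [ind_of hB]
          linarith
        rw [ind_of_not hB, mul_zero, zero_add]
        rcases (hQ₃0 ((x, s), t)).eq_or_lt with h0 | h0
        · rw [← h0] at hn1 ⊢
          linarith
        have hC : 2 * ∑ z ∈ G x s t, Q₄ (((x, s), t), z) < Q₃ ((x, s), t) := by
          by_contra! hC
          exact hAx ⟨h0, not_lt.1 hB, hC⟩
        have hsplit : Q₃ ((x, s), t) = ∑ z ∈ G x s t, Q₄ (((x, s), t), z) +
            ∑ z ∈ (G x s t)ᶜ, Q₄ (((x, s), t), z) := by
          rw [Finset.sum_add_sum_compl, hQ₄s]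
        have hcompl : ∑ z ∈ (G x s t)ᶜ, Q₄ (((x, s), t), z) ≤
            ∑ z, Q₄ (((x, s), t), z) * ind (Q₃ ((x, s), t) < g₃ * Q₄ (((x, s), t), z)) +
            1 / ε * ∑ z, Q₄ (((x, s), t), z) * ∑ y, K z y * ind (¬D x t y) := by
          have hn : ∀ z, 0 ≤ Q₄ (((x, s), t), z) *
              ind (Q₃ ((x, s), t) < g₃ * Q₄ (((x, s), t), z)) +
              1 / ε * (Q₄ (((x, s), t), z) * ∑ y, K z y * ind (¬D x t y)) := fun z =>
            add_nonneg (mul_nonneg (hQ₄0 _) (ind_nonneg _))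
              (mul_nonneg (by positivity) (mul_nonneg (hQ₄0 _) (hn0 z)))
          rw [Finset.mul_sum, ← Finset.sum_add_distrib]
          refine le_trans (Finset.sum_le_sum fun z hz => ?_)
            (Finset.sum_le_sum_of_subset_of_nonneg (Finset.subset_univ _) fun z _ _ => hn z)
          by_cases h1 : Q₃ ((x, s), t) < g₃ * Q₄ (((x, s), t), z)
          · rw [ind_of h1, mul_one]
            exact le_add_of_nonneg_right
              (mul_nonneg (by positivity) (mul_nonneg (hQ₄0 _) (hn0 z)))
          rw [ind_of_not h1, mul_zero, zero_add]
          rcases (hQ₄0 (((x, s), t), z)).eq_or_lt with h2 | h2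
          · rw [← h2]; simp
          have h3 : ε < ∑ y, K z y * ind (¬D x t y) := by
            by_contra! h3
            exact (Finset.mem_compl.1 hz)
              (Finset.mem_filter.2 ⟨Finset.mem_univ z, h2, not_lt.1 h1, h3⟩)
          rw [one_div, le_inv_mul_iff₀ hε]
          nlinarith
        linarith
      refine (Finset.sum_le_sum fun w _ => hpt w).trans ?_
      rw [Finset.sum_add_distrib, ← Finset.mul_sum, Finset.sum_add_distrib, ← Finset.mul_sum]
      have e1 : ∑ w : (𝒳 × 𝒮) × 𝒯,
          Q₃ w * ind (g₂ * (pS w.1.2 * (pX w.1.1 * pU w.1.1 w.2)) < Q₃ w) ≤ e :=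
        (sum_law_mul p _ fun w : (𝒳 × 𝒮) × 𝒯 =>
          ind (g₂ * (pS w.1.2 * (pX w.1.1 * pU w.1.1 w.2)) < Q₃ w)).trans_le h₂
      have e2 : ∑ w : (𝒳 × 𝒮) × 𝒯, ∑ z, Q₄ (w, z) * ind (Q₃ w < g₃ * Q₄ (w, z)) ≤ e := by
        rw [← Fintype.sum_prod_type fun i : ((𝒳 × 𝒮) × 𝒯) × 𝒵 => Q₄ i * ind (Q₃ i.1 < g₃ * Q₄ i)]
        exact (sum_law_mul p _ fun i : ((𝒳 × 𝒮) × 𝒯) × 𝒵 =>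
          ind (Q₃ i.1 < g₃ * Q₄ i)).trans_le h₃
      have e3 : ∑ w : (𝒳 × 𝒮) × 𝒯, ∑ z, Q₄ (w, z) * ∑ y, K z y * ind (¬D w.1.1 w.2 y) ≤ e := by
        have := sum_law_mul p (fun ω => ((((X ω, S ω), T ω), Z ω), Y ω)) fun i =>
          ind (¬D i.1.1.1.1 i.1.1.2 i.2)
        rw [Fintype.sum_prod_type, Fintype.sum_prod_type] at this
        simp only [hY] at this
        refine le_trans (le_of_eq ?_) (this.trans_le ?_)
        · refine Finset.sum_congr rfl fun w _ => Finset.sum_congr rfl fun z _ => ?_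
          rw [Finset.mul_sum]
          exact Finset.sum_congr rfl fun y _ => by ring
        · simpa only [hD, not_not] using h₁
      have e4 : 1 / ε * ∑ w : (𝒳 × 𝒮) × 𝒯, ∑ z, Q₄ (w, z) *
          ∑ y, K z y * ind (¬D w.1.1 w.2 y) ≤ 1 / ε * e :=
        mul_le_mul_of_nonneg_left e3 (by positivity)
      linarith
    -- where `(x, s)` has positive mass, an auxiliary codeword is admissible with probability at
    -- least `1 / g₂` times the conditional mass of the admissible triples
    have hpt : ∀ x s, pX x * (pS s * (∑ t, pU x t * ind (¬A x s t)) ^ L) ≤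
        ∑ t, Q₃ ((x, s), t) * ind (¬A x s t) +
          pX x * (pS s * Real.exp (-(L * (1 / g₂)))) := by
      intro x s
      have hc : ∑ t, Q₃ ((x, s), t) * ind (¬A x s t) =
          pX x * pS s - ∑ t, Q₃ ((x, s), t) * ind (A x s t) := by
        rw [← hQ₃s, ← Finset.sum_sub_distrib]
        exact Finset.sum_congr rfl fun t _ => by rw [ind_not]; ring
      have hu : ∑ t, pU x t * ind (¬A x s t) = 1 - ∑ t, pU x t * ind (A x s t) := by
        rw [← (hpU x).2, ← Finset.sum_sub_distrib]
        exact Finset.sum_congr rfl fun t _ => by rw [ind_not]; ring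
      have hn : 0 ≤ ∑ t, Q₃ ((x, s), t) * ind (¬A x s t) :=
        Finset.sum_nonneg fun t _ => mul_nonneg (hQ₃0 _) (ind_nonneg _)
      have hn' : 0 ≤ ∑ t, Q₃ ((x, s), t) * ind (A x s t) :=
        Finset.sum_nonneg fun t _ => mul_nonneg (hQ₃0 _) (ind_nonneg _)
      rcases (mul_nonneg (hpX.1 x) (hpS.1 s)).eq_or_lt with h0 | h0
      · rw [← mul_assoc, ← mul_assoc, ← h0]
        simpa using hn
      set a := ∑ t, Q₃ ((x, s), t) * ind (A x s t) with ha
      have hle : a ≤ g₂ * (pX x * pS s) * ∑ t, pU x t * ind (A x s t) := by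
        rw [ha, Finset.mul_sum]
        refine Finset.sum_le_sum fun t _ => ?_
        by_cases h : A x s t
        · rw [ind_of h]
          have := h.2.1
          linarith
        · rw [ind_of_not h]; simp
      have := pow_le_one_sub_add_exp (u := ∑ t, pU x t * ind (¬A x s t)) (c := 1 / g₂)
        (y := a / (pX x * pS s))
        (Finset.sum_nonneg fun t _ => mul_nonneg ((hpU x).1 t) (ind_nonneg _))
        (by
          rw [hu, one_div, inv_mul_eq_div, div_div]
          refine sub_le_sub_left ((div_le_iff₀ (mul_pos h0 hg₂)).2 ?_) 1
          linarith) (by positivity) ((div_le_one h0).2 (by linarith)) L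
      have h2 := mul_le_mul_of_nonneg_left this h0.le
      have h3 : pX x * pS s * (1 - a / (pX x * pS s) + Real.exp (-(L * (1 / g₂)))) =
          pX x * pS s - a + pX x * (pS s * Real.exp (-(L * (1 / g₂)))) := by
        rw [mul_add, mul_sub, mul_div_cancel₀ _ h0.ne']
        ring
      rw [hc]
      linarith
    calc _ = ∑ x, ∑ s, pX x * (pS s * (∑ t, pU x t * ind (¬A x s t)) ^ L) :=
          Finset.sum_congr rfl fun x _ => Finset.mul_sum _ _ _
      _ ≤ ∑ x, ∑ s, (∑ t, Q₃ ((x, s), t) * ind (¬A x s t) +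
          pX x * (pS s * Real.exp (-(L * (1 / g₂))))) :=
          Finset.sum_le_sum fun x _ => Finset.sum_le_sum fun s _ => hpt x s
      _ = ∑ w : (𝒳 × 𝒮) × 𝒯, Q₃ w * ind (¬A w.1.1 w.1.2 w.2) +
          Real.exp (-(L * (1 / g₂))) := by
          simp_rw [Finset.sum_add_distrib, ← Finset.mul_sum, ← Finset.sum_mul, hpS.2, hpX.2,
            one_mul, Fintype.sum_prod_type]
      _ ≤ _ := add_le_add_left hrej _
  -- the good outputs carry half of the mass, and each of them at most `1 / g₃` of it
  · intro x s t hAx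
    obtain ⟨h0, _, h2⟩ := hAx
    have hpos : 0 < ∑ z ∈ G x s t, Q₄ (((x, s), t), z) := by linarith
    refine hcol _ (Finset.card_pos.2 (Finset.nonempty_of_sum_ne_zero hpos.ne')) ?_
    have hle : ∑ z ∈ G x s t, g₃ * Q₄ (((x, s), t), z) ≤ ∑ _z ∈ G x s t, Q₃ ((x, s), t) :=
      Finset.sum_le_sum fun z hz => (Finset.mem_filter.1 hz).2.2.1
    rw [← Finset.mul_sum, Finset.sum_const, nsmul_eq_mul] at hle
    have h3 : g₃ * Q₃ ((x, s), t) ≤ g₃ * (2 * ∑ z ∈ G x s t, Q₄ (((x, s), t), z)) :=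
      mul_le_mul_of_nonneg_left h2 hg₃.le
    refine le_of_mul_le_mul_right ?_ h0
    simp only
    linarith

/-! ### Concentration of information densities -/

/-- A product of i.i.d. likelihood ratios `a / b` is exponentially close to its typical value. -/
theorem eventually_sum_ind_le {Ω : Type*} [Fintype Ω] {p : Ω → ℝ} (hp : p ∈ stdSimplex ℝ Ω)
    {a b : Ω → ℝ} (ha : ∀ ω, 0 < p ω → 0 < a ω) (hb : ∀ ω, 0 < p ω → 0 < b ω) {m : ℝ}
    (hm : ∑ ω, p ω * (Real.logb 2 (a ω) - Real.logb 2 (b ω)) = m) {d e : ℝ} (hd : 0 < d)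
    (he : 0 < e) :
    ∀ᶠ n : ℕ in Filter.atTop, ∑ ω : Fin n → Ω, (∏ i, p (ω i)) *
      ind (∏ i, a (ω i) ≤ (2 : ℝ) ^ (n * (m - d)) * ∏ i, b (ω i)) ≤ e := by
  classical
  set C := ∑ ω, p ω * (Real.logb 2 (a ω) - Real.logb 2 (b ω) - m) ^ 2 with hC
  have hlim : Filter.Tendsto (fun n : ℕ => C / (n * d ^ 2)) Filter.atTop (𝓝 0) := by
    have := tendsto_const_div_atTop_nhds_zero_nat (C / d ^ 2)
    refine this.congr fun n => ?_
    rw [div_div, mul_comm (d ^ 2)]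
  filter_upwards [hlim.eventually_le_const he, Filter.eventually_gt_atTop 0] with n hn hn0
  refine le_trans (le_trans (le_of_eq ?_) (sum_deviation_le hp
    (fun ω => Real.logb 2 (a ω) - Real.logb 2 (b ω)) hm hd hn0
    (fun ω => ∏ i, a (ω i) ≤ (2 : ℝ) ^ (n * (m - d)) * ∏ i, b (ω i)) ?_)) hn
  · refine Finset.sum_congr rfl fun ω _ => ?_
    unfold ind
    split_ifs <;> simp
  · intro ω hω hE
    have hpos : ∀ i, 0 < p (ω i) := fun i => (hp.1 _).lt_of_ne' fun h0 =>
      hω.ne' (Finset.prod_eq_zero (Finset.mem_univ i) h0)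
    have hA : 0 < ∏ i, a (ω i) := Finset.prod_pos fun i _ => ha _ (hpos i)
    have hB : 0 < ∏ i, b (ω i) := Finset.prod_pos fun i _ => hb _ (hpos i)
    have h2 := Real.logb_le_logb_of_le one_lt_two hA hE
    rw [Real.logb_mul (by positivity) hB.ne', Real.logb_rpow two_pos (by norm_num),
      Real.logb_prod _ _ fun i _ => (ha _ (hpos i)).ne',
      Real.logb_prod _ _ fun i _ => (hb _ (hpos i)).ne'] at h2
    rw [Finset.sum_sub_distrib]
    refine le_trans ?_ (neg_le_abs _)
    linarith

/-- The mean of `log (P(a) P(b) / P(c))` as a combination of entropies. -/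
theorem sum_logb_sub_logb_mul {Ω α β γ : Type*} [Fintype Ω] [Fintype α] [Fintype β] [Fintype γ]
    {p : Ω → ℝ} (hp : ∀ ω, 0 ≤ p ω) (A : Ω → α) (B : Ω → β) (C : Ω → γ) :
    ∑ ω, p ω * (Real.logb 2 (law p A (A ω)) -
      Real.logb 2 (law p B (B ω) * law p C (C ω))) =
      entropy p B + entropy p C - entropy p A := by
  rw [entropy_eq, entropy_eq, entropy_eq]
  have : ∀ ω, p ω * (Real.logb 2 (law p A (A ω)) -
      Real.logb 2 (law p B (B ω) * law p C (C ω))) = p ω * Real.logb 2 (law p A (A ω)) -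
      p ω * Real.logb 2 (law p B (B ω)) - p ω * Real.logb 2 (law p C (C ω)) := fun ω => by
    rcases (hp ω).eq_or_lt with h0 | h0
    · rw [← h0]; ring
    · rw [Real.logb_mul (law_pos hp B h0).ne' (law_pos hp C h0).ne']; ring
  rw [Finset.sum_congr rfl fun ω _ => this ω, Finset.sum_sub_distrib, Finset.sum_sub_distrib]
  ring

/-! ### Degraded semideterministic channels -/

section Deterministic

variable {X₁ X₂ S Y Z T : Type*} [Fintype X₁] [Fintype X₂] [Fintype S] [Fintype Y] [Fintype Z]
  [Fintype T] {ch : Channel X₁ X₂ S Y Z} {pX : X₁ → ℝ} {q : S → X₁ → T × X₂ → ℝ}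

/-- In a degraded semideterministic channel `Z` is a function of `(X₁, X₂, S)`, and `Y` is obtained
from `Z` through a channel. -/
theorem exists_deterministic {X₁ X₂ S Y Z : Type*} [Fintype S] [Fintype Y] [Fintype Z]
    {ch : Channel X₁ X₂ S Y Z} (hdeg : ch.IsDegraded) (hdet : ch.IsSemideterministic) :
    ∃ (f : X₁ → X₂ → S → Z) (K : Z → Y → ℝ), (∀ z, K z ∈ stdSimplex ℝ Y) ∧
      (∀ x x₂ s y z, ch.trans x x₂ s (y, z) = ch.transZ x x₂ s z * K z y) ∧
      ∀ x x₂ s z, ch.transZ x x₂ s z = ind (f x x₂ s = z) := by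
  classical
  obtain ⟨K, hK, htr⟩ := hdeg
  have hsum : ∀ x x₂ s, ∑ z, ch.transZ x x₂ s z = 1 := fun x x₂ s => by
    rw [← (ch.trans_mem x x₂ s).2, Fintype.sum_prod_type_right]
    rfl
  have hex : ∀ x x₂ s, ∃ z, ch.transZ x x₂ s z = 1 := by
    intro x x₂ s
    by_contra! h
    have := hsum x x₂ s
    rw [Finset.sum_eq_zero fun z _ => (hdet x x₂ s z).resolve_right (h z)] at this
    exact zero_ne_one this
  choose f hf using hex
  refine ⟨f, K, hK, htr, fun x x₂ s z => ?_⟩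
  by_cases h : f x x₂ s = z
  · rw [ind_of h, ← h, hf]
  · rw [ind_of_not h]
    refine (hdet x x₂ s z).resolve_right fun h1 => ?_
    have h2 : ∑ z' ∈ {f x x₂ s, z}, ch.transZ x x₂ s z' ≤ ∑ z', ch.transZ x x₂ s z' :=
      Finset.sum_le_sum_of_subset_of_nonneg (Finset.subset_univ _) fun z' _ _ => by
        rcases hdet x x₂ s z' with h | h <;> simp [h]
    rw [Finset.sum_pair h, hf, h1, hsum] at h2
    norm_num at h2

theorem law_jointLaw_input_state (h : (pX, q) ∈ inputLaws X₁ X₂ S T) (x : X₁) (s : S) :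
    law (ch.jointLaw pX q) (fun ω => (ω.1, ω.2.1)) (x, s) = pX x * ch.stateLaw s := by
  have h1 : ∀ x₂, ∑ y, ∑ z, ch.trans x x₂ s (y, z) = 1 := fun x₂ => by
    rw [← Fintype.sum_prod_type']; exact (ch.trans_mem x x₂ s).2
  have h2 : ∑ t, ∑ x₂, q s x (t, x₂) = 1 := by
    rw [← Fintype.sum_prod_type']; exact (h.2 s x).2
  have h3 : ∀ b, law (ch.jointLaw pX q) (fun ω => ((ω.1, ω.2.1), ω.2.2)) ((x, s), b) =
      ch.jointLaw pX q (x, s, b) := fun b => by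
    conv_rhs => rw [← law_id (ch.jointLaw pX q)]
    exact law_congr fun ω => by
      obtain ⟨x', s', b'⟩ := ω
      simp [and_assoc]
  rw [← sum_law_snd (ch.jointLaw pX q) (fun ω => (ω.1, ω.2.1)) (fun ω => ω.2.2) (x, s),
    Finset.sum_congr rfl fun b _ => h3 b]
  simp only [Channel.jointLaw, Fintype.sum_prod_type, ← Finset.mul_sum, h1, mul_one, h2]

/-- Given `(X₁, S, T, Z)`, the law of `Y` is `K Z`. -/
theorem law_jointLaw_output {K : Z → Y → ℝ} (hK : ∀ z, K z ∈ stdSimplex ℝ Y)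
    (htr : ∀ x x₂ s y z, ch.trans x x₂ s (y, z) = ch.transZ x x₂ s z * K z y)
    (w : ((X₁ × S) × T) × Z) (y : Y) :
    law (ch.jointLaw pX q)
      (fun ω => ((((ω.1, ω.2.1), ω.2.2.1), ω.2.2.2.2.2), ω.2.2.2.2.1)) (w, y) =
      law (ch.jointLaw pX q) (fun ω => (((ω.1, ω.2.1), ω.2.2.1), ω.2.2.2.2.2)) w * K w.2 y := by
  have := law_of_kernel (law_output_eq (pX := pX) (q := q) hK htr)
    (g := fun w => (((w.1, w.2.1), w.2.2.1), w.2.2.2.2)) (ξ := fun a => a.2) (fun _ => rfl) y w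
  rw [mul_comm, ← this]
  exact law_congr fun ω => by
    simp only [Prod.mk.injEq]
    tauto

/-- Almost surely `Z` is the output of the deterministic channel `f`. -/
theorem eq_of_jointLaw_pos {X₁ X₂ S Y Z T : Type*} [Fintype S] [Fintype Y] [Fintype Z]
    {ch : Channel X₁ X₂ S Y Z} {pX : X₁ → ℝ} {q : S → X₁ → T × X₂ → ℝ} {f : X₁ → X₂ → S → Z}
    {K : Z → Y → ℝ} (htr : ∀ x x₂ s y z, ch.trans x x₂ s (y, z) = ch.transZ x x₂ s z * K z y)
    (hf : ∀ x x₂ s z, ch.transZ x x₂ s z = ind (f x x₂ s = z))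
    {ω : X₁ × S × T × X₂ × Y × Z} (h : 0 < ch.jointLaw pX q ω) :
    f ω.1 ω.2.2.2.1 ω.2.1 = ω.2.2.2.2.2 := by
  by_contra hne
  obtain ⟨x, s, t, x₂, y, z⟩ := ω
  simp only [Channel.jointLaw, htr, hf, ind_of_not hne, zero_mul, mul_zero, lt_irrefl] at h

/-- The conditional law of `T` given `X₁`, chosen as the law of `T` where `X₁ = x` has probability
zero. -/
theorem exists_condLaw (h : (pX, q) ∈ inputLaws X₁ X₂ S T) : ∃ pU : X₁ → T → ℝ,
    (∀ x, pU x ∈ stdSimplex ℝ T) ∧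
    ∀ x t, law (ch.jointLaw pX q) (fun ω => (ω.1, ω.2.2.1)) (x, t) = pX x * pU x t := by
  classical
  have hP := jointLaw_mem (ch := ch) h
  set P := ch.jointLaw pX q with hPdef
  have hX : ∀ x, law P (fun ω => ω.1) x = pX x := fun x => by
    rw [← sum_law_snd P (fun ω => ω.1) (fun ω => ω.2.1) x,
      Finset.sum_congr rfl fun s _ => law_jointLaw_input_state h x s, ← Finset.mul_sum,
      ch.stateLaw_mem.2, mul_one]
  have hs : ∀ x, ∑ t, law P (fun ω => (ω.1, ω.2.2.1)) (x, t) = pX x := fun x => by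
    rw [← hX]; exact sum_law_snd P (fun ω => ω.1) (fun ω => ω.2.2.1) x
  have h0 : ∀ x t, 0 ≤ law P (fun ω => (ω.1, ω.2.2.1)) (x, t) := fun x t => law_nonneg hP.1 _ _
  refine ⟨fun x t => if pX x = 0 then law P (fun ω => ω.2.2.1) t else
    law P (fun ω => (ω.1, ω.2.2.1)) (x, t) / pX x, fun x => ?_, fun x t => ?_⟩
  · by_cases hx : pX x = 0
    · simp only [if_pos hx]
      exact law_mem_stdSimplex hP _
    · simp only [if_neg hx]
      exact ⟨fun t => div_nonneg (h0 x t) (h.1.1 x), by rw [← Finset.sum_div, hs, div_self hx]⟩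
  · by_cases hx : pX x = 0
    · rw [hx, zero_mul]
      refine (Finset.sum_eq_zero_iff_of_nonneg fun t _ => h0 x t).1 ?_ t (Finset.mem_univ t)
      rw [hs, hx]
    · simp only
      rw [if_neg hx, mul_div_cancel₀ _ hx]

end Deterministic

/-! ### Random block codes -/

section LawPi

variable {ι Ω α β γ δ ε : Type*} [Fintype ι] [Fintype Ω] (p : Ω → ℝ) (A : Ω → α) (B : Ω → β)
  (C : Ω → γ) (D : Ω → δ) (E : Ω → ε)

theorem law_pi_pair [DecidableEq ι] (a : ι → α) (b : ι → β) :
    law (fun ω : ι → Ω => ∏ i, p (ω i)) (fun ω => (fun i => A (ω i), fun i => B (ω i))) (a, b) =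
      ∏ i, law p (fun ω => (A ω, B ω)) (a i, b i) := by
  rw [← law_pi p (fun ω => (A ω, B ω)) fun i => (a i, b i)]
  exact law_congr fun ω => by simp only [Prod.mk.injEq, funext_iff, forall_and]

theorem law_pi_triple [DecidableEq ι] (a : ι → α) (b : ι → β) (c : ι → γ) :
    law (fun ω : ι → Ω => ∏ i, p (ω i))
      (fun ω => ((fun i => A (ω i), fun i => B (ω i)), fun i => C (ω i))) ((a, b), c) =
      ∏ i, law p (fun ω => ((A ω, B ω), C ω)) ((a i, b i), c i) := by
  rw [← law_pi p (fun ω => ((A ω, B ω), C ω)) fun i => ((a i, b i), c i)]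
  exact law_congr fun ω => by simp only [Prod.mk.injEq, funext_iff, forall_and]

theorem law_pi_quadruple [DecidableEq ι] (a : ι → α) (b : ι → β) (c : ι → γ) (d : ι → δ) :
    law (fun ω : ι → Ω => ∏ i, p (ω i))
      (fun ω => (((fun i => A (ω i), fun i => B (ω i)), fun i => C (ω i)), fun i => D (ω i)))
      (((a, b), c), d) =
      ∏ i, law p (fun ω => (((A ω, B ω), C ω), D ω)) (((a i, b i), c i), d i) := by
  rw [← law_pi p (fun ω => (((A ω, B ω), C ω), D ω)) fun i => (((a i, b i), c i), d i)]
  exact law_congr fun ω => by simp only [Prod.mk.injEq, funext_iff, forall_and]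

theorem law_pi_quintuple [DecidableEq ι] (a : ι → α) (b : ι → β) (c : ι → γ) (d : ι → δ)
    (e : ι → ε) :
    law (fun ω : ι → Ω => ∏ i, p (ω i))
      (fun ω => ((((fun i => A (ω i), fun i => B (ω i)), fun i => C (ω i)), fun i => D (ω i)),
        fun i => E (ω i))) ((((a, b), c), d), e) =
      ∏ i, law p (fun ω => ((((A ω, B ω), C ω), D ω), E ω)) ((((a i, b i), c i), d i), e i) := by
  rw [← law_pi p (fun ω => ((((A ω, B ω), C ω), D ω), E ω))
    fun i => ((((a i, b i), c i), d i), e i)]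
  exact law_congr fun ω => by simp only [Prod.mk.injEq, funext_iff, forall_and]

end LawPi

/-- The random code of block length `n` whose laws and channels are products. -/
def randomBlockCode {X₁ X₂ S Y Z T : Type*} [Fintype S] [Fintype Y] [Fintype Z]
    (ch : Channel X₁ X₂ S Y Z) (pX : X₁ → ℝ) (pU : X₁ → T → ℝ) (f : X₁ → X₂ → S → Z)
    (K : Z → Y → ℝ) (n : ℕ) (A : (Fin n → X₁) → (Fin n → S) → (Fin n → T) → Prop)
    (G : (Fin n → X₁) → (Fin n → S) → (Fin n → T) → Finset (Fin n → Z))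
    (D : (Fin n → X₁) → (Fin n → T) → (Fin n → Y) → Prop) :
    RandomCode (Fin n → X₁) (Fin n → X₂) (Fin n → S) (Fin n → T) (Fin n → Z) (Fin n → Y) where
  pX := fun x => ∏ i, pX (x i)
  pU := fun x t => ∏ i, pU (x i) (t i)
  pS := fun s => ∏ i, ch.stateLaw (s i)
  K := fun z y => ∏ i, K (z i) (y i)
  F := fun x x₂ s i => f (x i) (x₂ i) (s i)
  A := A
  G := G
  D := D

section BlockCode

variable {X₁ X₂ S Y Z T : Type*} [Fintype X₁] [Fintype X₂] [Fintype S] [Fintype Y] [Fintype Z]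
  [Fintype T] {ch : Channel X₁ X₂ S Y Z} {pX : X₁ → ℝ} {q : S → X₁ → T × X₂ → ℝ}
  {f : X₁ → X₂ → S → Z} {K : Z → Y → ℝ}

/-- I.i.d. random codebooks have good ingredients for all large block lengths. The exponents are
`I(X₁T;Y)`, `I(X₁T;S)` and `H(Z|X₁TS)`, up to `d`. -/
theorem eventually_exists_good (hK : ∀ z, K z ∈ stdSimplex ℝ Y)
    (htr : ∀ x x₂ s y z, ch.trans x x₂ s (y, z) = ch.transZ x x₂ s z * K z y)
    (hf : ∀ x x₂ s z, ch.transZ x x₂ s z = ind (f x x₂ s = z))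
    (hu : (pX, q) ∈ inputLaws X₁ X₂ S T) {P : X₁ × S × T × X₂ × Y × Z → ℝ}
    (hPdef : P = ch.jointLaw pX q) {pU : X₁ → T → ℝ} (hpU : ∀ x, pU x ∈ stdSimplex ℝ T)
    (hXT : ∀ x t, law P (fun ω => (ω.1, ω.2.2.1)) (x, t) = pX x * pU x t) {m₁ m₂ m₃ d e : ℝ}
    (hm₁ : m₁ = entropy P (fun ω => (ω.1, ω.2.2.1)) + entropy P (fun ω => ω.2.2.2.2.1) -
      entropy P (fun ω => ((ω.1, ω.2.2.1), ω.2.2.2.2.1)))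
    (hm₂ : m₂ = entropy P (fun ω => ω.2.1) + entropy P (fun ω => (ω.1, ω.2.2.1)) -
      entropy P (fun ω => ((ω.1, ω.2.1), ω.2.2.1)))
    (hm₃ : m₃ = entropy P (fun ω => (((ω.1, ω.2.1), ω.2.2.1), ω.2.2.2.2.2)) -
      entropy P (fun ω => ((ω.1, ω.2.1), ω.2.2.1))) (hd : 0 < d) (he : 0 < e) :
    ∀ᶠ n : ℕ in Filter.atTop, ∀ ε θ : ℝ, 0 < ε → 0 ≤ θ → ∀ M₂ : ℕ,
      (∀ N : ℕ, 1 ≤ N → (2 : ℝ) ^ (n * (m₃ - d)) / 2 ≤ N → (1 - 1 / (M₂ : ℝ)) ^ N ≤ θ) →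
      ∀ L : ℕ, ∃ A G D, (randomBlockCode ch pX pU f K n A G D).Good M₂ L
          (e + 2 * (e + 1 / ε * e) + Real.exp (-(L * (1 / (2 : ℝ) ^ (n * (m₂ + d)))))) θ ε
          (1 / (2 : ℝ) ^ (n * (m₁ - d))) := by
  classical
  have hP : P ∈ stdSimplex ℝ (X₁ × S × T × X₂ × Y × Z) := hPdef ▸ jointLaw_mem hu
  have hXS : ∀ x s, law P (fun ω => (ω.1, ω.2.1)) (x, s) = pX x * ch.stateLaw s := by
    rw [hPdef]; exact law_jointLaw_input_state hu
  have hS : ∀ s, law P (fun ω => ω.2.1) s = ch.stateLaw s := fun s => by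
    rw [← sum_law_fst P (fun ω => ω.1) (fun ω => ω.2.1) s,
      Finset.sum_congr rfl fun x _ => hXS x s, ← Finset.sum_mul, hu.1.2, one_mul]
  have s1 := sum_logb_sub_logb_mul hP.1 (fun ω => ((ω.1, ω.2.2.1), ω.2.2.2.2.1))
    (fun ω => (ω.1, ω.2.2.1)) (fun ω => ω.2.2.2.2.1)
  rw [← hm₁] at s1
  have s2 : ∑ ω, P ω * (Real.logb 2 (law P (fun ω => ω.2.1) ω.2.1 *
      law P (fun ω => (ω.1, ω.2.2.1)) (ω.1, ω.2.2.1)) -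
      Real.logb 2 (law P (fun ω => ((ω.1, ω.2.1), ω.2.2.1)) ((ω.1, ω.2.1), ω.2.2.1))) = -m₂ := by
    rw [hm₂, ← sum_logb_sub_logb_mul hP.1 (fun ω => ((ω.1, ω.2.1), ω.2.2.1)) (fun ω => ω.2.1)
      (fun ω => (ω.1, ω.2.2.1)), ← Finset.sum_neg_distrib]
    exact Finset.sum_congr rfl fun ω _ => by ring
  have s3 : ∑ ω, P ω * (Real.logb 2 (law P (fun ω => ((ω.1, ω.2.1), ω.2.2.1))
      ((ω.1, ω.2.1), ω.2.2.1)) - Real.logb 2 (law P (fun ω => (((ω.1, ω.2.1), ω.2.2.1),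
      ω.2.2.2.2.2)) (((ω.1, ω.2.1), ω.2.2.1), ω.2.2.2.2.2))) = m₃ := by
    rw [hm₃, entropy_eq, entropy_eq]
    simp_rw [mul_sub]
    rw [Finset.sum_sub_distrib]
    ring
  filter_upwards [
    eventually_sum_ind_le hP (fun ω hω => law_pos hP.1 _ hω)
      (fun ω hω => mul_pos (law_pos hP.1 _ hω) (law_pos hP.1 _ hω)) s1 hd he,
    eventually_sum_ind_le hP (fun ω hω => mul_pos (law_pos hP.1 _ hω) (law_pos hP.1 _ hω))
      (fun ω hω => law_pos hP.1 _ hω) s2 hd he,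
    eventually_sum_ind_le hP (fun ω hω => law_pos hP.1 _ hω)
      (fun ω hω => law_pos hP.1 _ hω) s3 hd he] with n h1 h2 h3 ε θ hε hθ M₂ hcol L
  have hpn : (fun ω : Fin n → _ => ∏ i, P (ω i)) ∈ stdSimplex ℝ _ :=
    pi_mem_stdSimplex fun _ : Fin n => hP
  have hnn : ∀ ω : Fin n → _, 0 ≤ ∏ i, P (ω i) := hpn.1
  refine exists_good_randomCode hpn
    (X := fun ω i => (ω i).1) (S := fun ω i => (ω i).2.1) (T := fun ω i => (ω i).2.2.1)
    (Z := fun ω i => (ω i).2.2.2.2.2) (Y := fun ω i => (ω i).2.2.2.2.1)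
    (pi_mem_stdSimplex fun _ => hu.1)
    (fun x => pi_mem_stdSimplex fun i => hpU (x i)) (pi_mem_stdSimplex fun _ => ch.stateLaw_mem)
    (fun z => pi_mem_stdSimplex fun i => hK (z i)) ?_ ?_ ?_ (Real.rpow_pos_of_pos two_pos _)
    (Real.rpow_pos_of_pos two_pos _) (Real.rpow_pos_of_pos two_pos _) hε hθ ?_ ?_ ?_ hcol L
  · intro x s
    rw [law_pi_pair P (fun ω => ω.1) (fun ω => ω.2.1), ← Finset.prod_mul_distrib]
    exact Finset.prod_congr rfl fun i _ => hXS _ _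
  · intro ω hω
    refine ⟨fun i => (ω i).2.2.2.1, funext fun i => ?_⟩
    have hpos : 0 < P (ω i) := (hP.1 _).lt_of_ne' fun h0 =>
      hω.ne' (Finset.prod_eq_zero (Finset.mem_univ i) h0)
    rw [hPdef] at hpos
    exact eq_of_jointLaw_pos htr hf hpos
  · rintro ⟨⟨⟨x, s⟩, t⟩, z⟩ y
    rw [law_pi_quintuple P (fun ω => ω.1) (fun ω => ω.2.1) (fun ω => ω.2.2.1)
      (fun ω => ω.2.2.2.2.2) (fun ω => ω.2.2.2.2.1), law_pi_quadruple P (fun ω => ω.1)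
      (fun ω => ω.2.1) (fun ω => ω.2.2.1) (fun ω => ω.2.2.2.2.2), ← Finset.prod_mul_distrib]
    refine Finset.prod_congr rfl fun i _ => ?_
    rw [hPdef]
    exact law_jointLaw_output hK htr _ _
  · refine le_trans (Finset.sum_le_sum fun ω _ => mul_le_mul_of_nonneg_left
      (ind_le_of_imp (ind_nonneg _) fun h => ?_) (hnn ω)) h1
    rw [ind_of]
    rw [law_pi_triple P (fun ω => ω.1) (fun ω => ω.2.2.1) (fun ω => ω.2.2.2.2.1),
      law_pi P (fun ω => ω.2.2.2.2.1), ← Finset.prod_mul_distrib, ← Finset.prod_mul_distrib] at h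
    simpa only [hXT] using h
  · refine le_trans (Finset.sum_le_sum fun ω _ => mul_le_mul_of_nonneg_left
      (ind_le_of_imp (ind_nonneg _) fun h => ?_) (hnn ω)) h2
    rw [ind_of]
    rw [law_pi_triple P (fun ω => ω.1) (fun ω => ω.2.1) (fun ω => ω.2.2.1),
      ← Finset.prod_mul_distrib, ← Finset.prod_mul_distrib] at h
    simp only [hXT, hS]
    rw [show (n : ℝ) * (-m₂ - d) = -(n * (m₂ + d)) by ring, Real.rpow_neg two_pos.le,
      le_inv_mul_iff₀ (by positivity)]
    exact h.le
  · refine le_trans (Finset.sum_le_sum fun ω _ => mul_le_mul_of_nonneg_left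
      (ind_le_of_imp (ind_nonneg _) fun h => ?_) (hnn ω)) h3
    rw [ind_of]
    rw [law_pi_triple P (fun ω => ω.1) (fun ω => ω.2.1) (fun ω => ω.2.2.1),
      law_pi_quadruple P (fun ω => ω.1) (fun ω => ω.2.1) (fun ω => ω.2.2.1)
      (fun ω => ω.2.2.2.2.2)] at h
    exact h.le

/-- A good random code for the block channel yields a block code. -/
theorem exists_code_of_good {X₁ X₂ S Y Z T : Type*} [Fintype X₁] [Fintype S] [Fintype Y]
    [Fintype Z] [Fintype T] {ch : Channel X₁ X₂ S Y Z} {pX : X₁ → ℝ} {f : X₁ → X₂ → S → Z}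
    {K : Z → Y → ℝ} {n M₁ M₂ L : ℕ} {A : (Fin n → X₁) → (Fin n → S) → (Fin n → T) → Prop}
    {G : (Fin n → X₁) → (Fin n → S) → (Fin n → T) → Finset (Fin n → Z)}
    {D : (Fin n → X₁) → (Fin n → T) → (Fin n → Y) → Prop} {pU : X₁ → T → ℝ} {η θ ε δ : ℝ}
    [Nonempty X₂] (htr : ∀ x x₂ s y z, ch.trans x x₂ s (y, z) = ch.transZ x x₂ s z * K z y)
    (hf : ∀ x x₂ s z, ch.transZ x x₂ s z = ind (f x x₂ s = z))
    (h : (randomBlockCode ch pX pU f K n A G D).Good M₂ L η θ ε δ) (hM₁ : 0 < M₁) (hM₂ : 0 < M₂) :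
    ∃ c : Code X₁ X₂ S Y Z M₁ M₂ n,
      c.errorProb ch ≤ 3 * (η + θ + ε + (M₁ - 1 : ℝ) * (L * δ)) := by
  classical
  obtain ⟨e₁, e₂, d₁, d₂, hle⟩ := RandomCode.exists_code h hM₁ hM₂
  refine ⟨⟨e₁, e₂, d₁, d₂⟩, le_trans (le_of_eq ?_) hle⟩
  unfold Code.errorProb Code.errorProbAt randomBlockCode
  congr 1
  refine Finset.sum_congr rfl fun w₁ _ => Finset.sum_congr rfl fun w₂ _ =>
    Finset.sum_congr rfl fun s _ => ?_
  rw [Finset.mul_sum]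
  refine Finset.sum_congr rfl fun y _ => ?_
  simp only
  have hprod : ∀ z : Fin n → Z, ∏ i, ch.trans (e₁ w₁ i) (e₂ w₁ w₂ s i) (s i) (y i, z i) =
      ind ((fun i => f (e₁ w₁ i) (e₂ w₁ w₂ s i) (s i)) = z) * ∏ i, K (z i) (y i) := fun z => by
    simp only [htr, hf]
    rw [Finset.prod_mul_distrib, prod_ind]
    simp only [funext_iff]
  set z₀ : Fin n → Z := fun i => f (e₁ w₁ i) (e₂ w₁ w₂ s i) (s i) with hz₀
  rw [Finset.sum_eq_single z₀]
  · rw [hprod, ind_of rfl]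
    unfold ind
    split_ifs <;> simp_all
  · intro z _ hz
    rw [hprod, ind_of_not hz.symm]
    simp
  · simp

end BlockCode

/-! ### Achievability -/

theorem nonempty_of_mem_stdSimplex {α : Type*} [Fintype α] {p : α → ℝ}
    (hp : p ∈ stdSimplex ℝ α) : Nonempty α := by
  by_contra h
  rw [not_nonempty_iff] at h
  simpa using hp.2

theorem numMessages_zero (n : ℕ) : numMessages n 0 = 1 := by
  simp [numMessages]

theorem natCeil_two_rpow_le {a : ℝ} (ha : 0 ≤ a) : (⌈(2 : ℝ) ^ a⌉₊ : ℝ) ≤ 2 * (2 : ℝ) ^ a := by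
  have h1 : 1 ≤ (2 : ℝ) ^ a := Real.one_le_rpow one_le_two ha
  linarith [(Nat.ceil_lt_add_one (zero_le_one.trans h1)).le]

theorem tendsto_two_rpow_nat_mul {d : ℝ} (hd : 0 < d) :
    Filter.Tendsto (fun n : ℕ => (2 : ℝ) ^ (n * d)) Filter.atTop Filter.atTop := by
  refine (tendsto_pow_atTop_atTop_of_one_lt (Real.one_lt_rpow one_lt_two hd)).congr fun n => ?_
  rw [← Real.rpow_natCast, ← Real.rpow_mul two_pos.le, mul_comm]

/-- Sequences of near-optimal codes exist as soon as every error level is eventually attained. -/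
theorem exists_seq_tendsto_zero {α : ℕ → Type*} [∀ n, Nonempty (α n)] {g : ∀ n, α n → ℝ}
    (h0 : ∀ n c, 0 ≤ g n c) (h : ∀ κ > 0, ∀ᶠ n in Filter.atTop, ∃ c, g n c ≤ κ) :
    ∃ c : ∀ n, α n, Filter.Tendsto (fun n => g n (c n)) Filter.atTop (𝓝 0) := by
  have hex : ∀ n : ℕ, ∃ c, g n c < sInf (Set.range (g n)) + 1 / ((n : ℝ) + 1) := fun n => by
    obtain ⟨_, ⟨c, rfl⟩, hc⟩ := exists_lt_of_csInf_lt (Set.range_nonempty (g n))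
      (lt_add_of_pos_right (sInf (Set.range (g n))) (Nat.one_div_pos_of_nat (α := ℝ) (n := n)))
    exact ⟨c, hc⟩
  choose c hc using hex
  refine ⟨c, Metric.tendsto_atTop'.2 fun ε hε => ?_⟩
  have h1 := tendsto_one_div_add_atTop_nhds_zero_nat (𝕜 := ℝ)
  obtain ⟨N, hN⟩ := Filter.eventually_atTop.1
    ((h (ε / 2) (half_pos hε)).and (h1.eventually_le_const (half_pos hε)))
  refine ⟨N, fun n hn => ?_⟩
  obtain ⟨⟨c', hc'⟩, hn'⟩ := hN n hn.le
  have h2 : sInf (Set.range (g n)) ≤ g n c' :=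
    csInf_le ⟨0, by rintro _ ⟨c, rfl⟩; exact h0 n c⟩ ⟨c', rfl⟩
  rw [Real.dist_eq, sub_zero, abs_of_nonneg (h0 n _)]
  linarith [hc n]

theorem Code.errorProb_nonneg {X₁ X₂ S Y Z : Type*} [Fintype S] [Fintype Y] [Fintype Z]
    {M₁ M₂ n : ℕ} (c : Code X₁ X₂ S Y Z M₁ M₂ n) (ch : Channel X₁ X₂ S Y Z) :
    0 ≤ c.errorProb ch := by
  refine mul_nonneg (by positivity) (Finset.sum_nonneg fun w₁ _ => Finset.sum_nonneg fun w₂ _ =>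
    Finset.sum_nonneg fun s _ => Finset.sum_nonneg fun y _ => Finset.sum_nonneg fun z _ => ?_)
  split_ifs
  · exact le_rfl
  · exact mul_nonneg (Finset.prod_nonneg fun i _ => ch.stateLaw_mem.1 _)
      (Finset.prod_nonneg fun i _ => (ch.trans_mem _ _ _).1 _)

/-- The colouring of the outputs with `M₂` colours is fine enough. -/
theorem colour_bound {n : ℕ} {r m d : ℝ} (hr : r = 0 ∨ 0 ≤ r ∧ r ≤ m - 2 * d) (N : ℕ) (h1 : 1 ≤ N)
    (hN : (2 : ℝ) ^ (n * (m - d)) / 2 ≤ N) :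
    (1 - 1 / (numMessages n r : ℝ)) ^ N ≤ Real.exp (-((2 : ℝ) ^ (n * d) / 4)) := by
  rcases hr with rfl | ⟨h0, hr⟩
  · rw [numMessages_zero]
    simp only [Nat.cast_one, div_one, sub_self]
    rw [zero_pow (by omega)]
    exact (Real.exp_pos _).le
  have hM1 : (1 : ℝ) ≤ numMessages n r := by exact_mod_cast numMessages_pos n r
  have hM0 : (0 : ℝ) < numMessages n r := by linarith
  have hM : (numMessages n r : ℝ) ≤ 2 * (2 : ℝ) ^ (n * r) := natCeil_two_rpow_le (by positivity)
  have hle : (2 : ℝ) ^ (n * d) * (2 : ℝ) ^ (n * r) ≤ (2 : ℝ) ^ (n * (m - d)) := by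
    rw [← Real.rpow_add two_pos]
    refine Real.rpow_le_rpow_of_exponent_le one_le_two ?_
    rw [← mul_add]
    exact mul_le_mul_of_nonneg_left (by linarith) (Nat.cast_nonneg n)
  have hb : 1 - 1 / (numMessages n r : ℝ) ≤ Real.exp (-(1 / (numMessages n r : ℝ))) := by
    linarith [Real.add_one_le_exp (-(1 / (numMessages n r : ℝ)))]
  calc _ ≤ Real.exp (-(1 / (numMessages n r : ℝ))) ^ N :=
        pow_le_pow_left₀ (sub_nonneg.2 ((div_le_one hM0).2 hM1)) hb N
    _ = Real.exp (-(N / (numMessages n r : ℝ))) := by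
        rw [← Real.exp_nat_mul]; congr 1; ring
    _ ≤ _ := by
        rw [Real.exp_le_exp, neg_le_neg_iff, div_le_div_iff₀ (by norm_num) hM0]
        have := mul_le_mul_of_nonneg_left hM (Real.rpow_pos_of_pos two_pos (n * d)).le
        linarith

/-- Confusions with other messages are rare. -/
theorem confusion_bound {n : ℕ} {r m₁ m₂ d : ℝ} (hr : r = 0 ∨ 0 ≤ r ∧ r ≤ m₁ - m₂ - 4 * d)
    (hm₂ : 0 ≤ m₂) (hd : 0 < d) :
    ((numMessages n r : ℝ) - 1) * ((⌈(2 : ℝ) ^ (n * (m₂ + 2 * d))⌉₊ : ℝ) *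
      (1 / (2 : ℝ) ^ (n * (m₁ - d)))) ≤ 2 / (2 : ℝ) ^ (n * d) := by
  rcases hr with rfl | ⟨h0, hr⟩
  · rw [numMessages_zero, Nat.cast_one, sub_self, zero_mul]
    positivity
  have hM : (numMessages n r : ℝ) - 1 ≤ (2 : ℝ) ^ (n * r) := by
    have := Nat.ceil_lt_add_one (Real.rpow_pos_of_pos two_pos (n * r)).le
    unfold numMessages
    linarith
  have hL : (⌈(2 : ℝ) ^ (n * (m₂ + 2 * d))⌉₊ : ℝ) ≤ 2 * (2 : ℝ) ^ (n * (m₂ + 2 * d)) :=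
    natCeil_two_rpow_le (by positivity)
  calc _ ≤ (2 : ℝ) ^ (n * r) * (2 * (2 : ℝ) ^ (n * (m₂ + 2 * d)) *
        (1 / (2 : ℝ) ^ (n * (m₁ - d)))) :=
        mul_le_mul hM (mul_le_mul_of_nonneg_right hL (by positivity)) (by positivity)
          (by positivity)
    _ = 2 * (2 : ℝ) ^ (n * r + n * (m₂ + 2 * d) - n * (m₁ - d)) := by
        rw [Real.rpow_sub two_pos, Real.rpow_add two_pos]; ring
    _ ≤ 2 * (2 : ℝ) ^ (-(n * d)) := by
        refine mul_le_mul_of_nonneg_left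
          (Real.rpow_le_rpow_of_exponent_le one_le_two ?_) two_pos.le
        have := mul_le_mul_of_nonneg_left hr (Nat.cast_nonneg (α := ℝ) n)
        linarith
    _ = _ := by rw [Real.rpow_neg two_pos.le]; ring

section Achievability

variable {X₁ X₂ S Y Z T : Type*} [Fintype X₁] [Fintype X₂] [Fintype S] [Fintype Y] [Fintype Z]
  [Fintype T] {ch : Channel X₁ X₂ S Y Z}

/-- At rates below the first two bounds, any error level is eventually attained. The margin `4 d`
consists of `d` for the decoding sets, `2 d` for the number of auxiliary codewords, and `d` to let
the probability of confusion vanish; the margin `2 d` consists of `d` for the number of good outputs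
and `d` for the colouring. A rate zero is always admitted, as it means a single message. -/
theorem eventually_exists_code (hdeg : ch.IsDegraded) (hdet : ch.IsSemideterministic)
    {u : (X₁ → ℝ) × (S → X₁ → T × X₂ → ℝ)} (hu : u ∈ inputLaws X₁ X₂ S T) {r₁ r₂ d : ℝ}
    (hd : 0 < d) (h₁ : r₁ = 0 ∨ 0 ≤ r₁ ∧ r₁ ≤ rateOne (ch.jointLaw u.1 u.2) - 4 * d)
    (h₂ : r₂ = 0 ∨ 0 ≤ r₂ ∧ r₂ ≤ rateTwo (ch.jointLaw u.1 u.2) - 2 * d) {κ : ℝ} (hκ : 0 < κ) :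
    ∀ᶠ n : ℕ in Filter.atTop, ∃ c : Code X₁ X₂ S Y Z (numMessages n r₁) (numMessages n r₂) n,
      c.errorProb ch ≤ κ := by
  obtain ⟨f, K, hK, htr, hf⟩ := exists_deterministic hdeg hdet
  obtain ⟨pU, hpU, hXT⟩ := exists_condLaw (ch := ch) hu
  obtain ⟨x⟩ := nonempty_of_mem_stdSimplex hu.1
  obtain ⟨s⟩ := nonempty_of_mem_stdSimplex ch.stateLaw_mem
  have hX₂ : Nonempty X₂ := (nonempty_of_mem_stdSimplex (hu.2 s x)).map Prod.snd
  have hP := jointLaw_mem (ch := ch) hu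
  have hind : entropy (ch.jointLaw u.1 u.2) (fun ω => (ω.1, ω.2.1)) =
      entropy (ch.jointLaw u.1 u.2) (fun ω => ω.1) +
        entropy (ch.jointLaw u.1 u.2) (fun ω => ω.2.1) := by
    have hXS := law_jointLaw_input_state (ch := ch) hu
    refine entropy_of_indep hP _ _ fun x s => ?_
    rw [hXS, ← sum_law_snd (ch.jointLaw u.1 u.2) (fun ω => ω.1) (fun ω => ω.2.1) x,
      ← sum_law_fst (ch.jointLaw u.1 u.2) (fun ω => ω.1) (fun ω => ω.2.1) s,
      Finset.sum_congr rfl fun s _ => hXS x s, Finset.sum_congr rfl fun x _ => hXS x s,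
      ← Finset.mul_sum, ← Finset.sum_mul, hu.1.2, ch.stateLaw_mem.2, mul_one, one_mul]
  obtain ⟨P, hPdef⟩ : ∃ P, P = ch.jointLaw u.1 u.2 := ⟨_, rfl⟩
  rw [← hPdef] at h₁ h₂ hXT hP hind
  obtain ⟨m₁, hm₁⟩ : ∃ m₁, m₁ = entropy P (fun ω => (ω.1, ω.2.2.1)) +
    entropy P (fun ω => ω.2.2.2.2.1) - entropy P (fun ω => ((ω.1, ω.2.2.1), ω.2.2.2.2.1)) :=
    ⟨_, rfl⟩
  obtain ⟨m₂, hm₂⟩ : ∃ m₂, m₂ = entropy P (fun ω => ω.2.1) + entropy P (fun ω => (ω.1, ω.2.2.1)) -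
    entropy P (fun ω => ((ω.1, ω.2.1), ω.2.2.1)) := ⟨_, rfl⟩
  obtain ⟨m₃, hm₃⟩ : ∃ m₃, m₃ = entropy P (fun ω => (((ω.1, ω.2.1), ω.2.2.1), ω.2.2.2.2.2)) -
    entropy P (fun ω => ((ω.1, ω.2.1), ω.2.2.1)) := ⟨_, rfl⟩
  have c1 := entropy_congr P (A := fun ω => (ω.1, ω.2.1, ω.2.2.1))
    (B := fun ω => ((ω.1, ω.2.1), ω.2.2.1)) (by grind)
  have hr₁ : rateOne P = m₁ - m₂ := by
    rw [rateOne, hm₁, hm₂, c1, hind, entropy_congr P (A := fun ω => (ω.1, ω.2.2.1, ω.2.2.2.2.1))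
      (B := fun ω => ((ω.1, ω.2.2.1), ω.2.2.2.2.1)) (by grind)]
    ring
  have hr₂ : rateTwo P = m₃ := by
    rw [rateTwo, hm₃, c1, entropy_congr P (A := fun ω => (ω.1, ω.2.1, ω.2.2.1, ω.2.2.2.2.2))
      (B := fun ω => (((ω.1, ω.2.1), ω.2.2.1), ω.2.2.2.2.2)) (by grind)]
  have hm₂0 : 0 ≤ m₂ := by
    have := entropy_pair_le hP (fun ω => ω.2.1) (fun ω => (ω.1, ω.2.2.1))
    rw [entropy_congr P (A := fun ω => (ω.2.1, ω.1, ω.2.2.1))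
      (B := fun ω => ((ω.1, ω.2.1), ω.2.2.1)) (by grind)] at this
    linarith
  rw [hr₁] at h₁
  rw [hr₂] at h₂
  -- the terms of the error bound are at most `κ / 15` each
  have hκ' : 0 < κ / 15 := by positivity
  have hc : 0 < 3 + 2 / (κ / 15) := by positivity
  have ht := tendsto_two_rpow_nat_mul hd
  have l1 := (Real.tendsto_exp_neg_atTop_nhds_zero.comp ht).eventually_le_const hκ'
  have l2 := (Real.tendsto_exp_neg_atTop_nhds_zero.comp
    (ht.atTop_div_const (r := 4) (by norm_num))).eventually_le_const hκ'
  have l3 := (ht.const_div_atTop 2).eventually_le_const hκ'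
  filter_upwards [eventually_exists_good hK htr hf hu hPdef hpU hXT hm₁ hm₂ hm₃ hd
    (div_pos hκ' hc), l1, l2, l3] with n hgood l1 l2 l3
  simp only [Function.comp_apply] at l1 l2
  obtain ⟨A, G, D, hAGD⟩ := hgood (κ / 15) (Real.exp (-((2 : ℝ) ^ (n * d) / 4))) hκ'
    (Real.exp_pos _).le (numMessages n r₂) (colour_bound h₂) ⌈(2 : ℝ) ^ (n * (m₂ + 2 * d))⌉₊
  obtain ⟨c, hcode⟩ := exists_code_of_good htr hf hAGD (numMessages_pos n r₁)
    (numMessages_pos n r₂)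
  refine ⟨c, hcode.trans ?_⟩
  have b1 := confusion_bound (n := n) h₁ hm₂0 hd
  have b2 : Real.exp (-((⌈(2 : ℝ) ^ (n * (m₂ + 2 * d))⌉₊ : ℝ) *
      (1 / (2 : ℝ) ^ (n * (m₂ + d))))) ≤ κ / 15 := by
    refine le_trans (Real.exp_le_exp.2 (neg_le_neg ?_)) l1
    rw [mul_one_div, le_div_iff₀ (by positivity), ← Real.rpow_add two_pos]
    refine le_trans (le_of_eq ?_) (Nat.le_ceil _)
    congr 1
    ring
  have b3 : κ / 15 / (3 + 2 / (κ / 15)) + 2 * (κ / 15 / (3 + 2 / (κ / 15)) +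
      1 / (κ / 15) * (κ / 15 / (3 + 2 / (κ / 15)))) = κ / 15 := by
    generalize κ / 15 = ε at hκ' hc
    field_simp
    ring
  linarith

theorem achievable_of_lt (hdeg : ch.IsDegraded) (hdet : ch.IsSemideterministic)
    {u : (X₁ → ℝ) × (S → X₁ → T × X₂ → ℝ)} (hu : u ∈ inputLaws X₁ X₂ S T) {r₁ r₂ d : ℝ}
    (hd : 0 < d) (h₁ : r₁ = 0 ∨ 0 ≤ r₁ ∧ r₁ ≤ rateOne (ch.jointLaw u.1 u.2) - 4 * d)
    (h₂ : r₂ = 0 ∨ 0 ≤ r₂ ∧ r₂ ≤ rateTwo (ch.jointLaw u.1 u.2) - 2 * d) :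
    ch.Achievable (r₁, r₂) := by
  refine ⟨h₁.elim (fun h => h.ge) fun h => h.1, h₂.elim (fun h => h.ge) fun h => h.1, ?_⟩
  obtain ⟨x⟩ := nonempty_of_mem_stdSimplex hu.1
  obtain ⟨s⟩ := nonempty_of_mem_stdSimplex ch.stateLaw_mem
  obtain ⟨-, x₂⟩ := nonempty_of_mem_stdSimplex (hu.2 s x)
  have : ∀ n, Nonempty (Code X₁ X₂ S Y Z (numMessages n r₁) (numMessages n r₂) n) := fun n =>
    ⟨⟨fun _ _ => x, fun _ _ _ _ => x₂, fun _ => ⟨0, numMessages_pos n r₁⟩,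
      fun _ => (⟨0, numMessages_pos n r₁⟩, ⟨0, numMessages_pos n r₂⟩)⟩⟩
  exact exists_seq_tendsto_zero
    (α := fun n => Code X₁ X₂ S Y Z (numMessages n r₁) (numMessages n r₂) n)
    (g := fun n c => c.errorProb ch) (fun n c => c.errorProb_nonneg ch)
    fun κ hκ => eventually_exists_code hdeg hdet hu hd h₁ h₂ hκ

theorem rateRegion_subset_capacityRegion (hdeg : ch.IsDegraded) (hdet : ch.IsSemideterministic) :
    ch.rateRegion T ⊆ ch.capacityRegion := by
  intro R hR
  obtain ⟨h1, h2, u, hu, hR1, hR2, -⟩ := mem_rateRegion_iff.1 hR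
  have hlim : Filter.Tendsto (fun d : ℝ => (max (R.1 - 4 * d) 0, max (R.2 - 2 * d) 0))
      (𝓝[>] 0) (𝓝 R) := by
    have hcont : Continuous fun d : ℝ => (max (R.1 - 4 * d) 0, max (R.2 - 2 * d) 0) := by fun_prop
    have := hcont.tendsto 0
    simp only [mul_zero, sub_zero, max_eq_left h1, max_eq_left h2] at this
    exact this.mono_left nhdsWithin_le_nhds
  refine mem_closure_of_tendsto hlim ?_
  filter_upwards [self_mem_nhdsWithin] with d hd
  refine achievable_of_lt hdeg hdet hu hd ?_ ?_
  · rcases le_total (R.1 - 4 * d) 0 with h | h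
    · exact Or.inl (max_eq_right h)
    · rw [max_eq_left h]
      exact Or.inr ⟨h, by linarith⟩
  · rcases le_total (R.2 - 2 * d) 0 with h | h
    · exact Or.inl (max_eq_right h)
    · rw [max_eq_left h]
      exact Or.inr ⟨h, by linarith⟩

end Achievability

end CognitiveIC

end

theorem theorem4 {X₁ X₂ S Y Z : Type*} [Fintype X₁] [Fintype X₂] [Fintype S] [Fintype Y]
    [Fintype Z] (ch : CognitiveIC.Channel X₁ X₂ S Y Z)
    (hdeg : ch.IsDegraded) (hdet : ch.IsSemideterministic) :
    ch.capacityRegion =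
        {R | ∃ k ≤ Fintype.card X₁ * Fintype.card X₂ * Fintype.card S + 1,
          R ∈ ch.rateRegion (Fin k)} ∧
      ch.capacityRegion = {R | ∃ k : ℕ, R ∈ ch.rateRegion (Fin k)} := by
  have hsub : ch.capacityRegion ⊆
      {R | ∃ k ≤ Fintype.card X₁ * Fintype.card X₂ * Fintype.card S + 1,
        R ∈ ch.rateRegion (Fin k)} :=
    closure_minimal (fun R hR => CognitiveIC.mem_iUnion_rateRegion_of_achievable hdeg hR)
      (CognitiveIC.isClosed_iUnion_rateRegion _)
  have hsup : ∀ k : ℕ, ch.rateRegion (Fin k) ⊆ ch.capacityRegion := fun k =>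
    CognitiveIC.rateRegion_subset_capacityRegion hdeg hdet
  refine ⟨hsub.antisymm ?_, Set.Subset.antisymm (fun R hR => ?_) ?_⟩
  · rintro R ⟨k, -, hk⟩
    exact hsup k hk
  · obtain ⟨k, -, hk⟩ := hsub hR
    exact ⟨k, hk⟩
  · rintro R ⟨k, hk⟩
    exact hsup k hk
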